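/- **Setting.** Let $(\mathfrak X,\mathcal X)$ be a measurable space (for instance a topological space with its Borel $\sigma$-algebra), $\lambda$ a measure on it, $\Theta\subset\mathbb R^q$ compact, $k\ge 1$, and let $\{p(x\mid\theta)\}_{\theta\in\Theta}$ be probability densities with respect to $\lambda$, with $P_\theta(dx)=p(x\mid\theta)\,\lambda(dx)$. Let $\mathcal G_k(\Theta)$ (resp. $\mathcal E_k(\Theta)$) be the set of discrete probability distributions on $\Theta$ with at most (resp. exactly) $k$ atoms. For $G=\sum_i p_i\delta_{\theta_i}$ put $P_G=\sum_i p_iP_{\theta_i}$, and let $W_\ell$ be the Wasserstein distance of order $\ell$ for the Euclidean norm. Assume that the mixture model is identifiable on $\mathcal G_k(\Theta)$: $G\mapsto P_G$ is injective there. Write $D^\alpha p(x\mid\theta)$ for the partial derivatives in $\theta$. "$m$ times continuously differentiable on $\Theta$" means that the densities are extended, measurably in $x$, to $\theta$ in an open set $U\supset\Theta$, and that $p(x\mid\cdot)$ is $m$ times continuously differentiable on $U$. *Assumption A2(m).* For $\lambda$-a.e. $x$, $p(x\mid\cdot)$ is $m$ times continuously differentiable on $\Theta$. For every multi-index $\gamma$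 with $|\gamma|\le m-1$, every $i\in\{1,\dots,q\}$ and $\theta\in\Theta$ there are $\delta>0$ and a $\lambda$-integrable $\psi$ such that for all $0<|\Delta|<\delta$ one has $\big|\big(D^\gamma p(x\mid\theta+\Delta e_i)-D^\gamma p(x\mid\theta)\big)/\Delta\big|\le\psi(x)$ for $\lambda$-a.e. $x$. For every $|\gamma|=m$ and $\theta\in\Theta$ there are $\delta'>0$ and a $\lambda$-integrable $\psi'$ such that for all $0<\|\Delta'\|_2<\delta'$ one has $|D^\gamma p(x\mid\theta+\Delta')-D^\gamma p(x\mid\theta)|\le\psi'(x)$ for $\lambda$-a.e. $x$. *$(m,k_0,k)$ linear independence.* For $\lambda$-a.e. $x$, $p(x\mid\cdot)$ is $m$ times continuously differentiable on $\Theta$; and for every integer $\ell\in[k_0,2k-k_0]$, all integers $m_1,\dots,m_\ell\in[1,m+1]$ with $\sum_i m_i\in[2k_0,2k]$, all distinct $\theta_1,\dots,\theta_\ell\in\Theta$ and all real coefficients $a_{i\alpha}$: if $\sum_{i=1}^{\ell}\sum_{|\alpha|\le m_i-1}a_{i\alpha}D^\alpha p(x\mid\theta_i)=0$ for $\lambda$-a.e.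 $x$ and $\sum_{i=1}^{\ell} a_{i\mathbf 0}=0$, then $a_{i\alpha}=0$ for all $i$ and all $|\alpha|<m_i$. *Kernels.* Let $\ker$ be a symmetric positive semidefinite kernel on $\mathfrak X$ with reproducing kernel Hilbert space $\mathcal H$. Suppose that it is measurable (each $\ker(\cdot,x)$ is measurable) and bounded, $\|\ker\|_\infty:=\sup_x\sqrt{\ker(x,x)}<\infty$, and that $\mu(Q)=\int\ker(\cdot,y)\,dQ(y)$ is injective on the finite signed measures on $(\mathfrak X,\mathcal X)$. Put $D_{\mathrm{MMD}}(P,Q)=\sup_{\|h\|_{\mathcal H}\le1}|\int h\,dP-\int h\,dQ|$ and let $\Phi_1=\{\theta\mapsto\int h\,dP_\theta:\ h\in\mathcal H,\ \|h\|_{\mathcal H}\le 1\}$, a class of functions on $\Theta$. For $n\ge1$ and a sample $X_1,\dots,X_n$ with empirical measure $\hat P_n=\frac1n\sum_i\delta_{X_i}$, a minimum MMD estimator $\hat G_n$ is any function of the sample with $\hat G_n\in\operatorname{argmin}_{G'\in\mathcal G_k(\Theta)}D_{\mathrm{MMD}}(P_{G'},\hat P_n)$. $\mathbb E_{G^*}$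 denotes the (outer, if need be) expectation when $X_1,\dots,X_n$ are i.i.d. with law $P_{G^*}$. **Theorem 5.** (a) Suppose that the density family satisfies A2$(2k-1)$ and is $(2k-1,1,k)$ linear independent. Then there is a constant $C$, which depends only on $\Theta$, $k$, $\{P_\theta\}$ and the class $\Phi_1$ (so on the kernel only through $\Phi_1$, and not on $n$ or on the choice of $\hat G_n$), such that for every $n\ge1$ and every minimum MMD estimator $\hat G_n$, $$\sup_{G^*\in\mathcal G_k(\Theta)}\mathbb E_{G^*}W_{2k-1}^{2k-1}(G^*,\hat G_n)\le C\,\frac{\|\ker\|_\infty}{\sqrt n}.$$ (b) Let $1\le k_0\le k$ and $d_1=k-k_0+1$, and suppose that the density family satisfies A2$(2d_1-1)$ and is $(2d_1-1,k_0,k)$ linear independent. Then for every $G_0\in\mathcal E_{k_0}(\Theta)$ there are $r(G_0)>0$ and $C(G_0)$, which depend only on $G_0$, $\Theta$, $k_0$, $k$, $\{P_\theta\}$ and $\Phi_1$, such that for every $n\ge1$ and every minimum MMD estimator $\hat G_n$, $$\sup_{G^*\in\mathcal G_k(\Theta):\,W_1(G_0,G^*)<r(G_0)}\mathbb E_{G^*}W_{2d_1-1}^{2d_1-1}(G^*,\hat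 G_n)\le C(G_0)\,\frac{\|\ker\|_\infty}{\sqrt n}.$$ -/

import Mathlib

open MeasureTheory
open scoped ENNReal

noncomputable section

namespace MMDMixture

/-- The ambient Euclidean space `ℝ^q` of the parameters. -/
abbrev Par (q : ℕ) : Type := EuclideanSpace ℝ (Fin q)

/-! ### Mixing measures and the Wasserstein distance -/

/-- Discrete probability distributions on `Θ` with at most `k` atoms. The distribution
`∑ p_i δ_{θ_i}` is encoded by its weight function `θ ↦ p_θ`, which has finite support. -/
def mixAtMost {q : ℕ} (Θ : Set (Par q)) (k : ℕ) : Set (Par q →₀ ℝ) :=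
  {G | (∀ θ ∈ G.support, θ ∈ Θ) ∧ (∀ θ, 0 ≤ G θ) ∧ ∑ θ ∈ G.support, G θ = 1 ∧
    G.support.card ≤ k}

/-- Discrete probability distributions on `Θ` with exactly `k` atoms. -/
def mixExactly {q : ℕ} (Θ : Set (Par q)) (k : ℕ) : Set (Par q →₀ ℝ) :=
  {G | G ∈ mixAtMost Θ k ∧ G.support.card = k}

/-- Couplings of `G` and `H`: matrices of non-negative weights, indexed by the atoms of `G` and
those of `H`, with the prescribed marginals. -/
def IsCoupling {q : ℕ} (G H : Par q →₀ ℝ) (c : Par q → Par q → ℝ) : Prop :=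
  (∀ a b, 0 ≤ c a b) ∧
  (∀ a ∈ G.support, ∑ b ∈ H.support, c a b = G a) ∧
  (∀ b ∈ H.support, ∑ a ∈ G.support, c a b = H b)

/-- The Wasserstein distance of order `l` with respect to the Euclidean distance. -/
def wasserstein {q : ℕ} (l : ℕ) (G H : Par q →₀ ℝ) : ℝ :=
  (sInf {s : ℝ | ∃ c, IsCoupling G H c ∧
    s = ∑ a ∈ G.support, ∑ b ∈ H.support, c a b * ‖a - b‖ ^ l}) ^ (1 / (l : ℝ))

/-! ### Partial derivatives in the parameter -/

/-- The partial derivative in the `i`-th coordinate. -/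
def partialD {q : ℕ} (i : Fin q) (f : Par q → ℝ) : Par q → ℝ :=
  fun θ => lineDeriv ℝ f θ (EuclideanSpace.single i 1)

/-- The partial derivative `D^α`, of order `α i` in the `i`-th coordinate. -/
def multiD {q : ℕ} (α : Fin q → ℕ) (f : Par q → ℝ) : Par q → ℝ :=
  (List.finRange q).foldr (fun i g => (partialD i)^[α i] g) f

/-- The multi-indices `α` with `|α| ≤ m`. -/
def multiIdx (q m : ℕ) : Finset (Fin q → ℕ) :=
  (Fintype.piFinset fun _ : Fin q => Finset.range (m + 1)).filter fun α => ∑ i, α i ≤ m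

/-! ### The density family -/

section family

variable {X : Type*} [MeasurableSpace X] {q : ℕ}

/-- The component `P_θ`, with density `p(· | θ)` with respect to `lam`. -/
def component (lam : Measure X) (p : X → Par q → ℝ) (θ : Par q) : Measure X :=
  lam.withDensity fun x => ENNReal.ofReal (p x θ)

/-- `p(· | θ)`, `θ ∈ Θ`, are probability densities with respect to `lam`. The values `p x θ` for `θ`
outside `Θ` only serve to make sense of derivatives at the boundary of `Θ`. -/
def IsDensityFamily (lam : Measure X) (p : X → Par q → ℝ) (Θ : Set (Par q)) : Prop :=
  ∀ θ ∈ Θ, Measurable (fun x => p x θ) ∧ (∀ᵐ x ∂lam, 0 ≤ p x θ) ∧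
    IsProbabilityMeasure (component lam p θ)

/-- The mixture distribution `P_G = ∑ p_i P_{θ_i}`. -/
def mixture (lam : Measure X) (p : X → Par q → ℝ) (G : Par q →₀ ℝ) : Measure X :=
  ∑ θ ∈ G.support, ENNReal.ofReal (G θ) • component lam p θ

/-- The mixture model is identifiable on the mixing measures with at most `k` atoms. -/
def Identifiable (lam : Measure X) (p : X → Par q → ℝ) (Θ : Set (Par q)) (k : ℕ) : Prop :=
  Set.InjOn (mixture lam p) (mixAtMost Θ k)

/-- For almost every `x`, `p(x | ·)` is `m` times continuously differentiable on `Θ`, that is, on a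
fixed open neighbourhood `U` of `Θ` to which the densities are extended. -/
def SmoothFamily (lam : Measure X) (p : X → Par q → ℝ) (Θ : Set (Par q)) (m : ℕ) : Prop :=
  ∃ U : Set (Par q), IsOpen U ∧ Θ ⊆ U ∧ (∀ θ ∈ U, Measurable fun x => p x θ) ∧
    ∀ᵐ x ∂lam, ContDiffOn ℝ (m : WithTop ℕ∞) (p x) U

/-- Assumption `A2(m)`: differentiability in the parameter up to order `m`, with integrable bounds
on the difference quotients of the derivatives of order `< m` and on the increments of the
derivatives of order `m`. -/
def AssumptionA2 (lam : Measure X) (p : X → Par q → ℝ) (Θ : Set (Par q)) (m : ℕ) : Prop :=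
  SmoothFamily lam p Θ m ∧
  (∀ γ : Fin q → ℕ, ∑ j, γ j < m → ∀ i : Fin q, ∀ θ ∈ Θ,
    ∃ δ : ℝ, 0 < δ ∧ ∃ ψ : X → ℝ, Integrable ψ lam ∧
      ∀ t : ℝ, 0 < |t| → |t| < δ → ∀ᵐ x ∂lam,
        |(multiD γ (p x) (θ + t • EuclideanSpace.single i 1) - multiD γ (p x) θ) / t| ≤ ψ x) ∧
  (∀ γ : Fin q → ℕ, ∑ j, γ j = m → ∀ θ ∈ Θ,
    ∃ δ : ℝ, 0 < δ ∧ ∃ ψ : X → ℝ, Integrable ψ lam ∧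
      ∀ v : Par q, 0 < ‖v‖ → ‖v‖ < δ → ∀ᵐ x ∂lam,
        |multiD γ (p x) (θ + v) - multiD γ (p x) θ| ≤ ψ x)

/-- The family is `(m, k₀, k)` linear independent. -/
def LinIndep (lam : Measure X) (p : X → Par q → ℝ) (Θ : Set (Par q)) (m k₀ k : ℕ) : Prop :=
  SmoothFamily lam p Θ m ∧
  ∀ l : ℕ, k₀ ≤ l → l ≤ 2 * k - k₀ →
  ∀ r : Fin l → ℕ, (∀ i, 1 ≤ r i ∧ r i ≤ m + 1) → 2 * k₀ ≤ ∑ i, r i → ∑ i, r i ≤ 2 * k →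
  ∀ θ : Fin l → Par q, Function.Injective θ → (∀ i, θ i ∈ Θ) →
  ∀ a : Fin l → (Fin q → ℕ) → ℝ,
    (∀ᵐ x ∂lam, ∑ i, ∑ α ∈ multiIdx q (r i - 1), a i α * multiD α (p x) (θ i) = 0) →
    ∑ i, a i 0 = 0 →
    ∀ i, ∀ α ∈ multiIdx q (r i - 1), a i α = 0

end family

/-! ### Kernels and maximum mean discrepancy -/

section kernel

variable {X : Type*}

/-- `‖ker‖_∞ = sup_x √(ker(x, x))`. -/
def kerNorm (ker : X → X → ℝ) : ℝ := ⨆ x, √(ker x x)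

/-- The mean embedding `Q ↦ ∫ ker(·, y) dQ(y)` of a finite signed measure `Q`. -/
def meanEmbedding [MeasurableSpace X] (ker : X → X → ℝ) (Q : SignedMeasure X) : X → ℝ :=
  fun x => ∫ y, ker x y ∂Q.toJordanDecomposition.posPart -
    ∫ y, ker x y ∂Q.toJordanDecomposition.negPart

/-- `ker` is bounded and measurable, and its mean embedding is injective on finite signed
measures. -/
structure GoodKernel [MeasurableSpace X] (ker : X → X → ℝ) : Prop where
  measurable : ∀ x, Measurable fun y => ker y x
  bounded : BddAbove (Set.range fun x => √(ker x x))
  injective : Function.Injective (meanEmbedding ker)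

variable (H : Type*) [NormedAddCommGroup H] [InnerProductSpace ℝ H] [RKHS ℝ H X ℝ]

/-- `H` is the reproducing kernel Hilbert space with kernel `ker`. (Such an `H` exists precisely when
`ker` is symmetric and positive semidefinite, and it is then unique.) -/
def HasKernel [CompleteSpace H] (ker : X → X → ℝ) : Prop :=
  ∀ x y, RKHS.kernel H x y 1 = ker x y

/-- The maximum mean discrepancy: the supremum of `|∫ h dP - ∫ h dQ|` over the unit ball of `H`. -/
def mmd [MeasurableSpace X] (P Q : Measure X) : ℝ :=
  ⨆ h : {h : H // ‖h‖ ≤ 1}, |∫ x, h.1 x ∂P - ∫ x, h.1 x ∂Q|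

/-- The class of test functions `θ ↦ ∫ h dP_θ` on `Θ`, for `h` in the unit ball of `H`. -/
def testClass [MeasurableSpace X] {q : ℕ} (lam : Measure X) (p : X → Par q → ℝ)
    (Θ : Set (Par q)) : Set (Θ → ℝ) :=
  {φ | ∃ h : H, ‖h‖ ≤ 1 ∧ φ = fun θ : Θ => ∫ x, h x ∂component lam p θ}

/-- The empirical measure of a sample. -/
def empirical [MeasurableSpace X] {n : ℕ} (x : Fin n → X) : Measure X :=
  (n : ℝ≥0∞)⁻¹ • ∑ i, Measure.dirac (x i)

/-- `Ghat` is a minimum MMD estimator from samples of size `n`. -/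
def IsMinMMD [MeasurableSpace X] {q : ℕ} (lam : Measure X) (p : X → Par q → ℝ)
    (Θ : Set (Par q)) (k n : ℕ) (Ghat : (Fin n → X) → (Par q →₀ ℝ)) : Prop :=
  ∀ x, Ghat x ∈ mixAtMost Θ k ∧
    ∀ G ∈ mixAtMost Θ k,
      mmd H (mixture lam p (Ghat x)) (empirical x) ≤ mmd H (mixture lam p G) (empirical x)

end kernel

/-! ### Expectations -/

/-- The outer expectation of a non-negative function; it is `∫⁻ ω, f ω ∂μ` for measurable `f`. -/
def outerE {Ω : Type*} [MeasurableSpace Ω] (μ : Measure Ω) (f : Ω → ℝ≥0∞) : ℝ≥0∞ :=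
  ⨅ (g : Ω → ℝ≥0∞) (_ : Measurable g) (_ : ∀ ω, f ω ≤ g ω), ∫⁻ ω, g ω ∂μ

/-- `E_G W_l^l(G, Ghat)`, where the sample consists of `n` independent draws from `P_G`. -/
def risk {X : Type*} [MeasurableSpace X] {q : ℕ} (lam : Measure X) (p : X → Par q → ℝ)
    (l n : ℕ) (Ghat : (Fin n → X) → (Par q →₀ ℝ)) (G : Par q →₀ ℝ) : ℝ≥0∞ :=
  outerE (Measure.pi fun _ : Fin n => mixture lam p G)
    fun x => ENNReal.ofReal (wasserstein l G (Ghat x) ^ l)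

end MMDMixture

end

namespace MMDMixture

/-! ### Moments of weighted point configurations -/

/-! The risk bound combines a deterministic inverse bound with a stochastic one. The inverse bound
is W_m^m(G, G') ≤ C · MMD(P_G, P_G') with m = 2(k - k₁) + 1, where k₁ = 1 in the global case, and k₁
= k₀ when G is restricted to a W_1-neighbourhood of G₀. The stochastic bound is E MMD(P_G, P_Ĝ) ≤
2‖ker‖_∞/√n.

Inverse bound (`false_of_sequences`). Suppose n · MMD(P_{G_n}, P_{G'_n}) < W_m^m(G_n, G'_n) for all
n. By compactness the weights and atoms converge along a subsequence. If the two limits differ,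
identifiability and injectivity of the mean embedding give h in the RKHS that separates them,
although its integrals have the same limit because W_m is bounded. If the limits agree, view G_n -
G'_n as 2k signed weights, grouped into clusters by the limits of their points, and let A be the sum
over the clusters of the absolute moments of order less than the cluster size. Two estimates,
neither of which involves the distances inside a cluster, do the work.

(i) W_m^m ≤ C·A (`exists_wasserstein_le_clusterMoments`). The mass of a part at distance δ from the
other points is a sum of σ against an indicator. Interpolating that indicator on a cluster of N
points costs moments of order less than N and a factor δ^{-(N-1)} (`exists_interpolant`). Greedy
merging of closest pairs turns such bounds into a transport plan (`exists_transport`).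

(ii) For f with N - 1 continuous derivatives, the cluster sum of σ_s f(τ_s) equals its Taylor
expansion in the moments up to o(A) (`abs_sum_sub_taylor_le`). The remainder is controlled by
moments, not by absolute weights: Hadamard's lemma removes one point and one derivative at a time
(`BddDerivs.abs_sum_le`).

By (ii) and dominated convergence, the density differences divided by A converge, when tested
against bounded functions, to a combination of derivatives D^α p(·|z) that has nontrivial
coefficients and order-zero coefficients summing to zero. Linear independence makes it nonzero, so
some h in the RKHS has a nonzero integral against it. By (i) and the assumption on the sequences,
the normalised integrals of h are O(1/n), a contradiction.

Stochastic bound (`risk_le_of_wasserstein_le`). In terms of mean elements the MMD is a Hilbert norm,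
and minimality gives ‖u - u'‖² ≤ 2⟨u - u', v - u'⟩, where u, u', v belong to the fitted mixture, the
true mixture and the sample. Only the projection of v - u' to a separable subspace containing the
mean elements of all mixtures matters. Its second moment is a countable sum of variances, at most
‖ker‖_∞²/n by Bessel. This needs neither separability of the RKHS nor measurability of the
estimator.

Finally, between mixtures the MMD depends on the kernel only through the class of test functions, so
a constant found for one kernel serves all kernels with the same class. -/

theorem mem_multiIdx {q m : ℕ} {α : Fin q → ℕ} : α ∈ multiIdx q m ↔ ∑ i, α i ≤ m := by
  unfold multiIdx
  simp only [Finset.mem_filter, Fintype.mem_piFinset, Finset.mem_range, and_iff_right_iff_imp]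
  intro h i
  have := Finset.single_le_sum (f := α) (fun j _ => Nat.zero_le _) (Finset.mem_univ i)
  omega

theorem zero_mem_multiIdx (q m : ℕ) : (0 : Fin q → ℕ) ∈ multiIdx q m := by
  simp [mem_multiIdx]

/-- The monomial `y ^ α`. -/
noncomputable def monom {q : ℕ} (α : Fin q → ℕ) (y : Par q) : ℝ := ∏ i, y i ^ α i

@[simp] theorem monom_zero {q : ℕ} (y : Par q) : monom 0 y = 1 := by simp [monom]

theorem sum_add_single {q : ℕ} (α : Fin q → ℕ) (i : Fin q) :
    ∑ j, (α + Pi.single i 1 : Fin q → ℕ) j = ∑ j, α j + 1 := by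
  simp [Finset.sum_add_distrib]

theorem monom_add_single {q : ℕ} (α : Fin q → ℕ) (i : Fin q) (y : Par q) :
    monom (α + Pi.single i 1) y = y i * monom α y := by
  unfold monom
  simp only [Pi.add_apply, pow_add, Finset.prod_mul_distrib]
  rw [mul_comm]
  congr 1
  rw [Finset.prod_eq_single i]
  · simp
  · intro j _ hj
    simp [hj]
  · simp

/-- The sum of the absolute values of the moments of order at most `d`, centred at `z`, of the
signed weights `σ` at the points `τ`. -/
noncomputable def momSum {q : ℕ} {ι : Type*} [Fintype ι] (z : Par q) (τ : ι → Par q) (d : ℕ)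
    (σ : ι → ℝ) : ℝ :=
  ∑ α ∈ multiIdx q d, |∑ s, σ s * monom α (τ s - z)|

section moments

variable {q : ℕ} {ι : Type*} [Fintype ι] (z : Par q) (τ : ι → Par q)

theorem momSum_nonneg (d : ℕ) (σ : ι → ℝ) : 0 ≤ momSum z τ d σ :=
  Finset.sum_nonneg fun _ _ => abs_nonneg _

theorem abs_moment_le_momSum {d : ℕ} {α : Fin q → ℕ} (hα : α ∈ multiIdx q d) (σ : ι → ℝ) :
    |∑ s, σ s * monom α (τ s - z)| ≤ momSum z τ d σ :=
  Finset.single_le_sum (f := fun α => |∑ s, σ s * monom α (τ s - z)|)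
    (fun _ _ => abs_nonneg _) hα

theorem abs_sum_le_momSum (d : ℕ) (σ : ι → ℝ) : |∑ s, σ s| ≤ momSum z τ d σ := by
  simpa using abs_moment_le_momSum z τ (zero_mem_multiIdx q d) σ

theorem momSum_mono {d e : ℕ} (h : d ≤ e) (σ : ι → ℝ) : momSum z τ d σ ≤ momSum z τ e σ := by
  refine Finset.sum_le_sum_of_subset_of_nonneg ?_ fun _ _ _ => abs_nonneg _
  intro α
  simp only [mem_multiIdx]
  omega

/-- Multiplying the weights by the i-th coordinate shifts the multi-index α to α + e_i, and this
shift is injective, so the new moments are distinct members of the larger family. -/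
theorem momSum_coord (d : ℕ) (i : Fin q) (σ : ι → ℝ) :
    momSum z τ d (fun s => (τ s - z) i * σ s) ≤ momSum z τ (d + 1) σ := by
  unfold momSum
  have hinj : Set.InjOn (fun α : Fin q → ℕ => α + Pi.single i 1) (multiIdx q d : Set (Fin q → ℕ)) :=
    fun a _ b _ h => add_right_cancel h
  calc _ = ∑ α ∈ (multiIdx q d).image (fun α : Fin q → ℕ => α + Pi.single i 1),
        |∑ s, σ s * monom α (τ s - z)| := by
        rw [Finset.sum_image hinj]
        refine Finset.sum_congr rfl fun α _ => ?_
        congr 1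
        refine Finset.sum_congr rfl fun s _ => ?_
        rw [monom_add_single]
        ring
    _ ≤ _ := by
        refine Finset.sum_le_sum_of_subset_of_nonneg ?_ fun _ _ _ => abs_nonneg _
        intro α hα
        obtain ⟨β, hβ, rfl⟩ := Finset.mem_image.1 hα
        rw [mem_multiIdx] at hβ ⊢
        rw [sum_add_single]
        omega

theorem momSum_add_le (d : ℕ) (σ σ' : ι → ℝ) :
    momSum z τ d (fun s => σ s + σ' s) ≤ momSum z τ d σ + momSum z τ d σ' := by
  unfold momSum
  rw [← Finset.sum_add_distrib]
  refine Finset.sum_le_sum fun α _ => ?_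
  simp only [add_mul, Finset.sum_add_distrib]
  exact abs_add_le _ _

theorem momSum_const_mul (d : ℕ) (c : ℝ) (σ : ι → ℝ) :
    momSum z τ d (fun s => c * σ s) = |c| * momSum z τ d σ := by
  unfold momSum
  rw [Finset.mul_sum]
  refine Finset.sum_congr rfl fun α _ => ?_
  rw [← abs_mul, Finset.mul_sum]
  simp only [mul_assoc]

theorem momSum_sum_le {κ : Type*} (t : Finset κ) (d : ℕ) (σ : κ → ι → ℝ) :
    momSum z τ d (fun s => ∑ j ∈ t, σ j s) ≤ ∑ j ∈ t, momSum z τ d (σ j) := by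
  classical
  induction t using Finset.induction_on with
  | empty => simp [momSum]
  | insert a t ha ih =>
    simp only [Finset.sum_insert ha]
    exact (momSum_add_le z τ d _ _).trans (by gcongr)

/-- Multiplication of the weights by a coordinate relative to a point of the unit ball around
the centre. -/
theorem momSum_coord_sub (d : ℕ) (i : Fin q) (b : Par q) (hb : ‖b - z‖ ≤ 1) (σ : ι → ℝ) :
    momSum z τ d (fun s => (τ s - b) i * σ s) ≤ 2 * momSum z τ (d + 1) σ := by
  have h1 : (fun s => (τ s - b) i * σ s)
      = fun s => (τ s - z) i * σ s + (-(b - z) i) * σ s := by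
    funext s
    simp only [PiLp.sub_apply]
    ring
  rw [h1]
  have h2 : |(b - z) i| ≤ 1 := by
    have := PiLp.norm_apply_le (b - z) i
    rw [Real.norm_eq_abs] at this
    linarith
  calc _ ≤ _ := momSum_add_le z τ d _ _
    _ ≤ momSum z τ (d + 1) σ + 1 * momSum z τ (d + 1) σ := by
        gcongr
        · exact momSum_coord z τ d i σ
        · rw [momSum_const_mul, abs_neg]
          exact mul_le_mul h2 (momSum_mono z τ (Nat.le_succ d) σ) (momSum_nonneg z τ d σ)
            zero_le_one
    _ = _ := by ring

/-- An affine function that vanishes at a point of the unit ball around the centre and has small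
gradient acts boundedly on the moments. -/
theorem momSum_affine (d : ℕ) (b u : Par q) (hb : ‖b - z‖ ≤ 1) {L : ℝ} (hu : ‖u‖ ≤ L)
    (σ : ι → ℝ) :
    momSum z τ d (fun s => (∑ i, u i * (τ s - b) i) * σ s)
      ≤ 2 * q * L * momSum z τ (d + 1) σ := by
  have h1 : (fun s => (∑ i, u i * (τ s - b) i) * σ s)
      = fun s => ∑ i, u i * ((τ s - b) i * σ s) := by
    funext s
    rw [Finset.sum_mul]
    simp only [mul_assoc]
  rw [h1]
  refine (momSum_sum_le z τ Finset.univ d _).trans ?_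
  calc _ ≤ ∑ i : Fin q, L * (2 * momSum z τ (d + 1) σ) := by
        refine Finset.sum_le_sum fun i _ => ?_
        rw [momSum_const_mul]
        have h2 := PiLp.norm_apply_le u i
        rw [Real.norm_eq_abs] at h2
        exact mul_le_mul (h2.trans hu) (momSum_coord_sub z τ d i b hb σ) (momSum_nonneg z τ d _)
          ((abs_nonneg _).trans (h2.trans hu))
    _ = _ := by
        simp
        ring

/-- Neville interpolation of an indicator: if the points of `J` and those outside `J` are at
distance at least `δ`, the indicator of `J` agrees on `I` with a function which the moments of order
`< #I` control. -/
theorem exists_interpolant (J : ι → Prop) {δ K : ℝ} (hδ : 0 < δ) (hK : 1 ≤ K)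
    (hKδ : 4 * q / δ ≤ K)
    (hJ : ∀ s t, J s → ¬ J t → δ ≤ ‖τ s - τ t‖) (d : ℕ) :
    ∀ I : Finset ι, I.card ≤ d + 1 → (∀ s ∈ I, ‖τ s - z‖ ≤ 1) →
      ∃ f : ι → ℝ, (∀ s ∈ I, (J s → f s = 1) ∧ (¬ J s → f s = 0)) ∧
        ∀ σ : ι → ℝ, |∑ s, σ s * f s| ≤ K ^ d * momSum z τ d σ := by
  classical
  induction d with
  | zero =>
    intro I hI _
    by_cases h : ∃ s ∈ I, J s
    · obtain ⟨s, hs, hJs⟩ := h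
      refine ⟨fun _ => 1, fun t ht => ?_, fun σ => by simpa using abs_sum_le_momSum z τ 0 σ⟩
      have : t = s := Finset.card_le_one.1 hI t ht s hs
      subst this
      exact ⟨fun _ => rfl, fun h => absurd hJs h⟩
    · push Not at h
      refine ⟨fun _ => 0, fun t ht => ⟨fun hJt => absurd hJt (h t ht), fun _ => rfl⟩, fun σ => ?_⟩
      simpa using momSum_nonneg z τ 0 σ
  | succ d ih =>
    intro I hI hz
    by_cases h : (∃ s ∈ I, J s) ∧ ∃ t ∈ I, ¬ J t
    · obtain ⟨⟨s, hs, hJs⟩, t, ht, hJt⟩ := h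
      have hst := hJ s t hJs hJt
      have hpos : 0 < ‖τ s - τ t‖ := hδ.trans_le hst
      obtain ⟨f, hf, hfσ⟩ := ih (I.erase t) (by rw [Finset.card_erase_of_mem ht]; omega)
        (fun r hr => hz r (Finset.mem_of_mem_erase hr))
      obtain ⟨g, hg, hgσ⟩ := ih (I.erase s) (by rw [Finset.card_erase_of_mem hs]; omega)
        (fun r hr => hz r (Finset.mem_of_mem_erase hr))
      -- With this normalisation ℓ is the affine function of gradient u that is 1 at τ s and 0 at τ
      -- t, and ℓ' = 1 - ℓ. As s and t lie on opposite sides of the separation, the gradient is at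
      -- most 1/δ, however close the other points of I are to each other.
      set c : ℝ := (‖τ s - τ t‖ ^ 2)⁻¹ with hc
      set u : Par q := c • (τ s - τ t) with hu
      have hun : ‖u‖ ≤ δ⁻¹ := by
        have h1 : ‖u‖ = ‖τ s - τ t‖⁻¹ := by
          rw [hu, norm_smul, hc, Real.norm_of_nonneg (by positivity)]
          field_simp
        rw [h1]
        gcongr
      set ℓ : ι → ℝ := fun r => ∑ i, u i * (τ r - τ t) i with hℓ
      set ℓ' : ι → ℝ := fun r => ∑ i, (-u) i * (τ r - τ s) i with hℓ'
      have hnorm : ∑ i, u i * (τ s - τ t) i = 1 := by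
        have h1 : ∑ i, u i * (τ s - τ t) i = c * ‖τ s - τ t‖ ^ 2 := by
          rw [EuclideanSpace.norm_sq_eq, Finset.mul_sum]
          refine Finset.sum_congr rfl fun i _ => ?_
          simp only [hu, PiLp.smul_apply, smul_eq_mul, Real.norm_eq_abs, sq_abs]
          ring
        rw [h1, hc]
        field_simp
      have hsum : ∀ r, ℓ r + ℓ' r = 1 := by
        intro r
        rw [← hnorm, hℓ, hℓ']
        simp only
        rw [← Finset.sum_add_distrib]
        refine Finset.sum_congr rfl fun i _ => ?_
        simp only [PiLp.neg_apply, PiLp.sub_apply]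
        ring
      have hℓt : ℓ t = 0 := by simp [hℓ]
      have hℓs : ℓ s = 1 := hnorm
      -- Neville's recursion: f may be wrong at t, where ℓ vanishes, and g may be wrong at s, where
      -- ℓ' vanishes.
      refine ⟨fun r => ℓ r * f r + ℓ' r * g r, fun r hr => ?_, fun σ => ?_⟩
      · by_cases hrt : r = t
        · subst hrt
          have h1 : ℓ' r = 1 := by have := hsum r; linarith
          have h2 := hg r (Finset.mem_erase.2 ⟨by rintro rfl; exact hJt hJs, hr⟩)
          refine ⟨fun h => absurd h hJt, fun h => ?_⟩
          simp [hℓt, h1, h2.2 h]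
        · have h2 := hf r (Finset.mem_erase.2 ⟨hrt, hr⟩)
          by_cases hrs : r = s
          · subst hrs
            have h1 : ℓ' r = 0 := by have := hsum r; linarith
            refine ⟨fun h => ?_, fun h => absurd hJs h⟩
            simp [hℓs, h1, h2.1 h]
          · have h3 := hg r (Finset.mem_erase.2 ⟨hrs, hr⟩)
            refine ⟨fun h => ?_, fun h => ?_⟩
            · simp [h2.1 h, h3.1 h, hsum r]
            · simp [h2.2 h, h3.2 h]
      · have h1 : ∑ r, σ r * (ℓ r * f r + ℓ' r * g r)
            = ∑ r, (ℓ r * σ r) * f r + ∑ r, (ℓ' r * σ r) * g r := by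
          rw [← Finset.sum_add_distrib]
          exact Finset.sum_congr rfl fun r _ => by ring
        rw [h1]
        have hKd : 0 ≤ K ^ d := by positivity
        -- Each affine factor raises the order of the moments by one and costs 2q/δ. The two
        -- together cost 4q/δ ≤ K.
        calc _ ≤ _ := abs_add_le _ _
          _ ≤ K ^ d * (2 * q * δ⁻¹ * momSum z τ (d + 1) σ)
              + K ^ d * (2 * q * δ⁻¹ * momSum z τ (d + 1) σ) := by
              refine add_le_add ?_ ?_
              · refine (hfσ _).trans (mul_le_mul_of_nonneg_left ?_ hKd)
                exact momSum_affine z τ d (τ t) u (hz t ht) hun σ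
              · refine (hgσ _).trans (mul_le_mul_of_nonneg_left ?_ hKd)
                exact momSum_affine z τ d (τ s) (-u) (hz s hs) (by rwa [norm_neg]) σ
          _ = K ^ d * (4 * q / δ) * momSum z τ (d + 1) σ := by
              field_simp
              ring
          _ ≤ K ^ d * K * momSum z τ (d + 1) σ := by
              gcongr
              exact momSum_nonneg z τ _ σ
          _ = _ := by ring
    -- All points of I lie on the same side, so a constant interpolates.
    · have hK1 : 1 ≤ K ^ (d + 1) := one_le_pow₀ hK
      by_cases h1 : ∃ s ∈ I, J s
      · refine ⟨fun _ => 1, fun t ht => ⟨fun _ => rfl, fun hJt => absurd ⟨h1, t, ht, hJt⟩ h⟩,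
          fun σ => ?_⟩
        have h2 := abs_sum_le_momSum z τ (d + 1) σ
        have h3 := momSum_nonneg z τ (d + 1) σ
        simp only [mul_one]
        nlinarith
      · push Not at h1
        refine ⟨fun _ => 0, fun t ht => ⟨fun hJt => absurd hJt (h1 t ht), fun _ => rfl⟩,
          fun σ => ?_⟩
        simpa using mul_nonneg (zero_le_one.trans hK1) (momSum_nonneg z τ (d + 1) σ)

/-- The total weight of a separated part of a small configuration is controlled by the moments. -/
theorem abs_sum_separated_le (J : ι → Prop) [DecidablePred J] {δ K : ℝ} (hδ : 0 < δ) (hK : 1 ≤ K)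
    (hKδ : 4 * q / δ ≤ K) (hJ : ∀ s t, J s → ¬ J t → δ ≤ ‖τ s - τ t‖) {d : ℕ}
    {I : Finset ι} (hI : I.card ≤ d + 1) (hz : ∀ s ∈ I, ‖τ s - z‖ ≤ 1) {σ : ι → ℝ}
    (hσ : ∀ s ∉ I, σ s = 0) :
    |∑ s, if J s then σ s else 0| ≤ K ^ d * momSum z τ d σ := by
  obtain ⟨f, hf, hfσ⟩ := exists_interpolant z τ J hδ hK hKδ hJ d I hI hz
  convert hfσ σ using 3 with s
  by_cases hs : s ∈ I
  · by_cases h : J s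
    · simp [h, (hf s hs).1 h]
    · simp [h, (hf s hs).2 h]
  · simp [hσ s hs]

end moments


/-! ### Partial derivatives -/

section partials

variable {q : ℕ}

/-- The linear form with coefficients `g`. -/
noncomputable def linForm (g : Fin q → ℝ) : Par q →L[ℝ] ℝ :=
  ∑ i, g i • (EuclideanSpace.proj i : Par q →L[ℝ] ℝ)

theorem linForm_apply (g : Fin q → ℝ) (v : Par q) : linForm g v = ∑ i, g i * v i := by
  simp [linForm]

theorem norm_linForm_le (g : Fin q → ℝ) : ‖linForm g‖ ≤ ∑ i, |g i| := by
  refine ContinuousLinearMap.opNorm_le_bound _ (Finset.sum_nonneg fun _ _ => abs_nonneg _)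
    fun v => ?_
  rw [linForm_apply, Finset.sum_mul]
  refine (Finset.abs_sum_le_sum_abs _ _).trans (Finset.sum_le_sum fun i _ => ?_)
  rw [abs_mul]
  gcongr
  exact PiLp.norm_apply_le v i

theorem partialD_eq_fderiv {f : Par q → ℝ} {θ : Par q} (hf : DifferentiableAt ℝ f θ)
    (i : Fin q) : partialD i f θ = fderiv ℝ f θ (EuclideanSpace.single i 1) :=
  hf.lineDeriv_eq_fderiv

theorem fderiv_eq_linForm {f : Par q → ℝ} {θ : Par q} (hf : DifferentiableAt ℝ f θ) :
    fderiv ℝ f θ = linForm fun i => partialD i f θ := by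
  ext v
  rw [linForm_apply]
  have hv : v = ∑ i, v i • (EuclideanSpace.single i (1 : ℝ) : Par q) := by
    ext j
    simp [Finset.sum_apply, Pi.single_apply]
  conv_lhs => rw [hv]
  rw [map_sum]
  refine Finset.sum_congr rfl fun i _ => ?_
  rw [map_smul, smul_eq_mul, partialD_eq_fderiv hf, mul_comm]

theorem partialD_congr {U : Set (Par q)} (hU : IsOpen U) {f g : Par q → ℝ} (h : Set.EqOn f g U)
    (i : Fin q) : Set.EqOn (partialD i f) (partialD i g) U := fun _ hθ =>
  Filter.EventuallyEq.lineDeriv_eq (h.eventuallyEq_of_mem (hU.mem_nhds hθ))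

theorem contDiffOn_partialD {U : Set (Par q)} (hU : IsOpen U) {f : Par q → ℝ} {n : ℕ}
    (hf : ContDiffOn ℝ ((n + 1 : ℕ) : WithTop ℕ∞) f U) (i : Fin q) :
    ContDiffOn ℝ (n : WithTop ℕ∞) (partialD i f) U := by
  have h1 : ContDiffOn ℝ (n : WithTop ℕ∞)
      (fun θ => fderiv ℝ f θ (EuclideanSpace.single i 1)) U :=
    (hf.fderiv_of_isOpen hU (by norm_cast)).clm_apply contDiffOn_const
  refine h1.congr fun θ hθ => partialD_eq_fderiv ?_ i
  exact (hf.contDiffAt (hU.mem_nhds hθ)).differentiableAt (by norm_cast)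

theorem differentiableAt_of_contDiffOn {U : Set (Par q)} (hU : IsOpen U) {f : Par q → ℝ} {n : ℕ}
    (hf : ContDiffOn ℝ ((n + 1 : ℕ) : WithTop ℕ∞) f U) {θ : Par q} (hθ : θ ∈ U) :
    DifferentiableAt ℝ f θ :=
  (hf.contDiffAt (hU.mem_nhds hθ)).differentiableAt (by norm_cast)

theorem hasFDerivAt_linForm {U : Set (Par q)} (hU : IsOpen U) {f : Par q → ℝ} {n : ℕ}
    (hf : ContDiffOn ℝ ((n + 1 : ℕ) : WithTop ℕ∞) f U) {θ : Par q} (hθ : θ ∈ U) :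
    HasFDerivAt f (linForm fun i => partialD i f θ) θ := by
  have h := differentiableAt_of_contDiffOn hU hf hθ
  rw [← fderiv_eq_linForm h]
  exact h.hasFDerivAt

/-- Both orders of differentiation are values of the second Fréchet derivative, which is symmetric
for a C² function. -/
theorem partialD_comm {U : Set (Par q)} (hU : IsOpen U) {f : Par q → ℝ}
    (hf : ContDiffOn ℝ ((2 : ℕ) : WithTop ℕ∞) f U) (i j : Fin q) :
    Set.EqOn (partialD i (partialD j f)) (partialD j (partialD i f)) U := by
  have key : ∀ i j : Fin q, ∀ θ ∈ U, partialD i (partialD j f) θ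
      = fderiv ℝ (fderiv ℝ f) θ (EuclideanSpace.single i 1) (EuclideanSpace.single j 1) := by
    intro i j θ hθ
    have h1 : Set.EqOn (partialD j f) (fun θ => fderiv ℝ f θ (EuclideanSpace.single j 1)) U :=
      fun θ hθ => partialD_eq_fderiv (differentiableAt_of_contDiffOn hU hf hθ) j
    rw [partialD_congr hU h1 i hθ]
    have h2 : DifferentiableAt ℝ (fderiv ℝ f) θ :=
      ((hf.fderiv_of_isOpen hU (m := 1) (by norm_num)).contDiffAt
        (hU.mem_nhds hθ)).differentiableAt (by norm_num)
    have h3 : HasFDerivAt (fun θ => fderiv ℝ f θ (EuclideanSpace.single j 1))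
        ((fderiv ℝ (fderiv ℝ f) θ).flip (EuclideanSpace.single j 1)) θ := by
      simpa using h2.hasFDerivAt.clm_apply (hasFDerivAt_const (EuclideanSpace.single j (1 : ℝ)) θ)
    rw [partialD_eq_fderiv h3.differentiableAt, h3.fderiv]
    rfl
  intro θ hθ
  rw [key i j θ hθ, key j i θ hθ]
  have h := ((hf.contDiffAt (hU.mem_nhds hθ)).isSymmSndFDerivAt (by simp))
  exact h.eq _ _

/-- The iterated partial derivative along a word. -/
noncomputable def wordD (l : List (Fin q)) (f : Par q → ℝ) : Par q → ℝ := l.foldr partialD f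

theorem wordD_append (l l' : List (Fin q)) (f : Par q → ℝ) :
    wordD (l ++ l') f = wordD l (wordD l' f) := by
  simp [wordD, List.foldr_append]

theorem contDiffOn_wordD {U : Set (Par q)} (hU : IsOpen U) {f : Par q → ℝ} (l : List (Fin q))
    (n : ℕ) (hf : ContDiffOn ℝ ((n + l.length : ℕ) : WithTop ℕ∞) f U) :
    ContDiffOn ℝ (n : WithTop ℕ∞) (wordD l f) U := by
  induction l generalizing n with
  | nil => simpa [wordD] using hf
  | cons i l ih =>
    refine contDiffOn_partialD hU (ih (n + 1) ?_) i
    convert hf using 2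
    simp only [List.length_cons]
    omega

/-- A permutation is a composition of adjacent swaps, and each swap is an instance of
`partialD_comm`. Smoothness of the order of the length of the word leaves two derivatives wherever a
swap takes place. -/
theorem wordD_perm {U : Set (Par q)} (hU : IsOpen U) {f : Par q → ℝ} {l l' : List (Fin q)}
    (h : l.Perm l') (hf : ContDiffOn ℝ (l.length : WithTop ℕ∞) f U) :
    Set.EqOn (wordD l f) (wordD l' f) U := by
  induction h with
  | nil => exact fun _ _ => rfl
  | cons i _ ih =>
    refine partialD_congr hU (ih (hf.of_le ?_)) i
    simp only [List.length_cons]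
    exact_mod_cast Nat.le_succ _
  | swap i j l =>
    refine partialD_comm hU (contDiffOn_wordD hU l 2 ?_) j i
    convert hf using 2
    simp only [List.length_cons]
    omega
  | trans h1 _ ih1 ih2 =>
    refine (ih1 hf).trans (ih2 ?_)
    rwa [← h1.length_eq]

/-- The word listing each coordinate `i` with multiplicity `α i`. -/
def idxWord (α : Fin q → ℕ) : List (Fin q) :=
  (List.finRange q).flatMap fun i => List.replicate (α i) i

/-- Words make the order of the derivatives explicit, so that it can be rearranged by `wordD_perm`;
`multiD` itself fixes one order of the coordinates. -/
theorem multiD_eq_wordD (α : Fin q → ℕ) (f : Par q → ℝ) :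
    multiD α f = wordD (idxWord α) f := by
  unfold multiD idxWord
  induction List.finRange q with
  | nil => rfl
  | cons i l ih =>
    rw [List.flatMap_cons, wordD_append, List.foldr_cons, ih]
    generalize wordD _ f = g
    induction α i with
    | zero => rfl
    | succ n ihn =>
      rw [Function.iterate_succ_apply', ihn]
      rfl

theorem count_idxWord (α : Fin q → ℕ) (i : Fin q) : (idxWord α).count i = α i := by
  unfold idxWord
  rw [List.count_flatMap]
  have : (List.count i ∘ fun j => List.replicate (α j) j) = fun j => if j = i then α i else 0 := by
    funext j
    by_cases h : j = i
    · subst h; simp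
    · simp [List.count_replicate, h]
  rw [this, ← List.ofFn_eq_map, List.sum_ofFn]
  simp

theorem length_idxWord (α : Fin q → ℕ) : (idxWord α).length = ∑ i, α i := by
  unfold idxWord
  rw [List.length_flatMap, ← List.sum_ofFn]
  simp [List.ofFn_eq_map]

theorem idxWord_add_single (α : Fin q → ℕ) (i : Fin q) :
    (idxWord (α + Pi.single i 1)).Perm (i :: idxWord α) := by
  rw [List.perm_iff_count]
  intro j
  rw [count_idxWord, List.count_cons, count_idxWord]
  by_cases h : j = i
  · subst h; simp
  · simp [h, Ne.symm h]

@[simp] theorem multiD_zero (f : Par q → ℝ) : multiD 0 f = f := by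
  have : idxWord (0 : Fin q → ℕ) = [] :=
    List.length_eq_zero_iff.1 (by rw [length_idxWord]; simp)
  rw [multiD_eq_wordD, this]
  rfl

theorem contDiffOn_multiD {U : Set (Par q)} (hU : IsOpen U) {f : Par q → ℝ} (α : Fin q → ℕ)
    (n : ℕ) (hf : ContDiffOn ℝ ((n + ∑ i, α i : ℕ) : WithTop ℕ∞) f U) :
    ContDiffOn ℝ (n : WithTop ℕ∞) (multiD α f) U := by
  rw [multiD_eq_wordD]
  refine contDiffOn_wordD hU _ n ?_
  rwa [length_idxWord]

/-- The additional derivative is taken last, as needed to differentiate D^α f itself. -/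
theorem multiD_add_single {U : Set (Par q)} (hU : IsOpen U) {f : Par q → ℝ} (α : Fin q → ℕ)
    (i : Fin q) (hf : ContDiffOn ℝ ((∑ j, α j + 1 : ℕ) : WithTop ℕ∞) f U) :
    Set.EqOn (multiD (α + Pi.single i 1) f) (partialD i (multiD α f)) U := by
  rw [multiD_eq_wordD, multiD_eq_wordD]
  refine wordD_perm hU (idxWord_add_single α i) ?_
  rwa [length_idxWord, sum_add_single]

/-- The additional derivative is taken first, as needed for inductions that replace f by a partial
derivative of f. -/
theorem multiD_add_single' {U : Set (Par q)} (hU : IsOpen U) {f : Par q → ℝ} (α : Fin q → ℕ)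
    (i : Fin q) (hf : ContDiffOn ℝ ((∑ j, α j + 1 : ℕ) : WithTop ℕ∞) f U) :
    Set.EqOn (multiD (α + Pi.single i 1) f) (multiD α (partialD i f)) U := by
  have h : wordD [i] f = partialD i f := rfl
  rw [multiD_eq_wordD, multiD_eq_wordD, ← h, ← wordD_append]
  refine wordD_perm hU ((idxWord_add_single α i).trans ?_) ?_
  · exact (List.perm_append_comm (l₁ := [i]))
  · rwa [length_idxWord, sum_add_single]

end partials


/-! ### Functions with bounded derivatives, and their averages along segments -/

section hadamard

variable {q : ℕ}

/-- `h` has continuous partial derivatives on `B` up to order `r`, all bounded by `η`. -/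
def BddDerivs (B : Set (Par q)) : ℕ → ℝ → (Par q → ℝ) → Prop
  | 0, η, h => ContinuousOn h B ∧ ∀ θ ∈ B, |h θ| ≤ η
  | r + 1, η, h => (∀ θ ∈ B, |h θ| ≤ η) ∧ ∃ g : Fin q → Par q → ℝ,
      (∀ θ ∈ B, HasFDerivAt h (linForm fun i => g i θ) θ) ∧ ∀ i, BddDerivs B r η (g i)

theorem BddDerivs.bound {B : Set (Par q)} {r : ℕ} {η : ℝ} {h : Par q → ℝ}
    (hh : BddDerivs B r η h) : ∀ θ ∈ B, |h θ| ≤ η := by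
  cases r with
  | zero => exact hh.2
  | succ r => exact hh.1

theorem BddDerivs.continuousOn {B : Set (Par q)} {r : ℕ} {η : ℝ} {h : Par q → ℝ}
    (hh : BddDerivs B r η h) : ContinuousOn h B := by
  cases r with
  | zero => exact hh.1
  | succ r =>
    obtain ⟨_, g, hg, _⟩ := hh
    exact fun θ hθ => (hg θ hθ).continuousAt.continuousWithinAt

theorem BddDerivs.mono {B : Set (Par q)} {r : ℕ} {η η' : ℝ} (hη : η ≤ η') {h : Par q → ℝ}
    (hh : BddDerivs B r η h) : BddDerivs B r η' h := by
  induction r generalizing h with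
  | zero => exact ⟨hh.1, fun θ hθ => (hh.2 θ hθ).trans hη⟩
  | succ r ih =>
    obtain ⟨h1, g, hg, hgb⟩ := hh
    exact ⟨fun θ hθ => (h1 θ hθ).trans hη, g, hg, fun i => ih (hgb i)⟩

/-- The weighted average of `h` along the segments issuing from `b`. -/
noncomputable def segAvg (b : Par q) (a : ℕ) (h : Par q → ℝ) (θ : Par q) : ℝ :=
  ∫ t in (0 : ℝ)..1, t ^ a * h (b + t • (θ - b))

variable {B : Set (Par q)} {b : Par q}

theorem segment_mem (hc : Convex ℝ B) (hb : b ∈ B) {θ : Par q} (hθ : θ ∈ B) {t : ℝ}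
    (ht : t ∈ Set.Icc (0 : ℝ) 1) : b + t • (θ - b) ∈ B :=
  hc.add_smul_sub_mem hb hθ ht

theorem continuousOn_segment (hc : Convex ℝ B) (hb : b ∈ B) {θ : Par q} (hθ : θ ∈ B)
    {h : Par q → ℝ} (hh : ContinuousOn h B) (a : ℕ) :
    ContinuousOn (fun t : ℝ => t ^ a * h (b + t • (θ - b))) (Set.uIcc 0 1) := by
  rw [Set.uIcc_of_le zero_le_one]
  refine ContinuousOn.mul (by fun_prop) (hh.comp (by fun_prop) ?_)
  exact fun t ht => segment_mem hc hb hθ ht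

theorem abs_segAvg_le (hc : Convex ℝ B) (hb : b ∈ B) {h : Par q → ℝ} {η : ℝ}
    (hη : ∀ θ ∈ B, |h θ| ≤ η) (a : ℕ) {θ : Par q} (hθ : θ ∈ B) : |segAvg b a h θ| ≤ η := by
  have h0 : 0 ≤ η := (abs_nonneg _).trans (hη b hb)
  have := intervalIntegral.norm_integral_le_of_norm_le_const (a := (0 : ℝ)) (b := 1) (C := η)
    (f := fun t : ℝ => t ^ a * h (b + t • (θ - b))) ?_
  · simpa [segAvg] using this
  · intro t ht
    rw [Set.uIoc_of_le zero_le_one] at ht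
    have h1 := hη _ (segment_mem hc hb hθ ⟨ht.1.le, ht.2⟩)
    rw [norm_mul, norm_pow, Real.norm_of_nonneg ht.1.le, Real.norm_eq_abs]
    have h2 : t ^ a ≤ 1 := pow_le_one₀ ht.1.le ht.2
    calc _ ≤ 1 * η := mul_le_mul h2 h1 (abs_nonneg _) zero_le_one
      _ = η := one_mul _

theorem continuousOn_segAvg (hB : IsOpen B) (hc : Convex ℝ B) (hb : b ∈ B) {h : Par q → ℝ}
    (hh : ContinuousOn h B) {η : ℝ} (hη : ∀ θ ∈ B, |h θ| ≤ η) (a : ℕ) :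
    ContinuousOn (segAvg b a h) B := by
  intro θ hθ
  refine ContinuousAt.continuousWithinAt ?_
  have hIoc : Set.uIoc (0 : ℝ) 1 = Set.Ioc 0 1 := Set.uIoc_of_le zero_le_one
  refine intervalIntegral.continuousAt_of_dominated_interval (bound := fun _ => η) ?_ ?_
    intervalIntegrable_const ?_
  · filter_upwards [hB.mem_nhds hθ] with θ' hθ'
    exact (continuousOn_segment hc hb hθ' hh a).intervalIntegrable.def'.aestronglyMeasurable
  · filter_upwards [hB.mem_nhds hθ] with θ' hθ'
    refine Filter.Eventually.of_forall fun t ht => ?_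
    rw [hIoc] at ht
    have h1 := hη _ (segment_mem hc hb hθ' ⟨ht.1.le, ht.2⟩)
    rw [norm_mul, norm_pow, Real.norm_of_nonneg ht.1.le, Real.norm_eq_abs]
    calc _ ≤ 1 * η := mul_le_mul (pow_le_one₀ ht.1.le ht.2) h1 (abs_nonneg _) zero_le_one
      _ = η := one_mul _
  · refine Filter.Eventually.of_forall fun t ht => ?_
    rw [hIoc] at ht
    refine continuousAt_const.mul (ContinuousAt.comp (f := fun θ' => b + t • (θ' - b)) ?_
      (by fun_prop))
    exact hh.continuousAt (hB.mem_nhds (segment_mem hc hb hθ ⟨ht.1.le, ht.2⟩))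

/-- Differentiation under the integral sign; the chain rule along b + t(θ - b) produces a factor t.
This is why the averages carry a weight t^a: the family is closed under differentiation, with a
replaced by a + 1. -/
theorem hasFDerivAt_segAvg (hB : IsOpen B) (hc : Convex ℝ B) (hb : b ∈ B) {h : Par q → ℝ}
    {g : Fin q → Par q → ℝ} (hg : ∀ θ ∈ B, HasFDerivAt h (linForm fun i => g i θ) θ)
    (hgc : ∀ i, ContinuousOn (g i) B) {η : ℝ} (hη : ∀ i, ∀ θ ∈ B, |g i θ| ≤ η)
    (a : ℕ) {θ : Par q} (hθ : θ ∈ B) :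
    HasFDerivAt (segAvg b a h) (linForm fun i => segAvg b (a + 1) (g i) θ) θ := by
  have hIoc : Set.uIoc (0 : ℝ) 1 = Set.Ioc 0 1 := Set.uIoc_of_le zero_le_one
  have hhc : ContinuousOn h B := fun θ hθ => (hg θ hθ).continuousAt.continuousWithinAt
  set F' : Par q → ℝ → Par q →L[ℝ] ℝ := fun θ t =>
    linForm fun i => t ^ (a + 1) * g i (b + t • (θ - b)) with hF'
  have hF'c : ContinuousOn (F' θ) (Set.uIcc 0 1) := by
    simp only [hF', linForm]
    exact continuousOn_finsetSum _ fun i _ =>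
      (continuousOn_segment hc hb hθ (hgc i) (a + 1)).smul continuousOn_const
  have key := intervalIntegral.hasFDerivAt_integral_of_dominated_of_fderiv_le (μ := volume)
    (𝕜 := ℝ) (a := (0 : ℝ)) (b := 1)
    (F := fun θ t => t ^ a * h (b + t • (θ - b))) (F' := F') (x₀ := θ) (s := B)
    (bound := fun _ => ∑ _i : Fin q, η) (hB.mem_nhds hθ) ?_ ?_ ?_ ?_ intervalIntegrable_const ?_
  · refine key.congr_fderiv ?_
    simp only [hF', linForm]
    rw [intervalIntegral.integral_finsetSum]
    · refine Finset.sum_congr rfl fun i _ => ?_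
      rw [intervalIntegral.integral_smul_const]
      rfl
    · intro i _
      exact ((continuousOn_segment hc hb hθ (hgc i) (a + 1)).smul
        continuousOn_const).intervalIntegrable
  · filter_upwards [hB.mem_nhds hθ] with θ' hθ'
    exact (continuousOn_segment hc hb hθ' hhc a).intervalIntegrable.def'.aestronglyMeasurable
  · exact (continuousOn_segment hc hb hθ hhc a).intervalIntegrable
  · exact hF'c.intervalIntegrable.def'.aestronglyMeasurable
  · refine Filter.Eventually.of_forall fun t ht θ' hθ' => (norm_linForm_le _).trans ?_
    rw [hIoc] at ht
    refine Finset.sum_le_sum fun i _ => ?_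
    rw [abs_mul, abs_of_nonneg (pow_nonneg ht.1.le _)]
    calc _ ≤ 1 * η := mul_le_mul (pow_le_one₀ ht.1.le ht.2)
          (hη i _ (segment_mem hc hb hθ' ⟨ht.1.le, ht.2⟩)) (abs_nonneg _) zero_le_one
      _ = η := one_mul _
  · refine Filter.Eventually.of_forall fun t ht θ' hθ' => ?_
    rw [hIoc] at ht
    have h1 : HasFDerivAt (fun θ : Par q => b + t • (θ - b))
        (t • ContinuousLinearMap.id ℝ (Par q)) θ' :=
      (((hasFDerivAt_id θ').sub_const b).const_smul t).const_add b
    have h2 := ((hg _ (segment_mem hc hb hθ' ⟨ht.1.le, ht.2⟩)).comp θ' h1).const_mul (t ^ a)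
    refine HasFDerivAt.congr_fderiv h2 ?_
    ext v
    simp only [hF', linForm_apply, smul_apply, ContinuousLinearMap.comp_apply,
      ContinuousLinearMap.id_apply, PiLp.smul_apply, smul_eq_mul, Finset.mul_sum]
    exact Finset.sum_congr rfl fun i _ => by ring

/-- The bound does not deteriorate because t^a ≤ 1 on the unit interval. The induction needs all a
at once, since each derivative raises the exponent. -/
theorem BddDerivs.segAvg (hB : IsOpen B) (hc : Convex ℝ B) (hb : b ∈ B) {r : ℕ} {η : ℝ}
    {h : Par q → ℝ} (hh : BddDerivs B r η h) (a : ℕ) : BddDerivs B r η (segAvg b a h) := by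
  induction r generalizing h a with
  | zero =>
    exact ⟨continuousOn_segAvg hB hc hb hh.1 hh.2 a, fun θ hθ => abs_segAvg_le hc hb hh.2 a hθ⟩
  | succ r ih =>
    obtain ⟨h1, g, hg, hgb⟩ := hh
    refine ⟨fun θ hθ => abs_segAvg_le hc hb h1 a hθ, fun i => MMDMixture.segAvg b (a + 1) (g i),
      fun θ hθ => ?_, fun i => ih (hgb i) (a + 1)⟩
    exact hasFDerivAt_segAvg hB hc hb hg (fun i => (hgb i).continuousOn)
      (fun i => (hgb i).bound) a hθ

/-- Hadamard's lemma. -/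
theorem hadamard_identity (hc : Convex ℝ B) (hb : b ∈ B) {h : Par q → ℝ}
    {g : Fin q → Par q → ℝ} (hg : ∀ θ ∈ B, HasFDerivAt h (linForm fun i => g i θ) θ)
    (hgc : ∀ i, ContinuousOn (g i) B) {θ : Par q} (hθ : θ ∈ B) :
    h θ = h b + ∑ i, (θ - b) i * segAvg b 0 (g i) θ := by
  have h1 : ∀ t ∈ Set.uIcc (0 : ℝ) 1, HasDerivAt (fun t : ℝ => h (b + t • (θ - b)))
      (∑ i, (t ^ 0 * g i (b + t • (θ - b))) * (θ - b) i) t := by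
    intro t ht
    rw [Set.uIcc_of_le zero_le_one] at ht
    have h2 : HasDerivAt (fun t : ℝ => b + t • (θ - b)) (θ - b) t := by
      simpa using ((hasDerivAt_id t).smul_const (θ - b)).const_add b
    have h3 := (hg _ (segment_mem hc hb hθ ht)).comp_hasDerivAt t h2
    rw [linForm_apply] at h3
    refine HasDerivAt.congr_deriv h3 (Finset.sum_congr rfl fun i _ => ?_)
    rw [pow_zero, one_mul]
  have h4 := intervalIntegral.integral_eq_sub_of_hasDerivAt h1 ?_
  · rw [intervalIntegral.integral_finsetSum] at h4
    · simp only [intervalIntegral.integral_mul_const, one_smul, zero_smul, add_zero,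
        add_sub_cancel] at h4
      have h5 : h θ = h b + (h θ - h b) := by ring
      rw [h5, ← h4]
      congr 1
      exact Finset.sum_congr rfl fun i _ => mul_comm _ _
    · intro i _
      exact ((continuousOn_segment hc hb hθ (hgc i) 0).mul continuousOn_const).intervalIntegrable
  · refine ContinuousOn.intervalIntegrable ?_
    exact continuousOn_finsetSum _ fun i _ =>
      (continuousOn_segment hc hb hθ (hgc i) 0).mul continuousOn_const

/-- A weighted sum of the values of a function with small derivatives is controlled by the moments
of the weights. -/
theorem BddDerivs.abs_sum_le {ι : Type*} [Fintype ι] (hB : IsOpen B) (hc : Convex ℝ B)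
    (z : Par q) (hBz : ∀ θ ∈ B, ‖θ - z‖ ≤ 1) (τ : ι → Par q) {r : ℕ} {η : ℝ}
    {h : Par q → ℝ} (hh : BddDerivs B r η h) (hη : 0 ≤ η) {I : Finset ι} (hI : I.card ≤ r + 1)
    (hτ : ∀ s ∈ I, τ s ∈ B) {σ : ι → ℝ} (hσ : ∀ s ∉ I, σ s = 0) :
    |∑ s, σ s * h (τ s)| ≤ (1 + 2 * q) ^ r * η * momSum z τ r σ := by
  classical
  induction r generalizing h I σ with
  | zero =>
    have hm := abs_sum_le_momSum z τ 0 σ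
    rcases I.eq_empty_or_nonempty with rfl | ⟨s, hs⟩
    · have : ∀ s, σ s = 0 := fun s => hσ s (Finset.notMem_empty s)
      simp only [this, zero_mul, Finset.sum_const_zero, abs_zero, pow_zero, one_mul]
      exact mul_nonneg hη (momSum_nonneg z τ 0 σ)
    · have hs1 : ∀ t, t ≠ s → σ t = 0 := fun t ht =>
        hσ t fun htI => ht (Finset.card_le_one.1 hI t htI s hs)
      have h1 : ∑ t, σ t * h (τ t) = σ s * h (τ s) :=
        Finset.sum_eq_single s (fun t _ ht => by simp [hs1 t ht]) (by simp)
      have h2 : ∑ t, σ t = σ s :=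
        Finset.sum_eq_single s (fun t _ ht => hs1 t ht) (by simp)
      rw [h1, abs_mul, pow_zero, one_mul, mul_comm]
      rw [h2] at hm
      exact mul_le_mul (hh.bound _ (hτ s hs)) hm (abs_nonneg _) hη
  | succ r ih =>
    have hK : (1 : ℝ) ≤ (1 + 2 * q) ^ r := one_le_pow₀ (by linarith [Nat.cast_nonneg (α := ℝ) q])
    have hM := momSum_nonneg z τ (r + 1) σ
    rcases I.eq_empty_or_nonempty with rfl | ⟨s, hs⟩
    · have : ∀ s, σ s = 0 := fun s => hσ s (Finset.notMem_empty s)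
      simp only [this, zero_mul, Finset.sum_const_zero, abs_zero]
      exact mul_nonneg (mul_nonneg (by positivity) hη) (momSum_nonneg z τ _ _)
    · obtain ⟨h1, g, hg, hgb⟩ := hh
      have hbB := hτ s hs
      -- Hadamard's lemma at the point τ s. The new weights (τ t - τ s)_i σ t vanish at t = s, so
      -- one point disappears while the averaged derivatives have one derivative fewer, and the
      -- induction closes. The first term contributes η and the q others 2(1 + 2q)^r η each, whence
      -- the factor 1 + 2q per step.
      have e1 : ∑ t, σ t * h (τ t) = h (τ s) * ∑ t, σ t
          + ∑ i, ∑ t, ((τ t - τ s) i * σ t) * MMDMixture.segAvg (τ s) 0 (g i) (τ t) := by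
        rw [Finset.sum_comm, Finset.mul_sum, ← Finset.sum_add_distrib]
        refine Finset.sum_congr rfl fun t _ => ?_
        by_cases ht : t ∈ I
        · rw [hadamard_identity hc hbB hg (fun i => (hgb i).continuousOn) (hτ t ht), mul_add,
            Finset.mul_sum, mul_comm]
          congr 1
          exact Finset.sum_congr rfl fun i _ => by ring
        · simp [hσ t ht]
      have e2 : ∀ i, |∑ t, ((τ t - τ s) i * σ t) * MMDMixture.segAvg (τ s) 0 (g i) (τ t)|
          ≤ (1 + 2 * q) ^ r * η * (2 * momSum z τ (r + 1) σ) := by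
        intro i
        refine (ih ((hgb i).segAvg hB hc hbB 0) (I := I.erase s) ?_
          (fun t ht => hτ t (Finset.mem_of_mem_erase ht)) ?_).trans ?_
        · rw [Finset.card_erase_of_mem hs]
          omega
        · intro t ht
          by_cases hts : t = s
          · simp [hts]
          · simp [hσ t fun h => ht (Finset.mem_erase.2 ⟨hts, h⟩)]
        · exact mul_le_mul_of_nonneg_left (momSum_coord_sub z τ r i (τ s) (hBz _ hbB) σ)
            (by positivity)
      rw [e1]
      calc _ ≤ |h (τ s) * ∑ t, σ t|
            + ∑ i, |∑ t, ((τ t - τ s) i * σ t) * MMDMixture.segAvg (τ s) 0 (g i) (τ t)| :=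
            (abs_add_le _ _).trans (by gcongr; exact Finset.abs_sum_le_sum_abs _ _)
        _ ≤ η * momSum z τ (r + 1) σ
            + ∑ _i : Fin q, (1 + 2 * q) ^ r * η * (2 * momSum z τ (r + 1) σ) := by
            refine add_le_add ?_ (Finset.sum_le_sum fun i _ => e2 i)
            rw [abs_mul]
            exact mul_le_mul (h1 _ hbB) (abs_sum_le_momSum z τ _ σ) (abs_nonneg _) hη
        _ ≤ (1 + 2 * q) ^ r * (η * momSum z τ (r + 1) σ)
            + ∑ _i : Fin q, (1 + 2 * q) ^ r * η * (2 * momSum z τ (r + 1) σ) := by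
            gcongr ?_ + _
            exact le_mul_of_one_le_left (mul_nonneg hη hM) hK
        _ = _ := by
            simp
            ring

end hadamard


/-! ### Taylor polynomials -/

section taylor

variable {q : ℕ}

/-- The factorial `α!` of a multi-index. -/
def idxFactorial (α : Fin q → ℕ) : ℕ := ∏ i, (α i).factorial

theorem idxFactorial_pos (α : Fin q → ℕ) : 0 < idxFactorial α :=
  Finset.prod_pos fun _ _ => Nat.factorial_pos _

theorem idxFactorial_add_single (α : Fin q → ℕ) (i : Fin q) :
    idxFactorial (α + Pi.single i 1) = (α i + 1) * idxFactorial α := by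
  unfold idxFactorial
  rw [← Finset.mul_prod_erase _ _ (Finset.mem_univ i),
    ← Finset.mul_prod_erase (Finset.univ) (fun j => (α j).factorial) (Finset.mem_univ i),
    ← mul_assoc]
  congr 1
  · simp [Nat.factorial_succ]
  · refine Finset.prod_congr rfl fun j hj => ?_
    simp [Finset.ne_of_mem_erase hj]

/-- The Taylor polynomial of order `r` of `f` at `z`. -/
noncomputable def taylorPoly (r : ℕ) (z : Par q) (f : Par q → ℝ) (θ : Par q) : ℝ :=
  ∑ α ∈ multiIdx q r, multiD α f z / idxFactorial α * monom α (θ - z)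

/-- When α i = 0 the subtraction of e_i truncates, but the factor α i removes the term. -/
theorem hasFDerivAt_monom (α : Fin q → ℕ) (z θ : Par q) :
    HasFDerivAt (fun θ => monom α (θ - z))
      (linForm fun i => α i * monom (α - Pi.single i 1) (θ - z)) θ := by
  have h1 : ∀ i ∈ (Finset.univ : Finset (Fin q)), HasFDerivAt (fun θ : Par q => (θ - z) i ^ α i)
      (((α i : ℝ) * (θ - z) i ^ (α i - 1)) • (EuclideanSpace.proj i : Par q →L[ℝ] ℝ)) θ := by
    intro i _
    have h2 : HasFDerivAt (fun θ : Par q => (θ - z) i)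
        (EuclideanSpace.proj i : Par q →L[ℝ] ℝ) θ :=
      (EuclideanSpace.proj i : Par q →L[ℝ] ℝ).hasFDerivAt.comp θ ((hasFDerivAt_id θ).sub_const z)
    refine (h2.pow (α i)).congr_fderiv ?_
    simp [nsmul_eq_mul]
  refine (HasFDerivAt.finsetProd h1).congr_fderiv ?_
  unfold linForm
  refine Finset.sum_congr rfl fun i _ => ?_
  rw [smul_smul]
  congr 1
  refine Eq.trans ?_ (congrArg _ (Finset.mul_prod_erase Finset.univ
    (fun j => (θ - z) j ^ (α - Pi.single i 1 : Fin q → ℕ) j) (Finset.mem_univ i)))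
  rw [mul_comm, mul_assoc]
  congr 1
  congr 1
  · simp
  · refine Finset.prod_congr rfl fun j hj => ?_
    simp [Finset.ne_of_mem_erase hj]

/-- The multi-indices with α i > 0 are exactly the β + e_i. This reindexes the differentiated Taylor
polynomial, in which the terms with α i = 0 have dropped out. -/
theorem sum_multiIdx_succ (r : ℕ) (i : Fin q) (F : (Fin q → ℕ) → ℝ) (hF : ∀ α, α i = 0 → F α = 0) :
    ∑ α ∈ multiIdx q (r + 1), F α = ∑ β ∈ multiIdx q r, F (β + Pi.single i 1) := by
  have hinj : Set.InjOn (fun α : Fin q → ℕ => α + Pi.single i 1)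
      (multiIdx q r : Set (Fin q → ℕ)) := fun a _ b _ h => add_right_cancel h
  rw [← Finset.sum_image (f := F) hinj]
  symm
  refine Finset.sum_subset ?_ ?_
  · intro α hα
    obtain ⟨β, hβ, rfl⟩ := Finset.mem_image.1 hα
    rw [mem_multiIdx] at hβ ⊢
    rw [sum_add_single]
    omega
  · intro α hα hα'
    apply hF
    by_contra h
    have h1 : α = (α - Pi.single i 1) + Pi.single i 1 := by
      funext j
      by_cases hj : j = i
      · subst hj
        simp
        omega
      · simp [hj]
    refine hα' (Finset.mem_image.2 ⟨α - Pi.single i 1, ?_, h1.symm⟩)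
    rw [mem_multiIdx] at hα ⊢
    rw [h1, sum_add_single] at hα
    omega

/-- Since (β_i + 1)/(β + e_i)! = 1/β!, differentiating termwise produces the Taylor polynomials of
the partial derivatives. Hence remainders differentiate to remainders, one order lower. -/
theorem hasFDerivAt_taylorPoly {U : Set (Par q)} (hU : IsOpen U) {r : ℕ} {z : Par q} (hz : z ∈ U)
    {f : Par q → ℝ} (hf : ContDiffOn ℝ ((r + 1 : ℕ) : WithTop ℕ∞) f U) (θ : Par q) :
    HasFDerivAt (taylorPoly (r + 1) z f)
      (linForm fun i => taylorPoly r z (partialD i f) θ) θ := by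
  have h1 : HasFDerivAt (taylorPoly (r + 1) z f) (∑ α ∈ multiIdx q (r + 1),
      (multiD α f z / idxFactorial α) •
        linForm fun i => α i * monom (α - Pi.single i 1) (θ - z)) θ := by
    refine HasFDerivAt.fun_sum fun α _ => ?_
    exact (hasFDerivAt_monom α z θ).const_mul _
  refine h1.congr_fderiv ?_
  ext v
  simp only [sum_apply, smul_apply, linForm_apply, smul_eq_mul,
    Finset.mul_sum]
  rw [Finset.sum_comm]
  refine Finset.sum_congr rfl fun i _ => ?_
  rw [sum_multiIdx_succ r i _ (fun α hα => by simp [hα]), taylorPoly, Finset.sum_mul]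
  refine Finset.sum_congr rfl fun β hβ => ?_
  rw [mem_multiIdx] at hβ
  have hf' : ContDiffOn ℝ ((∑ j, β j + 1 : ℕ) : WithTop ℕ∞) f U :=
    hf.of_le (by exact_mod_cast Nat.succ_le_succ hβ)
  rw [multiD_add_single' hU β i hf' hz, idxFactorial_add_single, add_tsub_cancel_right]
  have h2 : (idxFactorial β : ℝ) ≠ 0 := by exact_mod_cast (idxFactorial_pos β).ne'
  have h3 : ((β i : ℝ) + 1) ≠ 0 := by positivity
  simp only [Pi.add_apply, Pi.single_eq_same]
  push_cast
  field_simp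

theorem monom_sub_self (α : Fin q → ℕ) (hα : α ≠ 0) (z : Par q) : monom α (z - z) = 0 := by
  obtain ⟨i, hi⟩ := Function.ne_iff.1 hα
  unfold monom
  refine Finset.prod_eq_zero (Finset.mem_univ i) ?_
  rw [sub_self]
  exact zero_pow hi

theorem taylorPoly_self (r : ℕ) (z : Par q) (f : Par q → ℝ) : taylorPoly r z f z = f z := by
  unfold taylorPoly
  rw [Finset.sum_eq_single 0]
  · simp [idxFactorial]
  · intro α _ hα
    rw [monom_sub_self α hα, mul_zero]
  · exact fun h => absurd (zero_mem_multiIdx q r) h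

/-- The partial derivatives of the remainder of f are the remainders of the partial derivatives of
f. At order zero the remainder is an increment from z, bounded by η. The bounds climb back through
the orders by the mean value inequality, since each remainder vanishes at z and the radius is at
most 1; a level costs a factor q, rounded up to q + 1 so that the bounds increase. -/
theorem bddDerivs_sub_taylorPoly {z : Par q} {ρ : ℝ} (hρ : 0 < ρ) (hρ1 : ρ ≤ 1) {η : ℝ}
    (hη : 0 ≤ η) {r : ℕ} {f : Par q → ℝ}
    (hf : ContDiffOn ℝ (r : WithTop ℕ∞) f (Metric.ball z ρ))
    (hfη : ∀ γ : Fin q → ℕ, ∑ i, γ i = r → ∀ θ ∈ Metric.ball z ρ,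
      |multiD γ f θ - multiD γ f z| ≤ η) :
    BddDerivs (Metric.ball z ρ) r ((q + 1) ^ r * η) (fun θ => f θ - taylorPoly r z f θ) := by
  have hz : z ∈ Metric.ball z ρ := Metric.mem_ball_self hρ
  induction r generalizing f with
  | zero =>
    have h0 : ∀ θ, taylorPoly 0 z f θ = f z := by
      intro θ
      unfold taylorPoly
      rw [Finset.sum_eq_single 0]
      · simp [idxFactorial]
      · intro α hα hα0
        refine absurd (funext fun i => ?_) hα0
        have := mem_multiIdx.1 hα
        have := Finset.single_le_sum (f := α) (fun j _ => Nat.zero_le _) (Finset.mem_univ i)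
        simp only [Pi.zero_apply]
        omega
      · exact fun h => absurd (zero_mem_multiIdx q 0) h
    simp only [h0]
    refine ⟨hf.continuousOn.sub continuousOn_const, fun θ hθ => ?_⟩
    simpa using hfη 0 (by simp) θ hθ
  | succ r ih =>
    have hd : ∀ θ ∈ Metric.ball z ρ, HasFDerivAt (fun θ => f θ - taylorPoly (r + 1) z f θ)
        (linForm fun i => partialD i f θ - taylorPoly r z (partialD i f) θ) θ := by
      intro θ hθ
      refine ((hasFDerivAt_linForm Metric.isOpen_ball hf hθ).sub
        (hasFDerivAt_taylorPoly Metric.isOpen_ball hz hf θ)).congr_fderiv ?_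
      ext v
      simp [linForm_apply, sub_mul]
    have hb : ∀ i, BddDerivs (Metric.ball z ρ) r ((q + 1) ^ r * η)
        (fun θ => partialD i f θ - taylorPoly r z (partialD i f) θ) := by
      intro i
      refine ih (contDiffOn_partialD Metric.isOpen_ball hf i) fun γ hγ θ hθ => ?_
      have h1 := multiD_add_single' Metric.isOpen_ball γ i (f := f) (by rwa [hγ])
      rw [← h1 hθ, ← h1 hz]
      exact hfη _ (by rw [sum_add_single, hγ]) θ hθ
    have hle : (q + 1 : ℝ) ^ r * η ≤ (q + 1) ^ (r + 1) * η := by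
      gcongr
      · linarith [Nat.cast_nonneg (α := ℝ) q]
      · omega
    refine ⟨fun θ hθ => ?_, _, hd, fun i => (hb i).mono hle⟩
    have hmv := Convex.norm_image_sub_le_of_norm_hasFDerivWithin_le
      (s := Metric.ball z ρ) (C := q * ((q + 1) ^ r * η))
      (fun θ hθ => (hd θ hθ).hasFDerivWithinAt) (fun θ hθ => ?_) (convex_ball z ρ) hz hθ
    · rw [taylorPoly_self, sub_self, sub_zero, Real.norm_eq_abs] at hmv
      refine hmv.trans ?_
      have h1 : ‖θ - z‖ ≤ 1 := by
        rw [← dist_eq_norm]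
        exact (Metric.mem_ball.1 hθ).le.trans hρ1
      have h2 : 0 ≤ (q + 1 : ℝ) ^ r * η := by positivity
      calc _ ≤ q * ((q + 1) ^ r * η) * 1 := by gcongr
        _ ≤ _ := by
          rw [pow_succ]
          nlinarith
    · refine (norm_linForm_le _).trans ?_
      calc _ ≤ ∑ _i : Fin q, (q + 1 : ℝ) ^ r * η :=
            Finset.sum_le_sum fun i _ => (hb i).bound θ hθ
        _ = _ := by simp

/-- A weighted sum of the values of `f` at points near `z` is, up to a small multiple of the moments
of the weights, given by the derivatives of `f` at `z` and these moments. -/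
theorem abs_sum_sub_taylor_le {ι : Type*} [Fintype ι] {z : Par q} {ρ : ℝ} (hρ : 0 < ρ)
    (hρ1 : ρ ≤ 1) {η : ℝ} (hη : 0 ≤ η) {r : ℕ} {f : Par q → ℝ}
    (hf : ContDiffOn ℝ (r : WithTop ℕ∞) f (Metric.ball z ρ))
    (hfη : ∀ γ : Fin q → ℕ, ∑ i, γ i = r → ∀ θ ∈ Metric.ball z ρ,
      |multiD γ f θ - multiD γ f z| ≤ η)
    (τ : ι → Par q) {I : Finset ι} (hI : I.card ≤ r + 1) (hτ : ∀ s ∈ I, τ s ∈ Metric.ball z ρ)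
    {σ : ι → ℝ} (hσ : ∀ s ∉ I, σ s = 0) :
    |∑ s, σ s * f (τ s) - ∑ α ∈ multiIdx q r,
        multiD α f z / idxFactorial α * ∑ s, σ s * monom α (τ s - z)|
      ≤ ((1 + 2 * q) ^ r * (q + 1) ^ r) * η * momSum z τ r σ := by
  have h1 := (bddDerivs_sub_taylorPoly hρ hρ1 hη hf hfη).abs_sum_le Metric.isOpen_ball
    (convex_ball z ρ) z (fun θ hθ => by
      rw [← dist_eq_norm]
      exact (Metric.mem_ball.1 hθ).le.trans hρ1) τ (by positivity) hI hτ hσ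
  convert h1 using 1
  · congr 1
    simp only [mul_sub, Finset.sum_sub_distrib]
    congr 1
    simp only [taylorPoly, Finset.mul_sum]
    rw [Finset.sum_comm]
    exact Finset.sum_congr rfl fun s _ => Finset.sum_congr rfl fun α _ => by ring
  · ring

/-- If the derivatives of order `r + 1` of `f` are bounded near `z`, the increments of those of
order `r` are. -/
theorem abs_multiD_sub_le {z : Par q} {ρ : ℝ} (hρ1 : ρ ≤ 1) {r : ℕ} {f : Par q → ℝ}
    (hf : ContDiffOn ℝ ((r + 1 : ℕ) : WithTop ℕ∞) f (Metric.ball z ρ)) {M : ℝ}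
    {γ : Fin q → ℕ} (hγ : ∑ i, γ i = r)
    (hM : ∀ i, ∀ θ ∈ Metric.ball z ρ, |multiD (γ + Pi.single i 1) f θ| ≤ M) {θ : Par q}
    (hθ : θ ∈ Metric.ball z ρ) :
    |multiD γ f θ - multiD γ f z| ≤ q * M := by
  have hρ : 0 < ρ := dist_nonneg.trans_lt hθ
  have hz : z ∈ Metric.ball z ρ := Metric.mem_ball_self hρ
  have hg : ContDiffOn ℝ ((0 + 1 : ℕ) : WithTop ℕ∞) (multiD γ f) (Metric.ball z ρ) :=
    contDiffOn_multiD Metric.isOpen_ball γ _ (by rw [hγ]; convert hf using 2; omega)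
  have hd := fun θ hθ => hasFDerivAt_linForm Metric.isOpen_ball hg (θ := θ) hθ
  have hb : ∀ θ ∈ Metric.ball z ρ, ‖linForm fun i => partialD i (multiD γ f) θ‖ ≤ q * M := by
    intro θ hθ
    refine (norm_linForm_le _).trans ?_
    calc _ ≤ ∑ _i : Fin q, M := by
          refine Finset.sum_le_sum fun i _ => ?_
          rw [← multiD_add_single Metric.isOpen_ball γ i (by rwa [hγ]) hθ]
          exact hM i θ hθ
      _ = _ := by simp
  have hmv := Convex.norm_image_sub_le_of_norm_hasFDerivWithin_le
    (fun θ hθ => (hd θ hθ).hasFDerivWithinAt) hb (convex_ball z ρ) hz hθ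
  have h1 : ‖θ - z‖ ≤ 1 := by
    rw [← dist_eq_norm]
    exact (Metric.mem_ball.1 hθ).le.trans hρ1
  calc _ ≤ _ := hmv
    _ ≤ q * M * 1 := by
      refine mul_le_mul_of_nonneg_left h1 ?_
      exact (norm_nonneg _).trans (hb z hz)
    _ = _ := mul_one _

end taylor


/-! ### Transport between weights with small imbalance on separated sets -/

section transport

variable {q : ℕ}

/-- Every part of `S` which is at distance `δ` from its complement carries a total weight
`≤ B / δ ^ m` of `w`. -/
def SmallImbalance (m : ℕ) (S : Finset (Par q)) (w : Par q → ℝ) (B : ℝ) : Prop :=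
  ∀ J ⊆ S, J.Nonempty → (S \ J).Nonempty → ∀ δ : ℝ, 0 < δ →
    (∀ a ∈ J, ∀ b ∈ S \ J, δ ≤ ‖a - b‖) → |∑ a ∈ J, w a| * δ ^ m ≤ B

/-- A transport plan on `S` with marginals `u` and `v` and cost at most `B`. -/
def HasTransport (m : ℕ) (S : Finset (Par q)) (u v : Par q → ℝ) (B : ℝ) : Prop :=
  ∃ c : Par q → Par q → ℝ, (∀ a b, 0 ≤ c a b) ∧ (∀ a ∈ S, ∑ b ∈ S, c a b = u a) ∧
    (∀ b ∈ S, ∑ a ∈ S, c a b = v b) ∧ ∑ a ∈ S, ∑ b ∈ S, c a b * ‖a - b‖ ^ m ≤ B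

theorem HasTransport.symm {m : ℕ} {S : Finset (Par q)} {u v : Par q → ℝ} {B : ℝ}
    (h : HasTransport m S u v B) : HasTransport m S v u B := by
  obtain ⟨c, h0, h1, h2, h3⟩ := h
  refine ⟨fun a b => c b a, fun a b => h0 b a, h2, h1, ?_⟩
  rw [Finset.sum_comm]
  simpa only [norm_sub_rev] using h3

theorem SmallImbalance.symm {m : ℕ} {S : Finset (Par q)} {u v : Par q → ℝ} {B : ℝ}
    (h : SmallImbalance m S (fun x => u x - v x) B) :
    SmallImbalance m S (fun x => v x - u x) B := by
  intro J hJ hJn hJc δ hδ hsep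
  have := h J hJ hJn hJc δ hδ hsep
  rwa [← abs_neg, ← Finset.sum_neg_distrib, Finset.sum_congr rfl fun x _ => neg_sub (u x) (v x)]
    at this

/-- Merging an atom `a` into its nearest neighbour `b` multiplies the imbalance by at most `2 ^ m`. -/
theorem SmallImbalance.merge {m : ℕ} {S : Finset (Par q)} {w w' : Par q → ℝ} {B : ℝ}
    (h : SmallImbalance m S w B) {a b : Par q} (ha : a ∈ S) (hb : b ∈ S) (hab : a ≠ b)
    (hmin : ∀ x ∈ S, x ≠ a → ‖a - b‖ ≤ ‖a - x‖)
    (hw' : ∀ x, x ≠ b → w' x = w x) (hwb : w' b = w b + w a) :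
    SmallImbalance m (S.erase a) w' (2 ^ m * B) := by
  classical
  intro J hJ hJn hJc δ hδ hsep
  have haJ : a ∉ J := fun h => Finset.notMem_erase a S (hJ h)
  -- As b is nearest to a, ‖b - x‖ ≤ ‖a - b‖ + ‖a - x‖ ≤ 2‖a - x‖. Halving δ is what costs the
  -- factor 2^m.
  have hfar : ∀ x ∈ S, x ≠ a → δ ≤ ‖b - x‖ → δ / 2 ≤ ‖a - x‖ := by
    intro x hx hxa hδx
    have h1 := hmin x hx hxa
    have h2 : ‖b - x‖ ≤ ‖a - b‖ + ‖a - x‖ := by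
      have h3 : b - x = (a - x) - (a - b) := by abel
      rw [h3, add_comm]
      exact norm_sub_le _ _
    linarith
  suffices hs : |∑ x ∈ J, w' x| * (δ / 2) ^ m ≤ B by
    have h2 : (δ / 2) ^ m * 2 ^ m = δ ^ m := by
      rw [← mul_pow]
      congr 1
      ring
    calc _ = 2 ^ m * (|∑ x ∈ J, w' x| * (δ / 2) ^ m) := by rw [← h2]; ring
      _ ≤ _ := by gcongr
  -- The atom a is put on the side of b: a part of the merged set that contains b corresponds to J ∪
  -- {a}, any other part to J itself. Both remain separated by δ/2.
  by_cases hbJ : b ∈ J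
  · have h1 : ∑ x ∈ J, w' x = ∑ x ∈ insert a J, w x := by
      rw [Finset.sum_insert haJ, ← Finset.add_sum_erase _ _ hbJ, ← Finset.add_sum_erase J w hbJ,
        hwb, Finset.sum_congr rfl fun x hx => hw' x (Finset.ne_of_mem_erase hx)]
      ring
    rw [h1]
    have hsd : ∀ y ∈ S \ insert a J, y ∈ S.erase a \ J := by
      intro y hy
      simp only [Finset.mem_sdiff, Finset.mem_insert, not_or, Finset.mem_erase] at hy ⊢
      exact ⟨⟨hy.2.1, hy.1⟩, hy.2.2⟩
    refine h (insert a J) ?_ (Finset.insert_nonempty _ _) ?_ (δ / 2) (by positivity) ?_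
    · exact Finset.insert_subset ha (hJ.trans (Finset.erase_subset a S))
    · obtain ⟨y, hy⟩ := hJc
      refine ⟨y, ?_⟩
      simp only [Finset.mem_sdiff, Finset.mem_insert, not_or, Finset.mem_erase] at hy ⊢
      exact ⟨hy.1.2, hy.1.1, hy.2⟩
    · intro x hx y hy
      have hy' := hsd y hy
      rcases Finset.mem_insert.1 hx with rfl | hxJ
      · refine hfar y (Finset.mem_sdiff.1 hy).1 ?_ (hsep b hbJ y hy')
        rintro rfl
        simp at hy
      · linarith [hsep x hxJ y hy']
  · have h1 : ∑ x ∈ J, w' x = ∑ x ∈ J, w x :=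
      Finset.sum_congr rfl fun x hx => hw' x (by rintro rfl; exact hbJ hx)
    rw [h1]
    refine h J (hJ.trans (Finset.erase_subset a S)) hJn ⟨a, Finset.mem_sdiff.2 ⟨ha, haJ⟩⟩ (δ / 2)
      (by positivity) ?_
    intro x hx y hy
    rw [Finset.mem_sdiff] at hy
    have hxS := Finset.mem_erase.1 (hJ hx)
    by_cases hya : y = a
    · subst hya
      rw [norm_sub_rev]
      refine hfar x hxS.2 hxS.1 ?_
      rw [norm_sub_rev]
      exact hsep x hx b (Finset.mem_sdiff.2 ⟨Finset.mem_erase.2 ⟨hab.symm, hb⟩, hbJ⟩)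
    · linarith [hsep x hx y (Finset.mem_sdiff.2 ⟨Finset.mem_erase.2 ⟨hya, hy.1⟩, hy.2⟩)]

/-- Undoing the merger of an atom `a` with surplus `u a - v a` into `b`. -/
theorem HasTransport.split {m : ℕ} (hm : 1 ≤ m) {S : Finset (Par q)} {u v : Par q → ℝ} {B B' : ℝ}
    (hu : ∀ x, 0 ≤ u x) (hv : ∀ x, 0 ≤ v x) {a b : Par q} (ha : a ∈ S) (hb : b ∈ S) (hab : a ≠ b)
    (hle : v a ≤ u a) (hB : (u a - v a) * ‖a - b‖ ^ m ≤ B)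
    (h : HasTransport m (S.erase a) (fun x => if x = b then u b + (u a - v a) else u x) v B') :
    HasTransport m S u v (2 ^ m * B + 2 ^ m * B') := by
  classical
  obtain ⟨c', h0, h1, h2, h3⟩ := h
  set e := u a - v a with he
  have he0 : 0 ≤ e := sub_nonneg.2 hle
  -- The share of the merged mass at b that came from a. If that mass is zero, then e = 0 and the
  -- convention 0/0 = 0 gives the right value.
  set r := e / (u b + e) with hr
  have hw0 : 0 ≤ u b + e := add_nonneg (hu b) he0
  have hr0 : 0 ≤ r := div_nonneg he0 hw0
  have hr1 : r ≤ 1 := div_le_one_of_le₀ (by linarith [hu b]) hw0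
  have hrw : r * (u b + e) = e := by
    rcases hw0.eq_or_lt with hw | hw
    · have : e = 0 := by linarith [hu b]
      simp [hr, this]
    · rw [hr]
      field_simp
  have hbS : b ∈ S.erase a := Finset.mem_erase.2 ⟨hab.symm, hb⟩
  have hrowb : ∑ y ∈ S.erase a, c' b y = u b + e := by simpa using h1 b hbS
  -- The mass v a stays at a free of charge, and the row of b in the merged plan is divided between
  -- a and b in the ratio r : 1 - r. Only the part given to a travels further than before, by the
  -- detour through b.
  set c : Par q → Par q → ℝ := fun x y => if y = a then (if x = a then v a else 0) else
    if x = a then r * c' b y else if x = b then (1 - r) * c' b y else c' x y with hc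
  have caa : c a a = v a := by simp [hc]
  have cxa : ∀ x, x ≠ a → c x a = 0 := fun x hx => by simp [hc, hx]
  have cay : ∀ y ∈ S.erase a, c a y = r * c' b y := fun y hy => by
    simp [hc, Finset.ne_of_mem_erase hy]
  have cby : ∀ y ∈ S.erase a, c b y = (1 - r) * c' b y := fun y hy => by
    simp [hc, Finset.ne_of_mem_erase hy, hab.symm]
  have cxy : ∀ x ∈ (S.erase a).erase b, ∀ y ∈ S.erase a, c x y = c' x y := fun x hx y hy => by
    have hx1 := Finset.ne_of_mem_erase hx
    have hx2 := Finset.ne_of_mem_erase (Finset.mem_of_mem_erase hx)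
    simp [hc, Finset.ne_of_mem_erase hy, hx1, hx2]
  refine ⟨c, fun x y => ?_, fun x hx => ?_, fun y hy => ?_, ?_⟩
  · simp only [hc]
    split_ifs
    · exact hv a
    · exact le_rfl
    · exact mul_nonneg hr0 (h0 _ _)
    · exact mul_nonneg (by linarith) (h0 _ _)
    · exact h0 _ _
  · rw [← Finset.add_sum_erase _ _ ha]
    by_cases hxa : x = a
    · subst hxa
      rw [caa, Finset.sum_congr rfl cay, ← Finset.mul_sum, hrowb, hrw]
      ring
    · rw [cxa x hxa, zero_add]
      by_cases hxb : x = b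
      · subst hxb
        rw [Finset.sum_congr rfl cby, ← Finset.mul_sum, hrowb]
        linarith
      · have hx' : x ∈ S.erase a := Finset.mem_erase.2 ⟨hxa, hx⟩
        rw [Finset.sum_congr rfl (cxy x (Finset.mem_erase.2 ⟨hxb, hx'⟩)), h1 x hx']
        simp [hxb]
  · rw [← Finset.add_sum_erase _ _ ha]
    by_cases hya : y = a
    · subst hya
      rw [caa, Finset.sum_eq_zero fun x hx => cxa x (Finset.ne_of_mem_erase hx), add_zero]
    · have hy' : y ∈ S.erase a := Finset.mem_erase.2 ⟨hya, hy⟩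
      rw [← Finset.add_sum_erase _ _ hbS, cay y hy', cby y hy',
        Finset.sum_congr rfl fun x hx => cxy x hx y hy', ← h2 y hy',
        ← Finset.add_sum_erase (S.erase a) (fun x => c' x y) hbS]
      ring
  · have e1 : ∀ x, x ≠ a → ∑ y ∈ S, c x y * ‖x - y‖ ^ m
        = ∑ y ∈ S.erase a, c x y * ‖x - y‖ ^ m := fun x hx => by
      rw [← Finset.add_sum_erase _ _ ha, cxa x hx, zero_mul, zero_add]
    have e2 : ∑ y ∈ S, c a y * ‖a - y‖ ^ m = ∑ y ∈ S.erase a, (r * c' b y) * ‖a - y‖ ^ m := by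
      rw [← Finset.add_sum_erase _ _ ha, sub_self, norm_zero, zero_pow (by omega), mul_zero,
        zero_add]
      exact Finset.sum_congr rfl fun y hy => by rw [cay y hy]
    have hpow : ∀ y, ‖a - y‖ ^ m ≤ 2 ^ m * (‖a - b‖ ^ m + ‖b - y‖ ^ m) := by
      intro y
      have h4 : ‖a - y‖ ≤ ‖a - b‖ + ‖b - y‖ := norm_sub_le_norm_sub_add_norm_sub _ _ _
      calc ‖a - y‖ ^ m ≤ (‖a - b‖ + ‖b - y‖) ^ m := by gcongr
        _ ≤ 2 ^ (m - 1) * (‖a - b‖ ^ m + ‖b - y‖ ^ m) :=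
          add_pow_le (norm_nonneg _) (norm_nonneg _) m
        _ ≤ _ := by
          gcongr
          · norm_num
          · omega
    have e3 : ∑ y ∈ S.erase a, (r * c' b y) * ‖a - y‖ ^ m
        ≤ 2 ^ m * B + 2 ^ m * ∑ y ∈ S.erase a, (r * c' b y) * ‖b - y‖ ^ m := by
      calc _ ≤ ∑ y ∈ S.erase a, (r * c' b y) * (2 ^ m * (‖a - b‖ ^ m + ‖b - y‖ ^ m)) :=
            Finset.sum_le_sum fun y _ =>
              mul_le_mul_of_nonneg_left (hpow y) (mul_nonneg hr0 (h0 _ _))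
        _ = 2 ^ m * (r * (∑ y ∈ S.erase a, c' b y) * ‖a - b‖ ^ m)
            + 2 ^ m * ∑ y ∈ S.erase a, (r * c' b y) * ‖b - y‖ ^ m := by
            simp only [Finset.mul_sum, Finset.sum_mul]
            rw [← Finset.sum_add_distrib]
            exact Finset.sum_congr rfl fun y _ => by ring
        _ ≤ _ := by
            rw [hrowb, hrw]
            gcongr
    have e4 : ∑ y ∈ S.erase a, c b y * ‖b - y‖ ^ m
        ≤ 2 ^ m * ∑ y ∈ S.erase a, ((1 - r) * c' b y) * ‖b - y‖ ^ m := by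
      rw [Finset.sum_congr rfl fun y hy => by rw [cby y hy]]
      refine le_mul_of_one_le_left (Finset.sum_nonneg fun y _ => ?_) (one_le_pow₀ (by norm_num))
      exact mul_nonneg (mul_nonneg (by linarith) (h0 _ _)) (by positivity)
    have e5 : ∑ x ∈ (S.erase a).erase b, ∑ y ∈ S, c x y * ‖x - y‖ ^ m
        ≤ 2 ^ m * ∑ x ∈ (S.erase a).erase b, ∑ y ∈ S.erase a, c' x y * ‖x - y‖ ^ m := by
      rw [Finset.sum_congr rfl fun x hx => (e1 x (Finset.ne_of_mem_erase
        (Finset.mem_of_mem_erase hx))).trans (Finset.sum_congr rfl fun y hy => by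
          rw [cxy x hx y hy])]
      refine le_mul_of_one_le_left (Finset.sum_nonneg fun x _ => Finset.sum_nonneg fun y _ => ?_)
        (one_le_pow₀ (by norm_num))
      exact mul_nonneg (h0 _ _) (by positivity)
    rw [← Finset.add_sum_erase _ _ hbS] at h3
    rw [← Finset.add_sum_erase _ _ ha, ← Finset.add_sum_erase _ _ hbS, e2, e1 b hab.symm]
    have e6 : ∑ y ∈ S.erase a, (r * c' b y) * ‖b - y‖ ^ m
        + ∑ y ∈ S.erase a, ((1 - r) * c' b y) * ‖b - y‖ ^ m
        = ∑ y ∈ S.erase a, c' b y * ‖b - y‖ ^ m := by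
      rw [← Finset.sum_add_distrib]
      exact Finset.sum_congr rfl fun y _ => by ring
    have h5 := mul_le_mul_of_nonneg_left h3 (pow_nonneg (zero_le_two (α := ℝ)) m)
    rw [← e6] at h5
    linarith

/-- Induction on the number of points by merging a closest pair a, b. The set {a} is itself
separated from the rest by ‖a - b‖, so moving the surplus at a to b costs at most B. After the
merger the imbalance is at most 2^m B and the induction hypothesis applies; the merger is then
undone. -/
theorem exists_transport {m : ℕ} (hm : 1 ≤ m) (N : ℕ) :
    ∃ C : ℝ, 0 ≤ C ∧ ∀ S : Finset (Par q), S.card ≤ N → ∀ u v : Par q → ℝ, (∀ x, 0 ≤ u x) →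
      (∀ x, 0 ≤ v x) → ∑ x ∈ S, u x = ∑ x ∈ S, v x → ∀ B : ℝ, 0 ≤ B →
      SmallImbalance m S (fun x => u x - v x) B → HasTransport m S u v (C * B) := by
  classical
  induction N with
  | zero =>
    refine ⟨0, le_rfl, fun S hS u v hu _ _ B _ _ => ⟨fun a _ => u a, fun a _ => hu a, ?_⟩⟩
    have : S = ∅ := Finset.card_eq_zero.1 (by omega)
    subst this
    simp
  | succ N ih =>
    obtain ⟨C, hC, hCS⟩ := ih
    -- The first 2^m pays for moving the surplus, the second for the detours of the merged plan,
    -- whose cost is C times the imbalance 2^m B after the merger.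
    refine ⟨2 ^ m + 2 ^ m * (C * 2 ^ m), by positivity, fun S hS => ?_⟩
    by_cases hS1 : S.card ≤ 1
    · intro u v hu hv huv B hB _
      refine ⟨fun a _ => u a, fun a _ => hu a, ?_⟩
      rcases Nat.le_one_iff_eq_zero_or_eq_one.1 hS1 with h | h
      · have : S = ∅ := Finset.card_eq_zero.1 h
        subst this
        simp
        positivity
      · obtain ⟨a, rfl⟩ := Finset.card_eq_one.1 h
        have hua : u a = v a := by simpa using huv
        refine ⟨by simp, by simpa using hua, ?_⟩
        simp only [Finset.sum_singleton, sub_self, norm_zero]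
        rw [zero_pow (by omega), mul_zero]
        positivity
    · have hoff : S.offDiag.Nonempty := by
        obtain ⟨a, ha, b, hb, hab⟩ := Finset.one_lt_card.1 (not_le.1 hS1)
        exact ⟨(a, b), Finset.mem_offDiag.2 ⟨ha, hb, hab⟩⟩
      obtain ⟨⟨a, b⟩, habS, hmin⟩ := Finset.exists_min_image S.offDiag
        (fun x => ‖x.1 - x.2‖) hoff
      obtain ⟨ha, hb, hab⟩ := Finset.mem_offDiag.1 habS
      simp only at ha hb hab
      have hmina : ∀ x ∈ S, x ≠ a → ‖a - b‖ ≤ ‖a - x‖ := fun x hx hxa =>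
        hmin (a, x) (Finset.mem_offDiag.2 ⟨ha, hx, hxa.symm⟩)
      have key : ∀ u v : Par q → ℝ, (∀ x, 0 ≤ u x) → (∀ x, 0 ≤ v x) →
          ∑ x ∈ S, u x = ∑ x ∈ S, v x → ∀ B : ℝ, 0 ≤ B →
          SmallImbalance m S (fun x => u x - v x) B → v a ≤ u a →
          HasTransport m S u v ((2 ^ m + 2 ^ m * (C * 2 ^ m)) * B) := by
        intro u v hu hv huv B hB hbal hle
        have hbS : b ∈ S.erase a := Finset.mem_erase.2 ⟨hab.symm, hb⟩
        have h1 : HasTransport m (S.erase a)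
            (fun x => if x = b then u b + (u a - v a) else u x) v (C * (2 ^ m * B)) := by
          refine hCS _ (by rw [Finset.card_erase_of_mem ha]; omega) _ _ (fun x => ?_) hv ?_ _
            (by positivity) ?_
          · split_ifs
            · linarith [hu b]
            · exact hu x
          · rw [← Finset.add_sum_erase _ _ hbS, if_pos rfl,
              Finset.sum_congr rfl fun x hx => if_neg (Finset.ne_of_mem_erase hx)]
            rw [← Finset.add_sum_erase _ _ ha, ← Finset.add_sum_erase _ _ ha,
              ← Finset.add_sum_erase _ _ hbS] at huv
            linarith
          · refine hbal.merge ha hb hab hmina (fun x hx => ?_) ?_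
            · simp [hx]
            · simp only [if_true]
              ring
        have h2 : (u a - v a) * ‖a - b‖ ^ m ≤ B := by
          have := hbal {a} (by simpa using ha) (Finset.singleton_nonempty a)
            ⟨b, by simp [hb, hab.symm]⟩ ‖a - b‖ (norm_pos_iff.2 (sub_ne_zero.2 hab)) ?_
          · simpa [abs_of_nonneg (sub_nonneg.2 hle)] using this
          · intro x hx y hy
            obtain rfl := Finset.mem_singleton.1 hx
            simp only [Finset.mem_sdiff, Finset.mem_singleton] at hy
            exact hmina y hy.1 hy.2
        convert HasTransport.split hm hu hv ha hb hab hle h2 h1 using 1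
        ring
      -- If a has a deficit instead of a surplus, the roles of the two marginals are exchanged.
      intro u v hu hv huv B hB hbal
      rcases le_total (v a) (u a) with hle | hle
      · exact key u v hu hv huv B hB hbal hle
      · exact (key v u hv hu huv.symm B hB hbal.symm hle).symm

end transport

/-! ### The Wasserstein distance between discrete distributions -/

section wass

variable {q : ℕ}

/-- The integral of `F` with respect to the discrete distribution `G`. -/
noncomputable def mixInt (G : Par q →₀ ℝ) (F : Par q → ℝ) : ℝ := ∑ θ ∈ G.support, G θ * F θ

theorem mixInt_eq_sum {G : Par q →₀ ℝ} {S : Finset (Par q)} (hS : G.support ⊆ S)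
    (F : Par q → ℝ) : mixInt G F = ∑ θ ∈ S, G θ * F θ :=
  Finset.sum_subset hS fun θ _ h => by simp [Finsupp.notMem_support_iff.1 h]

theorem sInf_cost_nonneg (l : ℕ) (G H : Par q →₀ ℝ) :
    0 ≤ sInf {s : ℝ | ∃ c, IsCoupling G H c ∧
      s = ∑ a ∈ G.support, ∑ b ∈ H.support, c a b * ‖a - b‖ ^ l} := by
  refine Real.sInf_nonneg ?_
  rintro s ⟨c, hc, rfl⟩
  exact Finset.sum_nonneg fun a _ => Finset.sum_nonneg fun b _ =>
    mul_nonneg (hc.1 a b) (by positivity)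

theorem wasserstein_pow {l : ℕ} (hl : 1 ≤ l) (G H : Par q →₀ ℝ) :
    wasserstein l G H ^ l = sInf {s : ℝ | ∃ c, IsCoupling G H c ∧
      s = ∑ a ∈ G.support, ∑ b ∈ H.support, c a b * ‖a - b‖ ^ l} := by
  unfold wasserstein
  rw [one_div, Real.rpow_inv_natCast_pow (sInf_cost_nonneg l G H) (by omega)]

theorem wasserstein_pow_le {l : ℕ} (hl : 1 ≤ l) {G H : Par q →₀ ℝ} {c : Par q → Par q → ℝ}
    (hc : IsCoupling G H c) {B : ℝ}
    (hB : ∑ a ∈ G.support, ∑ b ∈ H.support, c a b * ‖a - b‖ ^ l ≤ B) :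
    wasserstein l G H ^ l ≤ B := by
  rw [wasserstein_pow hl]
  refine le_trans (csInf_le ?_ ⟨c, hc, rfl⟩) hB
  refine ⟨0, ?_⟩
  rintro s ⟨c, hc, rfl⟩
  exact Finset.sum_nonneg fun a _ => Finset.sum_nonneg fun b _ =>
    mul_nonneg (hc.1 a b) (by positivity)

theorem isCoupling_prod {Θ : Set (Par q)} {k : ℕ} {G H : Par q →₀ ℝ} (hG : G ∈ mixAtMost Θ k)
    (hH : H ∈ mixAtMost Θ k) : IsCoupling G H fun a b => G a * H b := by
  refine ⟨fun a b => mul_nonneg (hG.2.1 a) (hH.2.1 b), fun a _ => ?_, fun b _ => ?_⟩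
  · rw [← Finset.mul_sum, hH.2.2.1, mul_one]
  · rw [← Finset.sum_mul, hG.2.2.1, one_mul]

theorem wasserstein_pow_le_diam {l : ℕ} (hl : 1 ≤ l) {Θ : Set (Par q)} {k : ℕ}
    {G H : Par q →₀ ℝ} (hG : G ∈ mixAtMost Θ k) (hH : H ∈ mixAtMost Θ k) {D : ℝ}
    (hD : ∀ a ∈ Θ, ∀ b ∈ Θ, ‖a - b‖ ≤ D) : wasserstein l G H ^ l ≤ D ^ l := by
  refine wasserstein_pow_le hl (isCoupling_prod hG hH) ?_
  calc _ ≤ ∑ a ∈ G.support, ∑ b ∈ H.support, (G a * H b) * D ^ l := by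
        refine Finset.sum_le_sum fun a ha => Finset.sum_le_sum fun b hb => ?_
        refine mul_le_mul_of_nonneg_left ?_ (mul_nonneg (hG.2.1 a) (hH.2.1 b))
        gcongr
        exact hD a (hG.1 a ha) b (hH.1 b hb)
    _ = D ^ l := by
        simp only [← Finset.sum_mul, ← Finset.mul_sum, hH.2.2.1, hG.2.2.1, mul_one, one_mul]

/-- The easy half of Kantorovich duality: the difference of the integrals is the integral of F(a) -
F(b) against any coupling. -/
theorem abs_mixInt_sub_le {Θ : Set (Par q)} {k : ℕ} {G H : Par q →₀ ℝ} (hG : G ∈ mixAtMost Θ k)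
    (hH : H ∈ mixAtMost Θ k) {F : Par q → ℝ} {L : ℝ} (hF : ∀ a b, |F a - F b| ≤ L * ‖a - b‖)
    (hL : 0 < L) :
    |mixInt G F - mixInt H F| ≤ L * wasserstein 1 G H := by
  have h1 := wasserstein_pow le_rfl G H
  rw [pow_one] at h1
  rw [h1, mul_comm, ← div_le_iff₀ hL]
  refine le_csInf ⟨_, _, isCoupling_prod hG hH, rfl⟩ ?_
  rintro s ⟨c, hc, rfl⟩
  rw [div_le_iff₀ hL]
  have e1 : mixInt G F = ∑ a ∈ G.support, ∑ b ∈ H.support, c a b * F a :=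
    Finset.sum_congr rfl fun a ha => by rw [← Finset.sum_mul, hc.2.1 a ha]
  have e2 : mixInt H F = ∑ a ∈ G.support, ∑ b ∈ H.support, c a b * F b := by
    rw [Finset.sum_comm]
    exact Finset.sum_congr rfl fun b hb => by rw [← Finset.sum_mul, hc.2.2 b hb]
  rw [e1, e2, ← Finset.sum_sub_distrib, Finset.sum_mul]
  refine (Finset.abs_sum_le_sum_abs _ _).trans (Finset.sum_le_sum fun a _ => ?_)
  rw [← Finset.sum_sub_distrib, Finset.sum_mul]
  refine (Finset.abs_sum_le_sum_abs _ _).trans (Finset.sum_le_sum fun b _ => ?_)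
  rw [← mul_sub, abs_mul, abs_of_nonneg (hc.1 a b), pow_one, mul_assoc, mul_comm ‖a - b‖]
  exact mul_le_mul_of_nonneg_left (hF a b) (hc.1 a b)

/-- A transport plan on a set which contains both supports bounds the Wasserstein distance. -/
theorem HasTransport.wasserstein_le {l : ℕ} (hl : 1 ≤ l) {G H : Par q →₀ ℝ}
    {S : Finset (Par q)} (hGS : G.support ⊆ S) (hHS : H.support ⊆ S) {B : ℝ} (h : HasTransport l S G H B) :
    wasserstein l G H ^ l ≤ B := by
  obtain ⟨c, h0, h1, h2, h3⟩ := h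
  -- Non-negative entries with a vanishing marginal are zero, so cutting the plan down to the two
  -- supports does not change its marginals.
  have z1 : ∀ a ∈ S, a ∉ G.support → ∀ b ∈ S, c a b = 0 := fun a ha haG b hb => by
    have := h1 a ha
    rw [Finsupp.notMem_support_iff.1 haG, Finset.sum_eq_zero_iff_of_nonneg fun b _ => h0 a b] at this
    exact this b hb
  have z2 : ∀ b ∈ S, b ∉ H.support → ∀ a ∈ S, c a b = 0 := fun b hb hbH a ha => by
    have := h2 b hb
    rw [Finsupp.notMem_support_iff.1 hbH, Finset.sum_eq_zero_iff_of_nonneg fun a _ => h0 a b] at this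
    exact this a ha
  refine wasserstein_pow_le hl (c := c) ⟨h0, fun a ha => ?_, fun b hb => ?_⟩ (le_trans ?_ h3)
  · rw [← h1 a (hGS ha)]
    exact Finset.sum_subset hHS fun b hb hbH => z2 b hb hbH a (hGS ha)
  · rw [← h2 b (hHS hb)]
    exact Finset.sum_subset hGS fun a ha haG => z1 a ha haG b (hHS hb)
  · have hnn : ∀ a b, 0 ≤ c a b * ‖a - b‖ ^ l := fun a b => mul_nonneg (h0 a b) (by positivity)
    calc _ ≤ ∑ a ∈ G.support, ∑ b ∈ S, c a b * ‖a - b‖ ^ l :=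
          Finset.sum_le_sum fun a _ =>
            Finset.sum_le_sum_of_subset_of_nonneg hHS fun b _ _ => hnn a b
      _ ≤ _ := Finset.sum_le_sum_of_subset_of_nonneg hGS fun a _ _ =>
            Finset.sum_nonneg fun b _ => hnn a b

end wass


/-! ### Bounded measurable kernels -/

section kernelFacts

variable {X : Type*} {ker : X → X → ℝ} {H : Type*} [NormedAddCommGroup H] [InnerProductSpace ℝ H]
  [RKHS ℝ H X ℝ]

theorem inner_kerFun_one [CompleteSpace H] (x : X) (h : H) :
    inner ℝ (RKHS.kerFun H x 1) h = h x := by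
  rw [RKHS.kerFun_inner]
  simp

theorem kerFun_one_apply [CompleteSpace H] (hH : HasKernel H ker) (x y : X) :
    (RKHS.kerFun H y (1 : ℝ) : H) x = ker x y := by
  rw [RKHS.kerFun_apply, hH]

theorem ker_symm [CompleteSpace H] (hH : HasKernel H ker) (x y : X) : ker x y = ker y x := by
  rw [← kerFun_one_apply hH, ← kerFun_one_apply hH, ← inner_kerFun_one, ← inner_kerFun_one,
    real_inner_comm]

theorem norm_kerFun_one [CompleteSpace H] (hH : HasKernel H ker) (x : X) :
    ‖(RKHS.kerFun H x (1 : ℝ) : H)‖ = √(ker x x) := by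
  rw [norm_eq_sqrt_real_inner, inner_kerFun_one, kerFun_one_apply hH]

theorem kerNorm_nonneg (ker : X → X → ℝ) : 0 ≤ kerNorm ker :=
  Real.iSup_nonneg fun _ => Real.sqrt_nonneg _

theorem norm_kerFun_one_le [MeasurableSpace X] [CompleteSpace H] (hk : GoodKernel ker)
    (hH : HasKernel H ker) (x : X) : ‖(RKHS.kerFun H x (1 : ℝ) : H)‖ ≤ kerNorm ker := by
  rw [norm_kerFun_one hH]
  exact le_ciSup hk.bounded x

variable [MeasurableSpace X]

theorem mmd_nonneg (P Q : Measure X) : 0 ≤ mmd H P Q :=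
  Real.iSup_nonneg fun _ => abs_nonneg _

variable [CompleteSpace H]

theorem abs_apply_le (hk : GoodKernel ker) (hH : HasKernel H ker) (h : H) (x : X) :
    |h x| ≤ kerNorm ker * ‖h‖ := by
  rw [← inner_kerFun_one]
  refine (abs_real_inner_le_norm _ _).trans ?_
  gcongr
  exact norm_kerFun_one_le hk hH x

/-- The kernel sections are measurable and span a dense subspace, and norm convergence implies
pointwise convergence. A sequence suffices for each h, even if the space is not separable. -/
theorem measurable_rkhs (hk : GoodKernel ker) (hH : HasKernel H ker) (h : H) :
    Measurable fun x => h x := by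
  have hmem : h ∈ closure (Submodule.span ℝ {RKHS.kerFun H x v | (x : X) (v : ℝ)} : Set H) := by
    rw [← Submodule.topologicalClosure_coe, RKHS.kerFun_dense]
    trivial
  obtain ⟨u, hu, hlim⟩ := mem_closure_iff_seq_limit.1 hmem
  have hspan : ∀ g ∈ Submodule.span ℝ {RKHS.kerFun H x v | (x : X) (v : ℝ)},
      Measurable fun x => (g : H) x := by
    intro g hg
    induction hg using Submodule.span_induction with
    | mem g hg =>
      obtain ⟨x, v, rfl⟩ := hg
      have h1 : (RKHS.kerFun H x v : H) = v • RKHS.kerFun H x (1 : ℝ) := by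
        rw [← map_smul, smul_eq_mul, mul_one]
      simp only [h1, RKHS.coe_smul, Pi.smul_apply, kerFun_one_apply hH]
      exact (hk.measurable x).const_smul v
    | zero => simp
    | add g g' _ _ h1 h2 =>
      simp only [RKHS.coe_add]
      exact h1.add h2
    | smul c g _ h1 =>
      simp only [RKHS.coe_smul]
      exact h1.const_smul c
  refine measurable_of_tendsto_metrizable (fun n => hspan _ (hu n)) ?_
  rw [tendsto_pi_nhds]
  exact fun x => ((RKHS.continuous_eval (𝕜 := ℝ) (H := H) x).tendsto h).comp hlim

theorem integrable_rkhs (hk : GoodKernel ker) (hH : HasKernel H ker) (h : H) (P : Measure X)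
    [IsFiniteMeasure P] : Integrable (fun x => h x) P :=
  Integrable.of_bound (measurable_rkhs hk hH h).aestronglyMeasurable (kerNorm ker * ‖h‖)
    (Filter.Eventually.of_forall fun x => abs_apply_le hk hH h x)

theorem abs_integral_rkhs_le (hk : GoodKernel ker) (hH : HasKernel H ker) (h : H) (P : Measure X)
    [IsProbabilityMeasure P] : |∫ x, h x ∂P| ≤ kerNorm ker * ‖h‖ := by
  have := norm_integral_le_of_norm_le_const (μ := P) (f := fun x => h x)
    (C := kerNorm ker * ‖h‖) (Filter.Eventually.of_forall fun x => abs_apply_le hk hH h x)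
  simpa using this

theorem bddAbove_mmd (hk : GoodKernel ker) (hH : HasKernel H ker) (P Q : Measure X)
    [IsProbabilityMeasure P] [IsProbabilityMeasure Q] :
    BddAbove (Set.range fun h : {h : H // ‖h‖ ≤ 1} => |∫ x, h.1 x ∂P - ∫ x, h.1 x ∂Q|) := by
  refine ⟨kerNorm ker + kerNorm ker, ?_⟩
  rintro _ ⟨⟨h, hh⟩, rfl⟩
  have hK := kerNorm_nonneg ker
  have hle : kerNorm ker * ‖h‖ ≤ kerNorm ker := mul_le_of_le_one_right hK hh
  exact (abs_sub _ _).trans (add_le_add ((abs_integral_rkhs_le hk hH h P).trans hle)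
    ((abs_integral_rkhs_le hk hH h Q).trans hle))

theorem abs_integral_sub_le_mmd (hk : GoodKernel ker) (hH : HasKernel H ker) (P Q : Measure X)
    [IsProbabilityMeasure P] [IsProbabilityMeasure Q] (h : H) :
    |∫ x, h x ∂P - ∫ x, h x ∂Q| ≤ ‖h‖ * mmd H P Q := by
  rcases eq_or_ne h 0 with rfl | hh
  · simp
  · have hpos : 0 < ‖h‖ := norm_pos_iff.2 hh
    have h1 := le_ciSup (bddAbove_mmd hk hH P Q)
      ⟨‖h‖⁻¹ • h, by rw [norm_smul, norm_inv, norm_norm, inv_mul_cancel₀ hpos.ne']⟩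
    simp only [RKHS.coe_smul, Pi.smul_apply, smul_eq_mul, integral_const_mul] at h1
    rw [← mul_sub, abs_mul, abs_of_pos (inv_pos.2 hpos), inv_mul_le_iff₀ hpos] at h1
    exact h1

/-- The Jordan parts of the signed measure with density f have the densities f⁺ and f⁻, and the two
integrals recombine into one. -/
theorem meanEmbedding_withDensity (hk : GoodKernel ker) (hH : HasKernel H ker) (lam : Measure X)
    {f : X → ℝ} (hf : Measurable f) (hfi : Integrable f lam) (x : X) :
    meanEmbedding ker (lam.withDensityᵥ f) x = ∫ y, ker x y * f y ∂lam := by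
  have hj := SignedMeasure.toJordanDecomposition_eq_of_eq_add_withDensity (s := lam.withDensityᵥ f)
    (t := 0) hf hfi VectorMeasure.MutuallySingular.zero_left (by rw [zero_add])
  have hm : Measurable fun y => ker x y := by
    simpa only [ker_symm hH x] using hk.measurable x
  have hb : ∀ y, ‖ker x y‖ ≤ kerNorm ker * kerNorm ker := fun y => by
    rw [← kerFun_one_apply hH x y, Real.norm_eq_abs]
    refine (abs_apply_le hk hH _ x).trans ?_
    gcongr
    · exact kerNorm_nonneg _
    · exact norm_kerFun_one_le hk hH y
  have hint : ∀ g : X → ℝ, Integrable g lam → Integrable (fun y => g y * ker x y) lam :=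
    fun g hg => hg.mul_bdd hm.aestronglyMeasurable (Filter.Eventually.of_forall hb)
  unfold meanEmbedding
  rw [hj]
  simp only [SignedMeasure.toJordanDecomposition_zero, JordanDecomposition.zero_posPart,
    JordanDecomposition.zero_negPart, zero_add]
  rw [integral_withDensity_eq_integral_toReal_smul (by fun_prop) (by simp),
    integral_withDensity_eq_integral_toReal_smul (by fun_prop) (by simp)]
  simp only [smul_eq_mul, ENNReal.toReal_ofReal']
  rw [← integral_sub (hint _ hfi.pos_part) (hint (fun y => max (-f y) 0) hfi.neg.pos_part)]
  refine integral_congr_ae (Filter.Eventually.of_forall fun y => ?_)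
  simp only
  rw [← sub_mul, mul_comm]
  congr 1
  rcases le_total 0 (f y) with h | h
  · simp [h]
  · simp [h]

/-- An integrable function all of whose kernel integrals vanish is zero. -/
theorem ae_eq_zero_of_forall_integral (hk : GoodKernel ker) (hH : HasKernel H ker)
    (lam : Measure X) {f : X → ℝ} (hfi : Integrable f lam)
    (h : ∀ x, ∫ y, ker x y * f y ∂lam = 0) : f =ᵐ[lam] 0 := by
  -- A measurable representative is needed, because the Jordan parts are described through
  -- measurable densities.
  have hae : f =ᵐ[lam] hfi.1.mk f := hfi.1.ae_eq_mk
  have hgm : Measurable (hfi.1.mk f) := hfi.1.stronglyMeasurable_mk.measurable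
  have hgi : Integrable (hfi.1.mk f) lam := hfi.congr hae
  refine hae.trans ?_
  have h0 : meanEmbedding ker (lam.withDensityᵥ (hfi.1.mk f))
      = meanEmbedding ker (lam.withDensityᵥ (0 : X → ℝ)) := by
    funext x
    rw [meanEmbedding_withDensity hk hH lam hgm hgi,
      meanEmbedding_withDensity hk hH lam measurable_zero (integrable_zero _ _ _)]
    simp only [Pi.zero_apply, mul_zero, integral_zero]
    rw [← h x]
    refine integral_congr_ae ?_
    filter_upwards [hae] with y hy
    rw [hy]
  exact hgi.ae_eq_of_withDensityᵥ_eq (integrable_zero _ _ _) (hk.injective h0)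

end kernelFacts

/-! ### Mixtures -/

section mixtures

variable {X : Type*} [MeasurableSpace X] {q : ℕ} {lam : Measure X} {p : X → Par q → ℝ}
  {Θ : Set (Par q)} {k : ℕ}

theorem integral_component (hp : IsDensityFamily lam p Θ) {θ : Par q} (hθ : θ ∈ Θ) (h : X → ℝ) :
    ∫ x, h x ∂component lam p θ = ∫ x, h x * p x θ ∂lam := by
  obtain ⟨hm, h0, _⟩ := hp θ hθ
  unfold component
  rw [integral_withDensity_eq_integral_toReal_smul hm.ennreal_ofReal (by simp)]
  refine integral_congr_ae ?_
  filter_upwards [h0] with x hx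
  rw [ENNReal.toReal_ofReal hx, smul_eq_mul, mul_comm]

theorem integrable_density (hp : IsDensityFamily lam p Θ) {θ : Par q} (hθ : θ ∈ Θ) :
    Integrable (fun x => p x θ) lam := by
  obtain ⟨hm, h0, hP⟩ := hp θ hθ
  refine ⟨hm.aestronglyMeasurable, ?_⟩
  rw [hasFiniteIntegral_iff_ofReal h0]
  have := hP.measure_univ
  unfold component at this
  rw [withDensity_apply _ MeasurableSet.univ, Measure.restrict_univ] at this
  rw [this]
  exact ENNReal.one_lt_top

theorem isProbabilityMeasure_mixture (hp : IsDensityFamily lam p Θ) {G : Par q →₀ ℝ}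
    (hG : G ∈ mixAtMost Θ k) : IsProbabilityMeasure (mixture lam p G) := by
  refine ⟨?_⟩
  unfold mixture
  rw [Measure.finsetSum_apply]
  have h1 : ∀ θ ∈ G.support, (ENNReal.ofReal (G θ) • component lam p θ) Set.univ
      = ENNReal.ofReal (G θ) := fun θ hθ => by
    have := (hp θ (hG.1 θ hθ)).2.2.measure_univ
    simp [this]
  rw [Finset.sum_congr rfl h1, ← ENNReal.ofReal_sum_of_nonneg fun θ _ => hG.2.1 θ, hG.2.2.1,
    ENNReal.ofReal_one]

theorem integral_mixture (hp : IsDensityFamily lam p Θ) {G : Par q →₀ ℝ}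
    (hG : G ∈ mixAtMost Θ k) {h : X → ℝ} (hm : Measurable h) {K : ℝ} (hK : ∀ x, |h x| ≤ K) :
    ∫ x, h x ∂mixture lam p G = mixInt G fun θ => ∫ x, h x * p x θ ∂lam := by
  unfold mixture mixInt
  rw [integral_finsetSum_measure]
  · refine Finset.sum_congr rfl fun θ hθ => ?_
    rw [integral_smul_measure, ENNReal.toReal_ofReal (hG.2.1 θ), smul_eq_mul,
      integral_component hp (hG.1 θ hθ)]
  · intro θ hθ
    have := (hp θ (hG.1 θ hθ)).2.2
    exact (Integrable.of_bound hm.aestronglyMeasurable K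
      (Filter.Eventually.of_forall hK)).smul_measure ENNReal.ofReal_ne_top

/-- Passes from densities, to which the kernel argument applies, to measures, in terms of which
identifiability is stated. -/
theorem mixture_eq_of_density (hp : IsDensityFamily lam p Θ) {G G' : Par q →₀ ℝ}
    (hG : G ∈ mixAtMost Θ k) (hG' : G' ∈ mixAtMost Θ k)
    (h : (fun x => mixInt G (p x) - mixInt G' (p x)) =ᵐ[lam] 0) :
    mixture lam p G = mixture lam p G' := by
  have := isProbabilityMeasure_mixture hp hG
  have := isProbabilityMeasure_mixture hp hG'
  ext A hA
  have key : ∀ G ∈ mixAtMost Θ k, ((mixture lam p G) A).toReal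
      = ∫ x in A, mixInt G (p x) ∂lam := by
    intro G hG
    have h1 := integral_mixture hp hG (h := A.indicator 1) (measurable_one.indicator hA) (K := 1)
      (fun x => by by_cases hx : x ∈ A <;> simp [hx])
    rw [integral_indicator_one hA] at h1
    rw [← measureReal_def, h1]
    unfold mixInt
    rw [integral_finsetSum _ fun θ hθ =>
      ((integrable_density hp (hG.1 θ hθ)).const_mul _).integrableOn]
    refine Finset.sum_congr rfl fun θ _ => ?_
    rw [integral_const_mul, ← integral_indicator hA]
    congr 1
    refine integral_congr_ae (Filter.Eventually.of_forall fun x => ?_)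
    by_cases hx : x ∈ A <;> simp [hx]
  rw [← ENNReal.toReal_eq_toReal_iff' (measure_ne_top _ _) (measure_ne_top _ _), key G hG,
    key G' hG']
  refine integral_congr_ae (ae_restrict_of_ae ?_)
  filter_upwards [h] with x hx
  exact sub_eq_zero.1 hx

theorem integrable_mixInt_density (hp : IsDensityFamily lam p Θ) {G : Par q →₀ ℝ}
    (hG : G ∈ mixAtMost Θ k) : Integrable (fun x => mixInt G (p x)) lam := by
  unfold mixInt
  exact integrable_finsetSum _ fun θ hθ => (integrable_density hp (hG.1 θ hθ)).const_mul _

theorem mixInt_integral (hp : IsDensityFamily lam p Θ) {G : Par q →₀ ℝ}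
    (hG : G ∈ mixAtMost Θ k) {h : X → ℝ} (hm : Measurable h) {K : ℝ} (hK : ∀ x, |h x| ≤ K) :
    mixInt G (fun θ => ∫ x, h x * p x θ ∂lam) = ∫ x, h x * mixInt G (p x) ∂lam := by
  unfold mixInt
  simp only [Finset.mul_sum]
  rw [integral_finsetSum]
  · refine Finset.sum_congr rfl fun θ _ => ?_
    rw [← integral_const_mul]
    congr 1
    funext x
    ring
  · intro θ hθ
    exact ((integrable_density hp (hG.1 θ hθ)).const_mul _).bdd_mul hm.aestronglyMeasurable
      (Filter.Eventually.of_forall hK)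

end mixtures

/-! ### Mixtures seen through a kernel -/

section kernelMixtures

variable {X : Type*} [MeasurableSpace X] {q : ℕ} {lam : Measure X} {p : X → Par q → ℝ}
  {Θ : Set (Par q)} {k : ℕ} {ker : X → X → ℝ} {H : Type*} [NormedAddCommGroup H]
  [InnerProductSpace ℝ H] [RKHS ℝ H X ℝ] [CompleteSpace H]

/-- The function `θ ↦ ∫ h dP_θ`. -/
noncomputable def testFun (lam : Measure X) (p : X → Par q → ℝ) (h : H) (θ : Par q) : ℝ :=
  ∫ x, h x * p x θ ∂lam

theorem integral_mixture_rkhs (hk : GoodKernel ker) (hH : HasKernel H ker)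
    (hp : IsDensityFamily lam p Θ) {G : Par q →₀ ℝ} (hG : G ∈ mixAtMost Θ k) (h : H) :
    ∫ x, h x ∂mixture lam p G = mixInt G (testFun lam p h) :=
  integral_mixture hp hG (measurable_rkhs hk hH h) (abs_apply_le hk hH h)

theorem abs_mixInt_sub_le_mmd (hk : GoodKernel ker) (hH : HasKernel H ker)
    (hp : IsDensityFamily lam p Θ) {G G' : Par q →₀ ℝ} (hG : G ∈ mixAtMost Θ k)
    (hG' : G' ∈ mixAtMost Θ k) (h : H) :
    |mixInt G (testFun lam p h) - mixInt G' (testFun lam p h)|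
      ≤ ‖h‖ * mmd H (mixture lam p G) (mixture lam p G') := by
  have := isProbabilityMeasure_mixture hp hG
  have := isProbabilityMeasure_mixture hp hG'
  rw [← integral_mixture_rkhs hk hH hp hG, ← integral_mixture_rkhs hk hH hp hG']
  exact abs_integral_sub_le_mmd hk hH _ _ h

/-- A function which is not a.e. zero is detected by some element of the reproducing kernel Hilbert
space. -/
theorem exists_integral_ne_zero (hk : GoodKernel ker) (hH : HasKernel H ker) {f : X → ℝ}
    (hfi : Integrable f lam) (hf : ¬ f =ᵐ[lam] 0) : ∃ h : H, ∫ x, h x * f x ∂lam ≠ 0 := by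
  by_contra hcon
  push Not at hcon
  refine hf (ae_eq_zero_of_forall_integral hk hH lam hfi fun x => ?_)
  rw [← hcon (RKHS.kerFun H x (1 : ℝ))]
  congr 1
  funext y
  rw [kerFun_one_apply hH, ker_symm hH]

/-- By identifiability the difference of the two mixture densities is not a.e. zero, and by
injectivity of the mean embedding some element of the RKHS detects it. -/
theorem exists_mixInt_ne (hk : GoodKernel ker) (hH : HasKernel H ker)
    (hp : IsDensityFamily lam p Θ) (hid : Identifiable lam p Θ k) {G G' : Par q →₀ ℝ}
    (hG : G ∈ mixAtMost Θ k) (hG' : G' ∈ mixAtMost Θ k) (hne : G ≠ G') :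
    ∃ h : H, mixInt G (testFun lam p h) ≠ mixInt G' (testFun lam p h) := by
  have h1 : ¬ (fun x => mixInt G (p x) - mixInt G' (p x)) =ᵐ[lam] 0 := fun h0 =>
    hne (hid hG hG' (mixture_eq_of_density hp hG hG' h0))
  have hsub : Integrable (fun x => mixInt G (p x) - mixInt G' (p x)) lam :=
    (integrable_mixInt_density hp hG).sub (integrable_mixInt_density hp hG')
  obtain ⟨h, hh⟩ := exists_integral_ne_zero (H := H) hk hH hsub h1
  refine ⟨h, fun heq => hh ?_⟩
  have hm := measurable_rkhs hk hH h
  have hb := abs_apply_le hk hH h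
  have hint : ∀ G ∈ mixAtMost Θ k, Integrable (fun x => h x * mixInt G (p x)) lam := fun G hG =>
    (integrable_mixInt_density hp hG).bdd_mul hm.aestronglyMeasurable
      (Filter.Eventually.of_forall hb)
  simp only [mul_sub]
  rw [integral_sub (hint G hG) (hint G' hG'), ← mixInt_integral hp hG hm hb,
    ← mixInt_integral hp hG' hm hb]
  exact sub_eq_zero.2 heq

/-- The discrepancy between mixtures depends on the kernel only through the test functions. -/
theorem mmd_mixture_le_of_testClass {ker' : X → X → ℝ} {H' : Type*} [NormedAddCommGroup H']
    [InnerProductSpace ℝ H'] [RKHS ℝ H' X ℝ] [CompleteSpace H']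
    (hk : GoodKernel ker) (hH : HasKernel H ker) (hk' : GoodKernel ker') (hH' : HasKernel H' ker')
    (hp : IsDensityFamily lam p Θ) (heq : testClass H lam p Θ = testClass H' lam p Θ)
    {G G' : Par q →₀ ℝ} (hG : G ∈ mixAtMost Θ k) (hG' : G' ∈ mixAtMost Θ k) :
    mmd H (mixture lam p G) (mixture lam p G') ≤ mmd H' (mixture lam p G) (mixture lam p G') := by
  have : Nonempty {h : H // ‖h‖ ≤ 1} := ⟨⟨0, by simp⟩⟩
  refine ciSup_le fun ⟨h, hh⟩ => ?_
  rw [integral_mixture_rkhs hk hH hp hG, integral_mixture_rkhs hk hH hp hG']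
  obtain ⟨h', hh', hφ⟩ : (fun θ : Θ => ∫ x, h x ∂component lam p θ) ∈ testClass H' lam p Θ :=
    heq ▸ ⟨h, hh, rfl⟩
  have h1 : ∀ θ ∈ Θ, testFun lam p h θ = testFun lam p h' θ := fun θ hθ => by
    have := congrFun hφ ⟨θ, hθ⟩
    simp only at this
    rwa [integral_component hp hθ, integral_component hp hθ] at this
  have h2 : ∀ G ∈ mixAtMost Θ k, mixInt G (testFun lam p h) = mixInt G (testFun lam p h') :=
    fun G hG => Finset.sum_congr rfl fun θ hθ => by rw [h1 θ (hG.1 θ hθ)]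
  rw [h2 G hG, h2 G' hG']
  refine (abs_mixInt_sub_le_mmd hk' hH' hp hG hG' h').trans ?_
  exact mul_le_of_le_one_left (mmd_nonneg _ _) hh'

end kernelMixtures


/-! ### Local domination of the derivatives of the densities -/

section domination

variable {X : Type*} [MeasurableSpace X] {q : ℕ} {lam : Measure X} {p : X → Par q → ℝ}
  {Θ : Set (Par q)} {m : ℕ}

/-- A derivative of positive order is a limit of difference quotients of a derivative of one order
less, and these are dominated by assumption. The exceptional null set depends on the increment, so
the limit is taken along a fixed sequence of increments. -/
theorem exists_dominating_at (hp : IsDensityFamily lam p Θ) (hA : AssumptionA2 lam p Θ m)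
    {z : Par q} (hz : z ∈ Θ) {γ : Fin q → ℕ} (hγ : ∑ i, γ i ≤ m) :
    ∃ ψ : X → ℝ, Integrable ψ lam ∧ ∀ᵐ x ∂lam, |multiD γ (p x) z| ≤ ψ x := by
  obtain ⟨⟨U, hU, hΘU, -, hsm⟩, hA1, -⟩ := hA
  by_cases h0 : γ = 0
  · subst h0
    exact ⟨fun x => |p x z|, (integrable_density hp hz).abs,
      Filter.Eventually.of_forall fun x => by simp⟩
  · obtain ⟨i, hi⟩ := Function.ne_iff.1 h0
    have hγ1 : γ = (γ - Pi.single i 1) + Pi.single i 1 := by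
      funext j
      by_cases hj : j = i
      · subst hj
        simp only [Pi.zero_apply, ne_eq] at hi
        simp
        omega
      · simp [hj]
    set β : Fin q → ℕ := γ - Pi.single i 1 with hβ
    have hβm : ∑ j, β j + 1 ≤ m := by
      rw [← sum_add_single β i, ← hγ1]
      exact hγ
    obtain ⟨δ, hδ, ψ, hψ, hb⟩ := hA1 β (by omega) i z hz
    refine ⟨ψ, hψ, ?_⟩
    have ht0 : Filter.Tendsto (fun n : ℕ => δ / ((n : ℝ) + 2)) Filter.atTop (nhds 0) :=
      tendsto_const_nhds.div_atTop (tendsto_natCast_atTop_atTop.atTop_add tendsto_const_nhds)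
    have hpos : ∀ n : ℕ, 0 < δ / ((n : ℝ) + 2) := fun n => by positivity
    have hlt : ∀ n : ℕ, δ / ((n : ℝ) + 2) < δ := fun n => by
      rw [div_lt_iff₀ (by positivity)]
      have : (0 : ℝ) ≤ n := Nat.cast_nonneg n
      nlinarith
    have hall : ∀ᵐ x ∂lam, ∀ n : ℕ, |(multiD β (p x) (z + (δ / ((n : ℝ) + 2)) •
        EuclideanSpace.single i 1) - multiD β (p x) z) / (δ / ((n : ℝ) + 2))| ≤ ψ x :=
      ae_all_iff.2 fun n => hb _ (abs_pos.2 (hpos n).ne') (by rw [abs_of_pos (hpos n)]; exact hlt n)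
    filter_upwards [hsm, hall] with x hx hxn
    have hzU := hΘU hz
    have hc : ContDiffOn ℝ ((0 + 1 : ℕ) : WithTop ℕ∞) (multiD β (p x)) U :=
      contDiffOn_multiD hU β _ (hx.of_le (by norm_cast; omega))
    have hD : multiD γ (p x) z = partialD i (multiD β (p x)) z := by
      conv_lhs => rw [hγ1]
      exact multiD_add_single hU β i (hx.of_le (by norm_cast)) hzU
    have hld := (differentiableAt_of_contDiffOn hU hc hzU).lineDifferentiableAt
      (v := EuclideanSpace.single i (1 : ℝ))
    have hlim := hld.hasLineDerivAt.tendsto_slope_zero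
    have hlim' := hlim.comp (tendsto_nhdsWithin_iff.2
      ⟨ht0, Filter.Eventually.of_forall fun n => (hpos n).ne'⟩)
    rw [hD]
    refine le_of_tendsto' hlim'.abs fun n => ?_
    have := hxn n
    simpa only [Function.comp_apply, smul_eq_mul, div_eq_inv_mul] using this

/-- The assumption has a null set for each increment; here one null set must serve a whole ball. The
bound is first obtained on a countable dense set and then extended by continuity of the derivative.
-/
theorem exists_dominating_increment (hA : AssumptionA2 lam p Θ m)
    {z : Par q} (hz : z ∈ Θ) {γ : Fin q → ℕ} (hγ : ∑ i, γ i = m) :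
    ∃ ρ : ℝ, 0 < ρ ∧ ∃ ψ : X → ℝ, Integrable ψ lam ∧
      ∀ᵐ x ∂lam, ∀ θ ∈ Metric.ball z ρ, |multiD γ (p x) θ - multiD γ (p x) z| ≤ ψ x := by
  obtain ⟨⟨U, hU, hΘU, -, hsm⟩, -, hA2⟩ := hA
  obtain ⟨δ, hδ, ψ, hψ, hb⟩ := hA2 γ hγ z hz
  obtain ⟨ρ', hρ', hball⟩ := Metric.isOpen_iff.1 hU z (hΘU hz)
  -- The absolute value covers the point z itself: the assumption only concerns nonzero increments,
  -- and ψ might be negative somewhere.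
  refine ⟨min δ ρ', lt_min hδ hρ', fun x => |ψ x|, hψ.abs, ?_⟩
  set d := TopologicalSpace.denseSeq (Par q)
  have hall : ∀ᵐ x ∂lam, ∀ n : ℕ, 0 < ‖d n - z‖ → ‖d n - z‖ < δ →
      |multiD γ (p x) (z + (d n - z)) - multiD γ (p x) z| ≤ ψ x := by
    rw [ae_all_iff]
    intro n
    by_cases h : 0 < ‖d n - z‖ ∧ ‖d n - z‖ < δ
    · filter_upwards [hb _ h.1 h.2] with x hx _ _
      exact hx
    · exact Filter.Eventually.of_forall fun x h1 h2 => absurd ⟨h1, h2⟩ h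
  filter_upwards [hsm, hall] with x hx hxn θ hθ
  have hθU : θ ∈ U := hball (Metric.ball_subset_ball (min_le_right _ _) hθ)
  have hc : ContinuousOn (multiD γ (p x)) U :=
    (contDiffOn_multiD hU γ 0 (hx.of_le (by norm_cast; omega))).continuousOn
  have hmem := (TopologicalSpace.denseRange_denseSeq (Par q)).open_subset_closure_inter
    (Metric.isOpen_ball (x := z) (ε := min δ ρ')) hθ
  obtain ⟨u, hu, hlim⟩ := mem_closure_iff_seq_limit.1 hmem
  have h1 := ((hc.continuousAt (hU.mem_nhds hθU)).tendsto.comp hlim).sub_const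
    (multiD γ (p x) z)
  refine le_of_tendsto' h1.abs fun n => ?_
  obtain ⟨j, hj⟩ := (hu n).2
  have hdist := (hu n).1
  rw [Metric.mem_ball, dist_eq_norm] at hdist
  simp only [Function.comp_apply]
  by_cases h0 : u n = z
  · rw [h0, sub_self, abs_zero]
    exact abs_nonneg _
  · have h2 := hxn j
    have hj' : d j = u n := hj
    rw [hj', add_sub_cancel] at h2
    exact (h2 (norm_pos_iff.2 (sub_ne_zero.2 h0)) (hdist.trans_le (min_le_left _ _))).trans
      (le_abs_self _)

/-- Under assumption `A2(m)` all derivatives up to order `m` are dominated near each point of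
`Θ`. -/
theorem exists_local_domination (hp : IsDensityFamily lam p Θ) (hA : AssumptionA2 lam p Θ m)
    {z : Par q} (hz : z ∈ Θ) :
    ∃ ρ : ℝ, 0 < ρ ∧ ρ ≤ 1 ∧ ∃ Ψ : X → ℝ, Integrable Ψ lam ∧
      ∀ᵐ x ∂lam, ContDiffOn ℝ (m : WithTop ℕ∞) (p x) (Metric.ball z ρ) ∧
        ∀ γ ∈ multiIdx q m, ∀ θ ∈ Metric.ball z ρ, |multiD γ (p x) θ| ≤ Ψ x := by
  obtain ⟨U, hU, hΘU, -, hsm⟩ := hA.1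
  obtain ⟨ρ', hρ', hball⟩ := Metric.isOpen_iff.1 hU z (hΘU hz)
  have hat : ∀ γ : Fin q → ℕ, ∃ ψ : X → ℝ, Integrable ψ lam ∧
      (∑ i, γ i ≤ m → ∀ᵐ x ∂lam, |multiD γ (p x) z| ≤ ψ x) := by
    intro γ
    by_cases h : ∑ i, γ i ≤ m
    · obtain ⟨ψ, h1, h2⟩ := exists_dominating_at hp hA hz h
      exact ⟨ψ, h1, fun _ => h2⟩
    · exact ⟨0, integrable_zero _ _ _, fun h' => absurd h' h⟩
  have hinc : ∀ γ : Fin q → ℕ, ∃ ρ : ℝ, 0 < ρ ∧ ∃ ψ : X → ℝ, Integrable ψ lam ∧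
      (∑ i, γ i = m → ∀ᵐ x ∂lam, ∀ θ ∈ Metric.ball z ρ,
        |multiD γ (p x) θ - multiD γ (p x) z| ≤ ψ x) := by
    intro γ
    by_cases h : ∑ i, γ i = m
    · obtain ⟨ρ, h0, ψ, h1, h2⟩ := exists_dominating_increment hA hz h
      exact ⟨ρ, h0, ψ, h1, fun _ => h2⟩
    · exact ⟨1, one_pos, 0, integrable_zero _ _ _, fun h' => absurd h' h⟩
  choose A hAi hAb using hat
  choose R hR D hDi hDb using hinc
  obtain ⟨ρ, ⟨⟨hρR, hρ1⟩, hρρ'⟩, hρ⟩ : ∃ ρ : ℝ, (((∀ γ ∈ multiIdx q m, ρ ≤ R γ) ∧ ρ ≤ 1) ∧ ρ ≤ ρ')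
      ∧ 0 < ρ := by
    have h1 : ∀ c : ℝ, 0 < c → ∀ᶠ ρ in nhdsWithin (0 : ℝ) (Set.Ioi 0), ρ ≤ c := fun c hc =>
      nhdsWithin_le_nhds (Iic_mem_nhds hc)
    exact (((((Filter.eventually_all_finset _).2 fun γ _ => h1 _ (hR γ)).and (h1 1 one_pos)).and
      (h1 ρ' hρ')).and self_mem_nhdsWithin).exists
  have hsm' : ∀ᵐ x ∂lam, ContDiffOn ℝ (m : WithTop ℕ∞) (p x) (Metric.ball z ρ) := by
    filter_upwards [hsm] with x hx
    exact hx.mono ((Metric.ball_subset_ball hρρ').trans hball)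
  have hAb' : ∀ᵐ x ∂lam, ∀ γ ∈ multiIdx q m, |multiD γ (p x) z| ≤ A γ x :=
    (Filter.eventually_all_finset _).2 fun γ hγ => hAb γ (mem_multiIdx.1 hγ)
  have hDb' : ∀ᵐ x ∂lam, ∀ γ ∈ multiIdx q m, ∑ i, γ i = m → ∀ θ ∈ Metric.ball z ρ,
      |multiD γ (p x) θ - multiD γ (p x) z| ≤ D γ x := by
    refine (Filter.eventually_all_finset _).2 fun γ hγ => ?_
    by_cases h : ∑ i, γ i = m
    · filter_upwards [hDb γ h] with x hx _ θ hθ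
      exact hx θ (Metric.ball_subset_ball (hρR γ hγ) hθ)
    · exact Filter.Eventually.of_forall fun x h' => absurd h' h
  have hAsum : ∀ γ ∈ multiIdx q m, ∀ x, A γ x ≤ ∑ β ∈ multiIdx q m, |A β x| := fun γ hγ x =>
    (le_abs_self _).trans
      (Finset.single_le_sum (f := fun β => |A β x|) (fun _ _ => abs_nonneg _) hγ)
  have hAsumi : Integrable (fun x => ∑ β ∈ multiIdx q m, |A β x|) lam :=
    integrable_finsetSum _ fun β _ => (hAi β).abs
  -- Descending induction on the order m - j of the derivative. Order m is bounded by its value at z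
  -- plus its increment; a lower order by its value at z plus the mean value inequality applied to
  -- the next higher order.
  have hlev : ∀ j, j ≤ m → ∃ Ψ : X → ℝ, Integrable Ψ lam ∧ ∀ᵐ x ∂lam,
      ∀ γ : Fin q → ℕ, ∑ i, γ i = m - j → ∀ θ ∈ Metric.ball z ρ, |multiD γ (p x) θ| ≤ Ψ x := by
    intro j
    induction j with
    | zero =>
      intro _
      refine ⟨fun x => ∑ β ∈ multiIdx q m, |A β x| + ∑ β ∈ multiIdx q m, |D β x|,
        hAsumi.add (integrable_finsetSum _ fun β _ => (hDi β).abs), ?_⟩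
      filter_upwards [hAb', hDb'] with x hx hx' γ hγ θ hθ
      have hγm : γ ∈ multiIdx q m := mem_multiIdx.2 (by omega)
      have h1 := hx γ hγm
      have h2 := hx' γ hγm hγ θ hθ
      have h3 : D γ x ≤ ∑ β ∈ multiIdx q m, |D β x| := (le_abs_self _).trans
        (Finset.single_le_sum (f := fun β => |D β x|) (fun _ _ => abs_nonneg _) hγm)
      have h4 := hAsum γ hγm x
      have h5 := abs_sub_abs_le_abs_sub (multiD γ (p x) θ) (multiD γ (p x) z)
      linarith
    | succ j ih =>
      intro hj
      obtain ⟨Ψ, hΨ, hΨb⟩ := ih (by omega)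
      refine ⟨fun x => ∑ β ∈ multiIdx q m, |A β x| + q * Ψ x,
        hAsumi.add (hΨ.const_mul _), ?_⟩
      filter_upwards [hAb', hΨb, hsm'] with x hx hx' hxs γ hγ θ hθ
      have hγm : γ ∈ multiIdx q m := mem_multiIdx.2 (by omega)
      have h1 := hx γ hγm
      have h4 := hAsum γ hγm x
      have h2 := abs_multiD_sub_le hρ1 (r := m - (j + 1)) (f := p x)
        (hxs.of_le (by norm_cast; omega)) hγ (M := Ψ x)
        (fun i θ hθ => hx' _ (by rw [sum_add_single, hγ]; omega) θ hθ) hθ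
      have h5 := abs_sub_abs_le_abs_sub (multiD γ (p x) θ) (multiD γ (p x) z)
      linarith
  have hlev' : ∀ j, ∃ Ψ : X → ℝ, Integrable Ψ lam ∧ (j ≤ m → ∀ᵐ x ∂lam,
      ∀ γ : Fin q → ℕ, ∑ i, γ i = m - j → ∀ θ ∈ Metric.ball z ρ, |multiD γ (p x) θ| ≤ Ψ x) := by
    intro j
    by_cases h : j ≤ m
    · obtain ⟨Ψ, h1, h2⟩ := hlev j h
      exact ⟨Ψ, h1, fun _ => h2⟩
    · exact ⟨0, integrable_zero _ _ _, fun h' => absurd h' h⟩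
  choose Ψ hΨi hΨb using hlev'
  refine ⟨ρ, hρ, hρ1, fun x => ∑ j ∈ Finset.range (m + 1), |Ψ j x|,
    integrable_finsetSum _ fun j _ => (hΨi j).abs, ?_⟩
  have hΨb' : ∀ᵐ x ∂lam, ∀ j ∈ Finset.range (m + 1), ∀ γ : Fin q → ℕ, ∑ i, γ i = m - j →
      ∀ θ ∈ Metric.ball z ρ, |multiD γ (p x) θ| ≤ Ψ j x :=
    (Filter.eventually_all_finset _).2 fun j hj => hΨb j (by
      rw [Finset.mem_range] at hj
      omega)
  filter_upwards [hsm', hΨb'] with x hx hx'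
  refine ⟨hx, fun γ hγ θ hθ => ?_⟩
  rw [mem_multiIdx] at hγ
  have hj : m - ∑ i, γ i ∈ Finset.range (m + 1) := Finset.mem_range.2 (by omega)
  exact (hx' _ hj γ (by omega) θ hθ).trans ((le_abs_self _).trans
    (Finset.single_le_sum (f := fun j => |Ψ j x|) (fun _ _ => abs_nonneg _) hj))

/-- Continuity of `θ ↦ ∫ h dP_θ` on `Θ` for bounded `h`. -/
theorem continuousOn_integral_density (hp : IsDensityFamily lam p Θ)
    (hA : AssumptionA2 lam p Θ m) {h : X → ℝ} (hm : Measurable h) {K : ℝ} (hK : ∀ x, |h x| ≤ K) :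
    ContinuousOn (fun θ => ∫ x, h x * p x θ ∂lam) Θ := by
  intro z hz
  obtain ⟨ρ, hρ, -, Ψ, hΨ, hb⟩ := exists_local_domination hp hA hz
  refine continuousWithinAt_of_dominated (bound := fun x => K * Ψ x) ?_ ?_ (hΨ.const_mul K) ?_
  · filter_upwards [self_mem_nhdsWithin] with θ hθ
    exact hm.aestronglyMeasurable.mul (hp θ hθ).1.aestronglyMeasurable
  · filter_upwards [nhdsWithin_le_nhds (Metric.ball_mem_nhds z hρ)] with θ hθ
    filter_upwards [hb] with x hx
    have := hx.2 0 (zero_mem_multiIdx q m) θ hθ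
    rw [multiD_zero] at this
    rw [norm_mul, Real.norm_eq_abs, Real.norm_eq_abs]
    exact mul_le_mul (hK x) this (abs_nonneg _) ((abs_nonneg _).trans (hK x))
  · filter_upwards [hb] with x hx
    exact (continuousAt_const.mul (hx.1.continuousOn.continuousAt
      (Metric.ball_mem_nhds z hρ))).continuousWithinAt

end domination


/-! ### Discrete distributions as weighted point configurations -/

section configurations

variable {q k : ℕ} {Θ : Set (Par q)}

/-- The discrete measure with weights `w i` at the points `θ i`. -/
noncomputable def ofPoints (w : Fin k → ℝ) (θ : Fin k → Par q) : Par q →₀ ℝ :=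
  ∑ i, Finsupp.single (θ i) (w i)

theorem ofPoints_apply [DecidableEq (Par q)] (w : Fin k → ℝ) (θ : Fin k → Par q) (x : Par q) :
    ofPoints w θ x = ∑ i, if θ i = x then w i else 0 := by
  classical
  simp only [ofPoints, Finsupp.finsetSum_apply, Finsupp.single_apply]

theorem support_ofPoints_subset [DecidableEq (Par q)] (w : Fin k → ℝ) (θ : Fin k → Par q) :
    (ofPoints w θ).support ⊆ Finset.univ.image θ := by
  intro x hx
  rw [Finsupp.mem_support_iff, ofPoints_apply] at hx
  obtain ⟨i, -, hi⟩ := Finset.exists_ne_zero_of_sum_ne_zero hx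
  refine Finset.mem_image.2 ⟨i, Finset.mem_univ i, ?_⟩
  by_contra h
  simp [h] at hi

theorem sum_ofPoints (J : Finset (Par q)) [DecidableEq (Par q)] (w : Fin k → ℝ)
    (θ : Fin k → Par q) (F : Par q → ℝ) :
    ∑ x ∈ J, ofPoints w θ x * F x = ∑ i, if θ i ∈ J then w i * F (θ i) else 0 := by
  simp only [ofPoints_apply, Finset.sum_mul, ite_mul, zero_mul]
  rw [Finset.sum_comm]
  refine Finset.sum_congr rfl fun i _ => ?_
  rw [Finset.sum_ite_eq]

theorem mixInt_ofPoints (w : Fin k → ℝ) (θ : Fin k → Par q) (F : Par q → ℝ) :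
    mixInt (ofPoints w θ) F = ∑ i, w i * F (θ i) := by
  classical
  rw [mixInt_eq_sum (support_ofPoints_subset w θ), sum_ofPoints]
  simp

theorem mixInt_one (G : Par q →₀ ℝ) : mixInt G (fun _ => 1) = ∑ θ ∈ G.support, G θ := by
  simp [mixInt]

theorem ofPoints_mem {w : Fin k → ℝ} {θ : Fin k → Par q} (hw : ∀ i, 0 ≤ w i) (h1 : ∑ i, w i = 1)
    (hθ : ∀ i, θ i ∈ Θ) : ofPoints w θ ∈ mixAtMost Θ k := by
  classical
  have hsub := support_ofPoints_subset w θ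
  refine ⟨fun x hx => ?_, fun x => ?_, ?_, ?_⟩
  · obtain ⟨i, -, rfl⟩ := Finset.mem_image.1 (hsub hx)
    exact hθ i
  · rw [ofPoints_apply]
    exact Finset.sum_nonneg fun i _ => by split_ifs <;> simp [hw i]
  · rw [← mixInt_one, mixInt_ofPoints]
    simpa using h1
  · refine (Finset.card_le_card hsub).trans (Finset.card_image_le.trans ?_)
    simp

/-- The atoms are embedded into `Fin k`, and the unused indices get weight zero at some atom x0,
which keeps all points in Θ. A fixed number of indices makes compactness available even when atoms
merge or vanish in the limit. -/
theorem exists_ofPoints {G : Par q →₀ ℝ} (hG : G ∈ mixAtMost Θ k) :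
    ∃ (w : Fin k → ℝ) (θ : Fin k → Par q), (∀ i, 0 ≤ w i) ∧ ∑ i, w i = 1 ∧ (∀ i, θ i ∈ Θ) ∧
      G = ofPoints w θ := by
  classical
  obtain ⟨h1, h2, h3, h4⟩ := hG
  have hne : G.support.Nonempty := by
    by_contra h
    rw [Finset.not_nonempty_iff_eq_empty] at h
    rw [h] at h3
    simp at h3
  obtain ⟨x0, hx0⟩ := hne
  obtain ⟨j⟩ : Nonempty (G.support ↪ Fin k) :=
    Function.Embedding.nonempty_of_card_le (by simpa using h4)
  have hsum : ∀ {M : Type} [AddCommMonoid M] (f : Par q → ℝ → M), (∀ x, f x 0 = 0) →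
      ∑ i, f (Function.extend j (fun s : G.support => (s : Par q)) (fun _ => x0) i)
        (Function.extend j (fun s : G.support => G s) 0 i) = ∑ x ∈ G.support, f x (G x) := by
    intro M _ f hf
    rw [← Finset.sum_coe_sort G.support fun x => f x (G x)]
    symm
    refine Fintype.sum_of_injective j j.injective _ _ (fun i hi => ?_) fun s => ?_
    · rw [Function.extend_apply' _ _ _ (fun ⟨s, hs⟩ => hi ⟨s, hs⟩), Function.extend_apply' _ _ _
        (fun ⟨s, hs⟩ => hi ⟨s, hs⟩)]
      exact hf _
    · rw [j.injective.extend_apply, j.injective.extend_apply]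
  refine ⟨Function.extend j (fun s : G.support => G s) 0,
    Function.extend j (fun s : G.support => (s : Par q)) fun _ => x0, fun i => ?_, ?_, fun i => ?_,
    ?_⟩
  · by_cases hi : ∃ s, j s = i
    · obtain ⟨s, rfl⟩ := hi
      rw [j.injective.extend_apply]
      exact h2 _
    · rw [Function.extend_apply' _ _ _ hi]
      exact le_rfl
  · rw [← h3]
    exact hsum (M := ℝ) (fun _ y => y) fun _ => rfl
  · by_cases hi : ∃ s, j s = i
    · obtain ⟨s, rfl⟩ := hi
      rw [j.injective.extend_apply]
      exact h1 _ s.2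
    · rw [Function.extend_apply' _ _ _ hi]
      exact h1 _ hx0
  · unfold ofPoints
    rw [hsum (M := Par q →₀ ℝ) (fun x y => Finsupp.single x y) fun x => Finsupp.single_zero x]
    exact (Finsupp.sum_single G).symm

end configurations

/-! ### Clusters of points -/

section clusters

variable {q : ℕ} {ι : Type*} [Fintype ι]

open Classical in
/-- The indices whose limit point is `z`. -/
noncomputable def cluster (t : ι → Par q) (z : Par q) : Finset ι :=
  Finset.univ.filter fun s => t s = z

open Classical in
/-- The limit points. -/
noncomputable def centres (t : ι → Par q) : Finset (Par q) := Finset.univ.image t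

open Classical in
/-- The restriction of the weights to a cluster. -/
noncomputable def clusterWeight (t : ι → Par q) (σ : ι → ℝ) (z : Par q) (s : ι) : ℝ :=
  if t s = z then σ s else 0

/-- The sum over the clusters of the absolute moments of order less than the cluster size. -/
noncomputable def clusterMoments (t τ : ι → Par q) (σ : ι → ℝ) : ℝ :=
  ∑ z ∈ centres t, momSum z τ ((cluster t z).card - 1) (clusterWeight t σ z)

variable {t τ : ι → Par q} {σ : ι → ℝ}

theorem mem_cluster {z : Par q} {s : ι} : s ∈ cluster t z ↔ t s = z := by
  simp [cluster]

theorem mem_centres {z : Par q} : z ∈ centres t ↔ ∃ s, t s = z := by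
  simp [centres]

theorem card_cluster_pos {z : Par q} (hz : z ∈ centres t) : 0 < (cluster t z).card := by
  obtain ⟨s, hs⟩ := mem_centres.1 hz
  exact Finset.card_pos.2 ⟨s, mem_cluster.2 hs⟩

theorem clusterWeight_eq_zero {z : Par q} {s : ι} (hs : s ∉ cluster t z) :
    clusterWeight t σ z s = 0 := by
  rw [mem_cluster] at hs
  simp [clusterWeight, hs]

theorem sum_clusterWeight (s : ι) : ∑ z ∈ centres t, clusterWeight t σ z s = σ s := by
  classical
  rw [Finset.sum_eq_single (t s)]
  · simp [clusterWeight]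
  · intro z _ hz
    simp [clusterWeight, hz.symm]
  · exact fun h => absurd (mem_centres.2 ⟨s, rfl⟩) h

theorem sum_clusterWeight_mul (F : ι → ℝ) :
    ∑ z ∈ centres t, ∑ s, clusterWeight t σ z s * F s = ∑ s, σ s * F s := by
  rw [Finset.sum_comm]
  refine Finset.sum_congr rfl fun s _ => ?_
  rw [← Finset.sum_mul, sum_clusterWeight]

theorem clusterMoments_nonneg : 0 ≤ clusterMoments t τ σ :=
  Finset.sum_nonneg fun _ _ => momSum_nonneg _ _ _ _

theorem momSum_le_clusterMoments {z : Par q} (hz : z ∈ centres t) :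
    momSum z τ ((cluster t z).card - 1) (clusterWeight t σ z) ≤ clusterMoments t τ σ :=
  Finset.single_le_sum
    (f := fun z => momSum z τ ((cluster t z).card - 1) (clusterWeight t σ z))
    (fun _ _ => momSum_nonneg _ _ _ _) hz

theorem sum_card_cluster : ∑ z ∈ centres t, (cluster t z).card = Fintype.card ι := by
  classical
  unfold cluster centres
  rw [← Finset.card_eq_sum_card_image]
  rfl

/-- The Wasserstein distance is controlled by the moments of the clusters. -/
theorem exists_wasserstein_le_clusterMoments {Θ : Set (Par q)} (hΘ : IsCompact Θ) (t : ι → Par q)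
    {m : ℕ} (hm : 1 ≤ m) (hcl : ∀ z ∈ centres t, (cluster t z).card ≤ m + 1) :
    ∃ C : ℝ, 0 < C ∧ ∀ (τ : ι → Par q) (σ : ι → ℝ) (G G' : Par q →₀ ℝ),
      (∀ s, ‖τ s - t s‖ ≤ 1) → (∀ s, τ s ∈ Θ) → (∀ x, 0 ≤ G x) → (∀ x, 0 ≤ G' x) →
      (∀ x, G x ≠ 0 → ∃ s, τ s = x) → (∀ x, G' x ≠ 0 → ∃ s, τ s = x) →
      (∀ F : Par q → ℝ, mixInt G F - mixInt G' F = ∑ s, σ s * F (τ s)) → ∑ s, σ s = 0 →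
      wasserstein m G G' ^ m ≤ C * clusterMoments t τ σ := by
  classical
  obtain ⟨C, hC, hT⟩ := exists_transport (q := q) hm (Fintype.card ι)
  obtain ⟨D, hD⟩ := hΘ.isBounded.exists_norm_le
  -- A separation δ between points of Θ is at most 2D. The maximum therefore gives both C₀/δ ≥ 1 and
  -- C₀/δ ≥ 4q/δ, as the interpolation requires.
  set C₀ : ℝ := max (4 * q) (2 * D) with hC₀
  refine ⟨(C + 1) * (|C₀| + 1) ^ m, by positivity, ?_⟩
  intro τ σ G G' hτt hτΘ hG hG' hGτ hG'τ hσ hσ0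
  set A := clusterMoments t τ σ with hA
  have hA0 : 0 ≤ A := clusterMoments_nonneg
  set S : Finset (Par q) := Finset.univ.image τ with hS
  have hGS : G.support ⊆ S := fun x hx => by
    obtain ⟨s, hs⟩ := hGτ x (Finsupp.mem_support_iff.1 hx)
    exact Finset.mem_image.2 ⟨s, Finset.mem_univ s, hs⟩
  have hG'S : G'.support ⊆ S := fun x hx => by
    obtain ⟨s, hs⟩ := hG'τ x (Finsupp.mem_support_iff.1 hx)
    exact Finset.mem_image.2 ⟨s, Finset.mem_univ s, hs⟩
  have hJsum : ∀ J ⊆ S, ∑ x ∈ J, (G x - G' x) = ∑ s, if τ s ∈ J then σ s else 0 := by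
    intro J hJ
    have h1 := hσ fun x => if x ∈ J then 1 else 0
    rw [mixInt_eq_sum hGS, mixInt_eq_sum hG'S, ← Finset.sum_sub_distrib] at h1
    simp only [mul_ite, mul_one, mul_zero] at h1
    rw [← h1, ← Finset.sum_subset hJ fun x _ hx => by simp [hx]]
    exact Finset.sum_congr rfl fun x hx => by simp [hx]
  have htot : ∑ x ∈ S, G x = ∑ x ∈ S, G' x := by
    have h1 := hσ fun _ => 1
    rw [mixInt_eq_sum hGS, mixInt_eq_sum hG'S] at h1
    simp only [mul_one] at h1
    linarith
  have hbal : SmallImbalance m S (fun x => G x - G' x) ((|C₀| + 1) ^ m * A) := by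
    intro J hJ hJn hJc δ hδ hsep
    simp only
    have hJS : ∀ s, τ s ∈ S := fun s => Finset.mem_image.2 ⟨s, Finset.mem_univ s, rfl⟩
    have hδD : δ ≤ 2 * D := by
      obtain ⟨a, ha⟩ := hJn
      obtain ⟨b, hb⟩ := hJc
      obtain ⟨s, -, rfl⟩ := Finset.mem_image.1 (hJ ha)
      obtain ⟨s', -, rfl⟩ := Finset.mem_image.1 (Finset.mem_sdiff.1 hb).1
      have h1 := hsep _ ha _ hb
      have h2 := norm_sub_le (τ s) (τ s')
      linarith [hD _ (hτΘ s), hD _ (hτΘ s')]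
    have hC₀pos : 0 < C₀ := (hδ.trans_le hδD).trans_le (le_max_right _ _)
    have hK : 1 ≤ C₀ / δ := by
      rw [le_div_iff₀ hδ, one_mul]
      exact hδD.trans (le_max_right _ _)
    have hKδ : 4 * q / δ ≤ C₀ / δ := by
      gcongr
      exact le_max_left _ _
    have hsep' : ∀ s s', τ s ∈ J → ¬ τ s' ∈ J → δ ≤ ‖τ s - τ s'‖ := fun s s' hs hs' =>
      hsep _ hs _ (Finset.mem_sdiff.2 ⟨hJS s', hs'⟩)
    -- The interpolation is done in each cluster separately. A cluster has at most m + 1 points, so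
    -- its power of C₀/δ is at most the m-th, which the factor δ^m of the imbalance cancels.
    have hz : ∀ z ∈ centres t, |∑ s, if τ s ∈ J then clusterWeight t σ z s else 0|
        ≤ (C₀ / δ) ^ m * momSum z τ ((cluster t z).card - 1) (clusterWeight t σ z) := by
      intro z hz
      have hpos := card_cluster_pos hz
      refine (abs_sum_separated_le z τ (fun s => τ s ∈ J) hδ hK hKδ hsep'
        (d := (cluster t z).card - 1) (I := cluster t z) (by omega) (fun s hs => ?_)
        (fun s hs => clusterWeight_eq_zero hs)).trans ?_
      · rw [← mem_cluster.1 hs]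
        exact hτt s
      · refine mul_le_mul_of_nonneg_right (pow_le_pow_right₀ hK ?_) (momSum_nonneg _ _ _ _)
        have := hcl z hz
        omega
    have h1 : |∑ x ∈ J, (G x - G' x)| ≤ (C₀ / δ) ^ m * A := by
      have h2 : ∑ s, (if τ s ∈ J then σ s else 0)
          = ∑ z ∈ centres t, ∑ s, if τ s ∈ J then clusterWeight t σ z s else 0 := by
        rw [Finset.sum_comm]
        refine Finset.sum_congr rfl fun s _ => ?_
        split_ifs
        · exact (sum_clusterWeight s).symm
        · simp
      rw [hJsum J hJ, h2, hA, clusterMoments, Finset.mul_sum]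
      exact (Finset.abs_sum_le_sum_abs _ _).trans (Finset.sum_le_sum hz)
    calc _ ≤ (C₀ / δ) ^ m * A * δ ^ m := by gcongr
      _ = C₀ ^ m * A := by
        rw [div_pow]
        field_simp
      _ ≤ _ := by
        gcongr
        linarith [le_abs_self C₀]
  have h2 := hT S (Finset.card_image_le.trans (by simp)) G G' hG hG' htot _
    (mul_nonneg (by positivity) hA0) hbal
  refine (h2.wasserstein_le hm hGS hG'S).trans ?_
  rw [mul_assoc]
  exact mul_le_mul_of_nonneg_right (by linarith) (mul_nonneg (by positivity) hA0)

end clusters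


/-! ### Limits of normalised differences of mixtures -/

section pointwise

variable {q : ℕ} {ι : Type*} [Fintype ι]

/-- The crude form of the Taylor estimate, in which the increments of the top derivatives are only
bounded by 2M. It supplies the dominating function for the passage to the limit. -/
theorem abs_sum_le_of_bounded {z : Par q} {ρ : ℝ} (hρ : 0 < ρ) (hρ1 : ρ ≤ 1) {r : ℕ}
    {f : Par q → ℝ} (hf : ContDiffOn ℝ (r : WithTop ℕ∞) f (Metric.ball z ρ)) {M : ℝ}
    (hM : ∀ γ ∈ multiIdx q r, ∀ θ ∈ Metric.ball z ρ, |multiD γ f θ| ≤ M)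
    (τ : ι → Par q) {I : Finset ι} (hI : I.card ≤ r + 1) (hτ : ∀ s ∈ I, τ s ∈ Metric.ball z ρ)
    {σ : ι → ℝ} (hσ : ∀ s ∉ I, σ s = 0) :
    |∑ s, σ s * f (τ s)| ≤ ((multiIdx q r).card + 2 * ((1 + 2 * q) ^ r * (q + 1) ^ r)) * M
      * momSum z τ r σ := by
  have hz : z ∈ Metric.ball z ρ := Metric.mem_ball_self hρ
  have hM0 : 0 ≤ M := (abs_nonneg _).trans (hM 0 (zero_mem_multiIdx q r) z hz)
  have h1 := abs_sum_sub_taylor_le hρ hρ1 (η := 2 * M) (by positivity) hf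
    (fun γ hγ θ hθ => by
      have hγm : γ ∈ multiIdx q r := mem_multiIdx.2 hγ.le
      have h2 := hM γ hγm θ hθ
      have h3 := hM γ hγm z hz
      have h4 := abs_sub (multiD γ f θ) (multiD γ f z)
      linarith) τ hI hτ hσ
  have h2 : |∑ α ∈ multiIdx q r, multiD α f z / idxFactorial α
      * ∑ s, σ s * monom α (τ s - z)| ≤ (multiIdx q r).card * (M * momSum z τ r σ) := by
    rw [← nsmul_eq_mul]
    refine (Finset.abs_sum_le_sum_abs _ _).trans (Finset.sum_le_card_nsmul _ _ _ fun α hα => ?_)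
    rw [abs_mul]
    refine mul_le_mul ?_ (abs_moment_le_momSum z τ hα σ) (abs_nonneg _) hM0
    have h5 : (1 : ℝ) ≤ idxFactorial α := by exact_mod_cast idxFactorial_pos α
    rw [abs_div, abs_of_pos (zero_lt_one.trans_le h5)]
    exact (div_le_self (abs_nonneg _) h5).trans (hM α hα z hz)
  have h3 := abs_sub_abs_le_abs_sub (∑ s, σ s * f (τ s))
    (∑ α ∈ multiIdx q r, multiD α f z / idxFactorial α * ∑ s, σ s * monom α (τ s - z))
  nlinarith

/-- The sharp form of the Taylor estimate: by continuity the increments of the derivatives of order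
r are arbitrarily small near z, so the remainder is negligible with respect to the moments. -/
theorem tendsto_sum_sub_taylor_div {z : Par q} {ρ : ℝ} (hρ : 0 < ρ) (hρ1 : ρ ≤ 1) {r : ℕ}
    {f : Par q → ℝ} (hf : ContDiffOn ℝ (r : WithTop ℕ∞) f (Metric.ball z ρ))
    {τ : ℕ → ι → Par q} {I : Finset ι} (hI : I.card ≤ r + 1)
    (hτ : ∀ s ∈ I, Filter.Tendsto (fun n => τ n s) Filter.atTop (nhds z))
    {σ : ℕ → ι → ℝ} (hσ : ∀ n, ∀ s ∉ I, σ n s = 0) {A : ℕ → ℝ} (hA : ∀ n, 0 < A n)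
    (hAσ : ∀ n, momSum z (τ n) r (σ n) ≤ A n) :
    Filter.Tendsto (fun n => (∑ s, σ n s * f (τ n s) - ∑ α ∈ multiIdx q r,
      multiD α f z / idxFactorial α * ∑ s, σ n s * monom α (τ n s - z)) / A n)
      Filter.atTop (nhds 0) := by
  rw [Metric.tendsto_nhds]
  intro ε hε
  set C : ℝ := (1 + 2 * q) ^ r * (q + 1) ^ r with hC
  have hC0 : 0 ≤ C := by positivity
  set η : ℝ := ε / (C + 1) with hη
  have hη0 : 0 < η := by positivity
  have hcont : ∀ᶠ θ in nhds z, ∀ γ ∈ multiIdx q r, ∑ i, γ i = r →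
      |multiD γ f θ - multiD γ f z| ≤ η := by
    refine (Filter.eventually_all_finset _).2 fun γ _ => ?_
    by_cases h : ∑ i, γ i = r
    · have hc : ContinuousAt (multiD γ f) z :=
        (contDiffOn_multiD Metric.isOpen_ball γ 0 (hf.of_le (by norm_cast; omega))).continuousOn.continuousAt
          (Metric.ball_mem_nhds z hρ)
      filter_upwards [Metric.tendsto_nhds.1 hc.tendsto η hη0] with θ hθ _
      rw [Real.dist_eq] at hθ
      exact hθ.le
    · exact Filter.Eventually.of_forall fun θ h' => absurd h' h
  obtain ⟨ρ', hρ', hball⟩ := Metric.eventually_nhds_iff_ball.1 hcont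
  have hev : ∀ᶠ n in Filter.atTop, ∀ s ∈ I, τ n s ∈ Metric.ball z (min ρ ρ') :=
    (Filter.eventually_all_finset _).2 fun s hs =>
      (hτ s hs).eventually (Metric.ball_mem_nhds z (lt_min hρ hρ'))
  filter_upwards [hev] with n hn
  have h1 := abs_sum_sub_taylor_le (lt_min hρ hρ') ((min_le_left _ _).trans hρ1) hη0.le
    (hf.mono (Metric.ball_subset_ball (min_le_left _ _)))
    (fun γ hγ θ hθ => hball θ (Metric.ball_subset_ball (min_le_right _ _) hθ) γ
      (mem_multiIdx.2 hγ.le) hγ) (τ n) hI hn (hσ n)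
  rw [dist_zero_right, Real.norm_eq_abs, abs_div, abs_of_pos (hA n), div_lt_iff₀ (hA n)]
  calc _ ≤ _ := h1
    _ ≤ C * η * A n := mul_le_mul_of_nonneg_left (hAσ n) (by positivity)
    _ < ε * A n := by
      refine mul_lt_mul_of_pos_right ?_ (hA n)
      rw [hη, mul_div_assoc', div_lt_iff₀ (by positivity)]
      nlinarith

end pointwise

/-! ### Compactness of the normalised moments and dominated convergence -/

section limits

variable {X : Type*} [MeasurableSpace X] {q : ℕ} {lam : Measure X} {p : X → Par q → ℝ}
  {Θ : Set (Par q)} {m : ℕ} {ι : Type*} [Fintype ι]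

/-- Along a subsequence, the moments of the clusters, divided by their total size, converge to a
nontrivial family of coefficients. -/
theorem exists_limit_coefficients {t : ι → Par q} (τ : ℕ → ι → Par q) (σ : ℕ → ι → ℝ)
    (hσ0 : ∀ n, ∑ s, σ n s = 0) (hpos : ∀ n, 0 < clusterMoments t (τ n) (σ n)) :
    ∃ φ : ℕ → ℕ, StrictMono φ ∧ ∃ a : Par q → (Fin q → ℕ) → ℝ,
      ∑ z ∈ centres t, a z 0 = 0 ∧
      (∃ z ∈ centres t, ∃ α ∈ multiIdx q ((cluster t z).card - 1), a z α ≠ 0) ∧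
      ∀ z ∈ centres t, ∀ α ∈ multiIdx q ((cluster t z).card - 1), Filter.Tendsto
        (fun n => (∑ s, clusterWeight t (σ (φ n)) z s * monom α (τ (φ n) s - z))
          / clusterMoments t (τ (φ n)) (σ (φ n)) / idxFactorial α) Filter.atTop (nhds (a z α)) := by
  classical
  set P : Finset (Par q × (Fin q → ℕ)) := (centres t).biUnion fun z =>
    (multiIdx q ((cluster t z).card - 1)).image fun α => (z, α) with hP
  have memP : ∀ z α, (z, α) ∈ P ↔ z ∈ centres t ∧ α ∈ multiIdx q ((cluster t z).card - 1) := by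
    intro z α
    simp only [hP, Finset.mem_biUnion, Finset.mem_image, Prod.mk.injEq]
    constructor
    · rintro ⟨z', hz', α', hα', rfl, rfl⟩
      exact ⟨hz', hα'⟩
    · rintro ⟨hz, hα⟩
      exact ⟨z, hz, α, hα, rfl, rfl⟩
  set A : ℕ → ℝ := fun n => clusterMoments t (τ n) (σ n) with hA
  set c : ℕ → P → ℝ := fun n x =>
    (∑ s, clusterWeight t (σ n) x.1.1 s * monom x.1.2 (τ n s - x.1.1)) / A n with hc
  -- Each moment is one of the terms that make up A, so the normalised moments stay in a compact
  -- cube.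
  have hmem : ∀ n, c n ∈ Set.univ.pi fun _ : P => Set.Icc (-1 : ℝ) 1 := by
    rintro n ⟨⟨z, α⟩, hx⟩ -
    obtain ⟨hz, hα⟩ := (memP z α).1 hx
    refine abs_le.1 ?_
    simp only [hc]
    rw [abs_div, abs_of_pos (hpos n), div_le_one (hpos n)]
    exact (abs_moment_le_momSum z (τ n) hα _).trans (momSum_le_clusterMoments hz)
  obtain ⟨ℓ, -, φ, hφ, hlim⟩ :=
    (isCompact_univ_pi fun _ : P => isCompact_Icc (a := (-1 : ℝ)) (b := 1)).tendsto_subseq hmem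
  rw [tendsto_pi_nhds] at hlim
  set a : Par q → (Fin q → ℕ) → ℝ := fun z α =>
    if h : (z, α) ∈ P then ℓ ⟨(z, α), h⟩ / idxFactorial α else 0 with ha
  have hconv : ∀ z ∈ centres t, ∀ α ∈ multiIdx q ((cluster t z).card - 1), Filter.Tendsto
      (fun n => (∑ s, clusterWeight t (σ (φ n)) z s * monom α (τ (φ n) s - z)) / A (φ n)
        / idxFactorial α) Filter.atTop (nhds (a z α)) := by
    intro z hz α hα
    have h := (memP z α).2 ⟨hz, hα⟩
    have h1 := (hlim ⟨(z, α), h⟩).div_const (idxFactorial α : ℝ)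
    simp only [ha, dif_pos h]
    exact h1
  refine ⟨φ, hφ, a, ?_, ?_, hconv⟩
  · have h1 : Filter.Tendsto (fun _ : ℕ => (0 : ℝ)) Filter.atTop
        (nhds (∑ z ∈ centres t, a z 0)) := by
      refine (tendsto_finsetSum _ fun z hz => hconv z hz 0 (zero_mem_multiIdx _ _)).congr fun n => ?_
      have h2 := sum_clusterWeight_mul (t := t) (σ := σ (φ n)) fun _ => (1 : ℝ)
      simp only [mul_one, hσ0] at h2
      simp only [monom_zero, mul_one, idxFactorial, Pi.zero_apply, Nat.factorial_zero,
        Finset.prod_const_one, Nat.cast_one, div_one]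
      rw [← Finset.sum_div, h2, zero_div]
    exact (tendsto_nhds_unique h1 tendsto_const_nhds)
  · by_contra hcon
    push Not at hcon
    -- The absolute normalised moments sum to 1 for every n, and this survives in the limit, so the
    -- limit coefficients cannot all vanish.
    have h1 : Filter.Tendsto (fun _ : ℕ => (1 : ℝ)) Filter.atTop (nhds (∑ z ∈ centres t,
        ∑ α ∈ multiIdx q ((cluster t z).card - 1), |a z α * idxFactorial α|)) := by
      refine (tendsto_finsetSum _ fun z hz => tendsto_finsetSum _ fun α hα =>
        ((hconv z hz α hα).mul_const (idxFactorial α : ℝ)).abs).congr fun n => ?_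
      have h2 : ∀ z α, |(∑ s, clusterWeight t (σ (φ n)) z s * monom α (τ (φ n) s - z)) / A (φ n)
          / idxFactorial α * idxFactorial α|
          = |∑ s, clusterWeight t (σ (φ n)) z s * monom α (τ (φ n) s - z)| / A (φ n) := by
        intro z α
        have h3 : (idxFactorial α : ℝ) ≠ 0 := by exact_mod_cast (idxFactorial_pos α).ne'
        rw [div_mul_cancel₀ _ h3, abs_div, abs_of_pos (hpos _)]
      simp only [h2]
      simp only [← Finset.sum_div]
      exact div_self (hpos _).ne'
    rw [Finset.sum_eq_zero fun z hz => Finset.sum_eq_zero fun α hα => by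
      rw [hcon z hz α hα, zero_mul, abs_zero]] at h1
    exact one_ne_zero (tendsto_nhds_unique tendsto_const_nhds h1)

/-- Along a subsequence, normalised differences of mixtures converge to a nontrivial combination of
derivatives of the densities. -/
theorem exists_limit_combination (hp : IsDensityFamily lam p Θ) (hA : AssumptionA2 lam p Θ m)
    {t : ι → Par q} (ht : ∀ s, t s ∈ Θ) (hcl : ∀ z ∈ centres t, (cluster t z).card ≤ m + 1)
    (τ : ℕ → ι → Par q) (σ : ℕ → ι → ℝ) (hτΘ : ∀ n s, τ n s ∈ Θ)
    (hτ : ∀ s, Filter.Tendsto (fun n => τ n s) Filter.atTop (nhds (t s)))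
    (hσ0 : ∀ n, ∑ s, σ n s = 0) (hpos : ∀ n, 0 < clusterMoments t (τ n) (σ n)) :
    ∃ φ : ℕ → ℕ, StrictMono φ ∧ ∃ a : Par q → (Fin q → ℕ) → ℝ,
      ∑ z ∈ centres t, a z 0 = 0 ∧
      (∃ z ∈ centres t, ∃ α ∈ multiIdx q ((cluster t z).card - 1), a z α ≠ 0) ∧
      Integrable (fun x => ∑ z ∈ centres t, ∑ α ∈ multiIdx q ((cluster t z).card - 1),
        a z α * multiD α (p x) z) lam ∧
      ∀ h : X → ℝ, Measurable h → ∀ K : ℝ, (∀ x, |h x| ≤ K) → Filter.Tendsto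
        (fun n => (∑ s, σ (φ n) s * ∫ x, h x * p x (τ (φ n) s) ∂lam)
          / clusterMoments t (τ (φ n)) (σ (φ n))) Filter.atTop
        (nhds (∫ x, h x * ∑ z ∈ centres t, ∑ α ∈ multiIdx q ((cluster t z).card - 1),
          a z α * multiD α (p x) z ∂lam)) := by
  classical
  obtain ⟨φ, hφ, a, ha0, hane, hconv⟩ := exists_limit_coefficients (t := t) τ σ hσ0 hpos
  have hzΘ : ∀ z ∈ centres t, z ∈ Θ := fun z hz => by
    obtain ⟨s, rfl⟩ := mem_centres.1 hz
    exact ht s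
  have hloc : ∀ z : Par q, ∃ ρ : ℝ, 0 < ρ ∧ ρ ≤ 1 ∧ ∃ Ψ : X → ℝ, Integrable Ψ lam ∧
      (z ∈ Θ → ∀ᵐ x ∂lam, ContDiffOn ℝ (m : WithTop ℕ∞) (p x) (Metric.ball z ρ) ∧
        ∀ γ ∈ multiIdx q m, ∀ θ ∈ Metric.ball z ρ, |multiD γ (p x) θ| ≤ Ψ x) := by
    intro z
    by_cases hz : z ∈ Θ
    · obtain ⟨ρ, h1, h2, Ψ, h3, h4⟩ := exists_local_domination hp hA hz
      exact ⟨ρ, h1, h2, Ψ, h3, fun _ => h4⟩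
    · exact ⟨1, one_pos, le_rfl, 0, integrable_zero _ _ _, fun h => absurd h hz⟩
  choose ρ hρ hρ1 Ψ hΨ hb using hloc
  have hball : ∀ᵐ x ∂lam, ∀ z ∈ centres t,
      ContDiffOn ℝ (m : WithTop ℕ∞) (p x) (Metric.ball z (ρ z)) ∧
        ∀ γ ∈ multiIdx q m, ∀ θ ∈ Metric.ball z (ρ z), |multiD γ (p x) θ| ≤ Ψ z x :=
    (Filter.eventually_all_finset _).2 fun z hz => hb z (hzΘ z hz)
  set d : Par q → ℕ := fun z => (cluster t z).card - 1 with hd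
  have hdm : ∀ z ∈ centres t, d z ≤ m := fun z hz => by
    have := hcl z hz
    simp only [hd]
    omega
  have hdc : ∀ z ∈ centres t, (cluster t z).card ≤ d z + 1 := fun z hz => by
    simp only [hd]
    omega
  set A : ℕ → ℝ := fun n => clusterMoments t (τ n) (σ n) with hAdef
  set F : ℕ → X → ℝ := fun n x => (∑ s, σ n s * p x (τ n s)) / A n with hF
  set f : X → ℝ := fun x => ∑ z ∈ centres t, ∑ α ∈ multiIdx q (d z), a z α * multiD α (p x) z
    with hf
  set Cst : Par q → ℝ := fun z =>
    (multiIdx q (d z)).card + 2 * ((1 + 2 * q) ^ d z * (q + 1) ^ d z) with hCst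
  have hFm : ∀ n, AEStronglyMeasurable (F n) lam := fun n => by
    have : Measurable (F n) := by
      simp only [hF]
      exact (Finset.measurable_sum _ fun s _ => (hp _ (hτΘ n s)).1.const_mul _).div_const _
    exact this.aestronglyMeasurable
  -- Taylor expansion in each cluster; the factor 1/α! has been absorbed into the coefficients a.
  have hlim : ∀ᵐ x ∂lam, Filter.Tendsto (fun n => F (φ n) x) Filter.atTop (nhds (f x)) := by
    filter_upwards [hball] with x hx
    have h1 : ∀ z ∈ centres t, Filter.Tendsto
        (fun n => (∑ s, clusterWeight t (σ (φ n)) z s * p x (τ (φ n) s)) / A (φ n))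
        Filter.atTop (nhds (∑ α ∈ multiIdx q (d z), a z α * multiD α (p x) z)) := by
      intro z hz
      have h2 := tendsto_sum_sub_taylor_div (hρ z) (hρ1 z) (r := d z) (f := p x)
        ((hx z hz).1.of_le (by exact_mod_cast hdm z hz)) (τ := fun n => τ (φ n))
        (I := cluster t z) (hdc z hz)
        (fun s hs => by
          have := (hτ s).comp hφ.tendsto_atTop
          rwa [mem_cluster.1 hs] at this)
        (σ := fun n => clusterWeight t (σ (φ n)) z) (fun n s hs => clusterWeight_eq_zero hs)
        (A := fun n => A (φ n)) (fun n => hpos _) (fun n => momSum_le_clusterMoments hz)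
      have h3 := tendsto_finsetSum (multiIdx q (d z)) fun α hα =>
        (hconv z hz α hα).mul_const (multiD α (p x) z)
      refine ((h2.add h3).congr fun n => ?_).trans (by rw [zero_add])
      have h4 : ∑ α ∈ multiIdx q (d z), (∑ s, clusterWeight t (σ (φ n)) z s
          * monom α (τ (φ n) s - z)) / A (φ n) / idxFactorial α * multiD α (p x) z
          = (∑ α ∈ multiIdx q (d z), multiD α (p x) z / idxFactorial α
            * ∑ s, clusterWeight t (σ (φ n)) z s * monom α (τ (φ n) s - z)) / A (φ n) := by
        rw [Finset.sum_div]
        exact Finset.sum_congr rfl fun α _ => by ring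
      rw [h4]
      ring
    refine (tendsto_finsetSum _ h1).congr fun n => ?_
    rw [← Finset.sum_div, sum_clusterWeight_mul]
  -- The domination holds only once all points have entered the balls on which the derivatives are
  -- controlled.
  have hbound : ∀ᶠ n in Filter.atTop, ∀ᵐ x ∂lam,
      |F (φ n) x| ≤ ∑ z ∈ centres t, Cst z * |Ψ z x| := by
    have hev : ∀ᶠ n in Filter.atTop, ∀ s, τ (φ n) s ∈ Metric.ball (t s) (ρ (t s)) :=
      Filter.eventually_all.2 fun s =>
        ((hτ s).comp hφ.tendsto_atTop).eventually (Metric.ball_mem_nhds _ (hρ _))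
    filter_upwards [hev] with n hn
    filter_upwards [hball] with x hx
    simp only [hF]
    rw [← sum_clusterWeight_mul (t := t), Finset.sum_div]
    refine (Finset.abs_sum_le_sum_abs _ _).trans (Finset.sum_le_sum fun z hz => ?_)
    rw [abs_div, abs_of_pos (hpos _), div_le_iff₀ (hpos _)]
    have hCst0 : 0 ≤ Cst z := by simp only [hCst]; positivity
    calc _ ≤ Cst z * |Ψ z x| * momSum z (τ (φ n)) (d z) (clusterWeight t (σ (φ n)) z) := by
          refine abs_sum_le_of_bounded (hρ z) (hρ1 z)
            ((hx z hz).1.of_le (by exact_mod_cast hdm z hz)) (fun γ hγ θ hθ => ?_) (τ (φ n))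
            (I := cluster t z) (hdc z hz) (fun s hs => ?_) fun s hs => clusterWeight_eq_zero hs
          · refine ((hx z hz).2 γ (mem_multiIdx.2 ?_) θ hθ).trans (le_abs_self _)
            exact (mem_multiIdx.1 hγ).trans (hdm z hz)
          · have := hn s
            rwa [mem_cluster.1 hs] at this
      _ ≤ _ := mul_le_mul_of_nonneg_left (momSum_le_clusterMoments hz) (by positivity)
  have hboundi : Integrable (fun x => ∑ z ∈ centres t, Cst z * |Ψ z x|) lam :=
    integrable_finsetSum _ fun z _ => (hΨ z).abs.const_mul _
  have hfm : AEStronglyMeasurable f lam :=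
    aestronglyMeasurable_of_tendsto_ae Filter.atTop (fun n => hFm (φ n)) hlim
  have hfi : Integrable f lam := by
    refine Integrable.mono' (g := fun x => ∑ z ∈ centres t, ∑ α ∈ multiIdx q (d z),
      |a z α| * Ψ z x) ?_ hfm ?_
    · exact integrable_finsetSum _ fun z _ => integrable_finsetSum _ fun α _ =>
        (hΨ z).const_mul _
    · filter_upwards [hball] with x hx
      rw [Real.norm_eq_abs]
      refine (Finset.abs_sum_le_sum_abs _ _).trans (Finset.sum_le_sum fun z hz =>
        (Finset.abs_sum_le_sum_abs _ _).trans (Finset.sum_le_sum fun α hα => ?_))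
      rw [abs_mul]
      refine mul_le_mul_of_nonneg_left ((hx z hz).2 α (mem_multiIdx.2 ?_) z
        (Metric.mem_ball_self (hρ z))) (abs_nonneg _)
      exact (mem_multiIdx.1 hα).trans (hdm z hz)
  refine ⟨φ, hφ, a, ha0, hane, hfi, fun h hm K hK => ?_⟩
  have key := tendsto_integral_filter_of_dominated_convergence (μ := lam) (l := Filter.atTop)
    (F := fun n x => h x * F (φ n) x) (f := fun x => h x * f x)
    (fun x => K * ∑ z ∈ centres t, Cst z * |Ψ z x|)
    (Filter.Eventually.of_forall fun n => hm.aestronglyMeasurable.mul (hFm (φ n))) ?_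
    (hboundi.const_mul K) ?_
  · refine key.congr fun n => ?_
    simp only [hF, mul_div_assoc', Finset.mul_sum]
    rw [integral_div, integral_finsetSum]
    · congr 1
      refine Finset.sum_congr rfl fun s _ => ?_
      rw [← integral_const_mul]
      congr 1
      funext x
      ring
    · intro s _
      exact ((integrable_density hp (hτΘ _ s)).const_mul _).bdd_mul hm.aestronglyMeasurable
        (Filter.Eventually.of_forall hK)
  · filter_upwards [hbound] with n hn
    filter_upwards [hn] with x hx
    rw [norm_mul, Real.norm_eq_abs, Real.norm_eq_abs]
    exact mul_le_mul (hK x) hx (abs_nonneg _) ((abs_nonneg _).trans (hK x))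
  · filter_upwards [hlim] with x hx
    exact hx.const_mul _

end limits


/-! ### The inverse bound -/

section counting

variable {q k : ℕ}

/-- The at least k₁ - 1 values other than z need an index each, and the fibre over z has to do with
the remaining ones. -/
theorem card_fibre_le [DecidableEq (Par q)] (f : Fin k → Par q) {k₁ : ℕ}
    (hf : k₁ ≤ (Finset.univ.image f).card) (z : Par q) :
    (Finset.univ.filter fun i => f i = z).card ≤ k - k₁ + 1 := by
  have h1 : Finset.univ.image f
      ⊆ insert z ((Finset.univ.filter fun i => ¬ f i = z).image f) := by
    intro x hx
    obtain ⟨i, -, rfl⟩ := Finset.mem_image.1 hx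
    by_cases h : f i = z
    · exact Finset.mem_insert.2 (Or.inl h)
    · exact Finset.mem_insert.2 (Or.inr (Finset.mem_image.2 ⟨i, by simp [h], rfl⟩))
  have h2 := (Finset.card_le_card h1).trans ((Finset.card_insert_le _ _).trans
    (Nat.succ_le_succ Finset.card_image_le))
  have h3 := Finset.card_filter_add_card_filter_not (s := (Finset.univ : Finset (Fin k)))
    (fun i => f i = z)
  rw [Finset.card_univ, Fintype.card_fin] at h3
  omega

/-- Each of the two families attains all the points of S, so each contributes at most k - k₁ + 1
indices to a cluster. The total 2(k - k₁) + 2 is m + 1, which is where the exponent m comes from. -/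
theorem card_cluster_elim_le (θ θ' : Fin k → Par q) {k₁ : ℕ} {S : Finset (Par q)}
    (hS : k₁ ≤ S.card) (h : ∀ x ∈ S, ∃ i, θ i = x) (h' : ∀ x ∈ S, ∃ i, θ' i = x) (z : Par q) :
    (cluster (Sum.elim θ θ') z).card ≤ 2 * (k - k₁) + 2 := by
  classical
  have hsub : ∀ f : Fin k → Par q, (∀ x ∈ S, ∃ i, f i = x) →
      k₁ ≤ (Finset.univ.image f).card := fun f hf => hS.trans (Finset.card_le_card fun x hx => by
    obtain ⟨i, hi⟩ := hf x hx
    exact Finset.mem_image.2 ⟨i, Finset.mem_univ i, hi⟩)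
  have h1 : (cluster (Sum.elim θ θ') z).card
      = (Finset.univ.filter fun i => θ i = z).card
        + (Finset.univ.filter fun i => θ' i = z).card := by
    simp only [cluster, Finset.card_filter, Fintype.sum_sum_type, Sum.elim_inl, Sum.elim_inr]
    congr!
  have h2 := card_fibre_le θ (hsub θ h) z
  have h3 := card_fibre_le θ' (hsub θ' h') z
  omega

/-- Inclusion and exclusion: the two families of at most k limit points have S in common. This is
the range of the number of points in the linear independence condition. -/
theorem card_centres_elim (θ θ' : Fin k → Par q) {k₁ : ℕ} {S : Finset (Par q)}
    (hS : k₁ ≤ S.card) (h : ∀ x ∈ S, ∃ i, θ i = x) (h' : ∀ x ∈ S, ∃ i, θ' i = x) :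
    k₁ ≤ (centres (Sum.elim θ θ')).card ∧ (centres (Sum.elim θ θ')).card ≤ 2 * k - k₁ := by
  classical
  have h1 : centres (Sum.elim θ θ') = Finset.univ.image θ ∪ Finset.univ.image θ' := by
    ext x
    simp [mem_centres]
  have h2 := Finset.card_union_add_card_inter (Finset.univ.image θ) (Finset.univ.image θ')
  have hSI : S ⊆ Finset.univ.image θ ∩ Finset.univ.image θ' := fun x hx => by
    obtain ⟨i, hi⟩ := h x hx
    obtain ⟨j, hj⟩ := h' x hx
    exact Finset.mem_inter.2 ⟨Finset.mem_image.2 ⟨i, Finset.mem_univ i, hi⟩,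
      Finset.mem_image.2 ⟨j, Finset.mem_univ j, hj⟩⟩
  have h3 := Finset.card_le_card hSI
  have h4 : (Finset.univ.image θ).card ≤ k := Finset.card_image_le.trans (by simp)
  have h5 : (Finset.univ.image θ').card ≤ k := Finset.card_image_le.trans (by simp)
  have h6 : S.card ≤ (Finset.univ.image θ ∪ Finset.univ.image θ').card :=
    Finset.card_le_card (hSI.trans (Finset.inter_subset_left.trans Finset.subset_union_left))
  rw [h1]
  omega

end counting

/-! ### Global and local bounds of the Wasserstein distance by the discrepancy -/

section inverse

variable {X : Type*} [MeasurableSpace X] {q : ℕ} {lam : Measure X} {p : X → Par q → ℝ}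
  {Θ : Set (Par q)} {m k k₁ : ℕ}

/-- The cluster sizes serve as the multiplicities m_i. They add up to the number 2k of indices, the
upper end of the admissible range. -/
theorem LinIndep.combination_ne_zero {ι : Type*} [Fintype ι] (hL : LinIndep lam p Θ m k₁ k)
    (hk : k₁ ≤ k) {t : ι → Par q} (hι : Fintype.card ι = 2 * k) (ht : ∀ s, t s ∈ Θ)
    (hc1 : k₁ ≤ (centres t).card) (hc2 : (centres t).card ≤ 2 * k - k₁)
    (hcl : ∀ z ∈ centres t, (cluster t z).card ≤ m + 1) {a : Par q → (Fin q → ℕ) → ℝ}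
    (ha0 : ∑ z ∈ centres t, a z 0 = 0)
    (hane : ∃ z ∈ centres t, ∃ α ∈ multiIdx q ((cluster t z).card - 1), a z α ≠ 0) :
    ¬ (fun x => ∑ z ∈ centres t, ∑ α ∈ multiIdx q ((cluster t z).card - 1),
        a z α * multiD α (p x) z) =ᵐ[lam] 0 := by
  intro h0
  obtain ⟨z, hz, α, hα, hne⟩ := hane
  set e := (centres t).equivFin.symm with he
  have hsum : ∀ {M : Type} [AddCommMonoid M] (F : Par q → M),
      ∑ i, F (e i) = ∑ z ∈ centres t, F z := by
    intro M _ F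
    rw [← Finset.sum_coe_sort (centres t) F]
    exact Equiv.sum_comp e fun z => F z
  have key := hL.2 (centres t).card hc1 hc2 (fun i => (cluster t (e i)).card)
    (fun i => ⟨card_cluster_pos (e i).2, hcl _ (e i).2⟩) ?_ ?_ (fun i => e i)
    (fun i j hij => e.injective (Subtype.ext hij)) (fun i => ?_) (fun i => a (e i)) ?_ ?_
    (e.symm ⟨z, hz⟩) α (by simpa using hα)
  · simp at key
    exact hne key
  · rw [hsum fun z => (cluster t z).card, sum_card_cluster, hι]
    omega
  · rw [hsum fun z => (cluster t z).card, sum_card_cluster, hι]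
  · obtain ⟨s, hs⟩ := mem_centres.1 (e i).2
    rw [← hs]
    exact ht s
  · filter_upwards [h0] with x hx
    rw [hsum fun z => ∑ α ∈ multiIdx q ((cluster t z).card - 1), a z α * multiD α (p x) z]
    exact hx
  · rw [hsum fun z => a z 0]
    exact ha0

theorem eq_zero_of_tendsto_of_mul_le {u : ℕ → ℝ} {c B : ℝ}
    (hu : Filter.Tendsto u Filter.atTop (nhds c)) (hB : ∀ n : ℕ, (n : ℝ) * |u n| ≤ B) : c = 0 := by
  have h1 : Filter.Tendsto (fun n : ℕ => B / n) Filter.atTop (nhds 0) :=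
    tendsto_const_div_atTop_nhds_zero_nat B
  refine tendsto_nhds_unique hu (squeeze_zero_norm' ?_ h1)
  filter_upwards [Filter.eventually_gt_atTop 0] with n hn
  have hn' : (0 : ℝ) < n := by exact_mod_cast hn
  rw [Real.norm_eq_abs, le_div_iff₀ hn', mul_comm]
  exact hB n

variable {ker : X → X → ℝ} {H : Type*} [NormedAddCommGroup H]
  [InnerProductSpace ℝ H] [RKHS ℝ H X ℝ] [CompleteSpace H]

theorem continuousOn_testFun (hk : GoodKernel ker) (hH : HasKernel H ker)
    (hp : IsDensityFamily lam p Θ) (hA : AssumptionA2 lam p Θ m) (h : H) :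
    ContinuousOn (testFun lam p h) Θ :=
  continuousOn_integral_density hp hA (measurable_rkhs hk hH h) (abs_apply_le hk hH h)

theorem tendsto_mixInt_ofPoints {w : ℕ → Fin k → ℝ} {θ : ℕ → Fin k → Par q} {w₀ : Fin k → ℝ}
    {θ₀ : Fin k → Par q} (hw : Filter.Tendsto w Filter.atTop (nhds w₀))
    (hθ : Filter.Tendsto θ Filter.atTop (nhds θ₀)) (hθΘ : ∀ n i, θ n i ∈ Θ) (hθ₀ : ∀ i, θ₀ i ∈ Θ)
    {F : Par q → ℝ} (hF : ContinuousOn F Θ) :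
    Filter.Tendsto (fun n => mixInt (ofPoints (w n) (θ n)) F) Filter.atTop
      (nhds (mixInt (ofPoints w₀ θ₀) F)) := by
  simp only [mixInt_ofPoints]
  rw [tendsto_pi_nhds] at hw hθ
  refine tendsto_finsetSum _ fun i _ => (hw i).mul ?_
  exact (hF (θ₀ i) (hθ₀ i)).tendsto.comp
    (tendsto_nhdsWithin_iff.2 ⟨hθ i, Filter.Eventually.of_forall fun n => hθΘ n i⟩)

/-- Two sequences of mixing measures with a common limit cannot have a discrepancy which is
negligible with respect to their Wasserstein distance. -/
theorem false_of_common_limit (hk : GoodKernel ker) (hH : HasKernel H ker)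
    (hΘ : IsCompact Θ) (hp : IsDensityFamily lam p Θ) (hk₁k : k₁ ≤ k)
    (hm : m = 2 * (k - k₁) + 1) (hA : AssumptionA2 lam p Θ m) (hL : LinIndep lam p Θ m k₁ k)
    {w w' : ℕ → Fin k → ℝ} {θ θ' : ℕ → Fin k → Par q} {w₀ w₀' : Fin k → ℝ}
    {θ₀ θ₀' : Fin k → Par q} (hw : ∀ n i, 0 ≤ w n i) (hw' : ∀ n i, 0 ≤ w' n i)
    (hw1 : ∀ n, ∑ i, w n i = 1) (hw1' : ∀ n, ∑ i, w' n i = 1)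
    (hθ : ∀ n i, θ n i ∈ Θ) (hθ' : ∀ n i, θ' n i ∈ Θ) (hθ₀ : ∀ i, θ₀ i ∈ Θ)
    (hθ₀' : ∀ i, θ₀' i ∈ Θ) (hθl : Filter.Tendsto θ Filter.atTop (nhds θ₀))
    (hθl' : Filter.Tendsto θ' Filter.atTop (nhds θ₀'))
    (heq : ofPoints w₀ θ₀ = ofPoints w₀' θ₀') (hcard : k₁ ≤ (ofPoints w₀ θ₀).support.card)
    (hbig : ∀ n : ℕ, (n : ℝ) * mmd H (mixture lam p (ofPoints (w n) (θ n)))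
      (mixture lam p (ofPoints (w' n) (θ' n)))
        < wasserstein m (ofPoints (w n) (θ n)) (ofPoints (w' n) (θ' n)) ^ m) : False := by
  classical
  set G : ℕ → Par q →₀ ℝ := fun n => ofPoints (w n) (θ n) with hG
  set G' : ℕ → Par q →₀ ℝ := fun n => ofPoints (w' n) (θ' n) with hG'
  have hGm : ∀ n, G n ∈ mixAtMost Θ k := fun n => ofPoints_mem (hw n) (hw1 n) (hθ n)
  have hGm' : ∀ n, G' n ∈ mixAtMost Θ k := fun n => ofPoints_mem (hw' n) (hw1' n) (hθ' n)
  set t : Fin k ⊕ Fin k → Par q := Sum.elim θ₀ θ₀' with ht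
  set τ : ℕ → Fin k ⊕ Fin k → Par q := fun n => Sum.elim (θ n) (θ' n) with hτ
  set σ : ℕ → Fin k ⊕ Fin k → ℝ := fun n => Sum.elim (w n) (fun i => -w' n i) with hσ
  have hdiff : ∀ n F, mixInt (G n) F - mixInt (G' n) F = ∑ s, σ n s * F (τ n s) := by
    intro n F
    simp [hG, hG', mixInt_ofPoints, hσ, hτ, Fintype.sum_sum_type, sub_eq_add_neg]
  have hσ0 : ∀ n, ∑ s, σ n s = 0 := by
    intro n
    simp [hσ, Fintype.sum_sum_type, hw1, hw1']
  have htΘ : ∀ s, t s ∈ Θ := by rintro (i | i) <;> simp [ht, hθ₀, hθ₀']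
  have hτΘ : ∀ n s, τ n s ∈ Θ := by rintro n (i | i) <;> simp [hτ, hθ, hθ']
  have hτl : ∀ s, Filter.Tendsto (fun n => τ n s) Filter.atTop (nhds (t s)) := by
    rintro (i | i)
    · exact (tendsto_pi_nhds.1 hθl) i
    · exact (tendsto_pi_nhds.1 hθl') i
  have hS : ∀ x ∈ (ofPoints w₀ θ₀).support, ∃ i, θ₀ i = x := fun x hx => by
    obtain ⟨i, -, hi⟩ := Finset.mem_image.1 (support_ofPoints_subset w₀ θ₀ hx)
    exact ⟨i, hi⟩
  have hS' : ∀ x ∈ (ofPoints w₀ θ₀).support, ∃ i, θ₀' i = x := fun x hx => by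
    rw [heq] at hx
    obtain ⟨i, -, hi⟩ := Finset.mem_image.1 (support_ofPoints_subset w₀' θ₀' hx)
    exact ⟨i, hi⟩
  have hcl : ∀ z ∈ centres t, (cluster t z).card ≤ m + 1 := fun z _ => by
    rw [hm]
    exact card_cluster_elim_le θ₀ θ₀' hcard hS hS' z
  obtain ⟨hc1, hc2⟩ := card_centres_elim θ₀ θ₀' hcard hS hS'
  obtain ⟨C, hC, hWC⟩ := exists_wasserstein_le_clusterMoments hΘ t (m := m) (by omega) hcl
  have hev : ∀ᶠ n in Filter.atTop, ∀ s, ‖τ n s - t s‖ ≤ 1 := Filter.eventually_all.2 fun s => by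
    filter_upwards [(hτl s).eventually (Metric.ball_mem_nhds _ one_pos)] with n hn
    rw [← dist_eq_norm]
    exact (Metric.mem_ball.1 hn).le
  -- The sequences are shifted by N, so that all points are within distance 1 of their limits from
  -- the start.
  obtain ⟨N, hN⟩ := Filter.eventually_atTop.1 hev
  have hWA : ∀ n, wasserstein m (G (n + N)) (G' (n + N)) ^ m
      ≤ C * clusterMoments t (τ (n + N)) (σ (n + N)) := fun n => by
    refine hWC _ _ _ _ (hN _ (Nat.le_add_left _ _)) (hτΘ _) (hGm _).2.1 (hGm' _).2.1
      (fun x hx => ?_) (fun x hx => ?_) (hdiff _) (hσ0 _)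
    · obtain ⟨i, -, hi⟩ := Finset.mem_image.1
        (support_ofPoints_subset _ _ (Finsupp.mem_support_iff.2 hx))
      exact ⟨Sum.inl i, hi⟩
    · obtain ⟨i, -, hi⟩ := Finset.mem_image.1
        (support_ofPoints_subset _ _ (Finsupp.mem_support_iff.2 hx))
      exact ⟨Sum.inr i, hi⟩
  -- The strict inequality `hbig` makes the Wasserstein distance positive, so the moments that bound
  -- it are positive and can be divided by.
  have hpos : ∀ n, 0 < clusterMoments t (τ (n + N)) (σ (n + N)) := fun n => by
    have h1 := (mul_nonneg (Nat.cast_nonneg (n + N)) (mmd_nonneg (H := H) _ _)).trans_lt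
      ((hbig (n + N)).trans_le (hWA n))
    exact pos_of_mul_pos_right h1 hC.le
  obtain ⟨φ, hφ, a, ha0, hane, hfi, hlim⟩ := exists_limit_combination hp hA htΘ hcl
    (fun n => τ (n + N)) (fun n => σ (n + N)) (fun n => hτΘ _)
    (fun s => (hτl s).comp (Filter.tendsto_add_atTop_nat N)) (fun n => hσ0 _) hpos
  have hne := hL.combination_ne_zero hk₁k (t := t) (by simp; ring) htΘ hc1 hc2 hcl ha0 hane
  obtain ⟨h, hh⟩ := exists_integral_ne_zero (H := H) hk hH hfi hne
  -- The difference of the integrals of h is at most ‖h‖ MMD, and n · MMD is at most C times the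
  -- moments. The normalised integrals are thus O(1/n), although their limit is nonzero by the
  -- choice of h.
  refine hh (eq_zero_of_tendsto_of_mul_le (B := ‖h‖ * C)
    (hlim (fun x => h x) (measurable_rkhs hk hH h) _ (abs_apply_le hk hH h)) fun n => ?_)
  have h1 := abs_mixInt_sub_le_mmd hk hH hp (hGm (φ n + N)) (hGm' (φ n + N)) h
  rw [hdiff] at h1
  have h2 := hbig (φ n + N)
  have h3 := hWA (φ n)
  have hn : (n : ℝ) ≤ ((φ n + N : ℕ) : ℝ) := by
    exact_mod_cast (hφ.le_apply).trans (Nat.le_add_right _ _)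
  have hmm := mmd_nonneg (H := H) (mixture lam p (G (φ n + N))) (mixture lam p (G' (φ n + N)))
  rw [abs_div, abs_of_pos (hpos _), mul_div_assoc', div_le_iff₀ (hpos _)]
  calc (n : ℝ) * |∑ s, σ (φ n + N) s * ∫ x, h x * p x (τ (φ n + N) s) ∂lam|
      ≤ ((φ n + N : ℕ) : ℝ) * (‖h‖ * mmd H (mixture lam p (G (φ n + N)))
        (mixture lam p (G' (φ n + N)))) := mul_le_mul hn h1 (abs_nonneg _) (Nat.cast_nonneg _)
    _ = ‖h‖ * (((φ n + N : ℕ) : ℝ) * mmd H (mixture lam p (G (φ n + N)))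
        (mixture lam p (G' (φ n + N)))) := by ring
    _ ≤ ‖h‖ * (C * clusterMoments t (τ (φ n + N)) (σ (φ n + N))) :=
        mul_le_mul_of_nonneg_left (h2.le.trans h3) (norm_nonneg _)
    _ = _ := by ring

/-- There are no sequences of mixing measures along which the discrepancy is negligible with respect
to the Wasserstein distance, provided that the limits of the first sequence have enough atoms. -/
theorem false_of_sequences (hk : GoodKernel ker) (hH : HasKernel H ker)
    (hΘ : IsCompact Θ) (hp : IsDensityFamily lam p Θ) (hid : Identifiable lam p Θ k)
    (hk₁k : k₁ ≤ k) (hm : m = 2 * (k - k₁) + 1) (hA : AssumptionA2 lam p Θ m)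
    (hL : LinIndep lam p Θ m k₁ k) {G G' : ℕ → Par q →₀ ℝ} (hG : ∀ n, G n ∈ mixAtMost Θ k)
    (hG' : ∀ n, G' n ∈ mixAtMost Θ k)
    (hbig : ∀ n : ℕ, (n : ℝ) * mmd H (mixture lam p (G n)) (mixture lam p (G' n))
      < wasserstein m (G n) (G' n) ^ m)
    (hlim : ∀ G₀ ∈ mixAtMost Θ k, ∀ φ : ℕ → ℕ, StrictMono φ →
      (∀ F : Par q → ℝ, Continuous F → Filter.Tendsto (fun n => mixInt (G (φ n)) F) Filter.atTop
        (nhds (mixInt G₀ F))) → k₁ ≤ G₀.support.card) : False := by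
  choose w θ hw hw1 hθ hGw using fun n => exists_ofPoints (hG n)
  choose w' θ' hw' hw1' hθ' hGw' using fun n => exists_ofPoints (hG' n)
  have hw1i : ∀ w : Fin k → ℝ, (∀ i, 0 ≤ w i) → ∑ i, w i = 1 →
      w ∈ Set.univ.pi fun _ : Fin k => Set.Icc (0 : ℝ) 1 := fun w h0 h1 i _ =>
    ⟨h0 i, h1 ▸ Finset.single_le_sum (fun j _ => h0 j) (Finset.mem_univ i)⟩
  have hcpt : IsCompact (((Set.univ.pi fun _ : Fin k => Set.Icc (0 : ℝ) 1) ×ˢ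
      (Set.univ.pi fun _ : Fin k => Θ)) ×ˢ ((Set.univ.pi fun _ : Fin k => Set.Icc (0 : ℝ) 1) ×ˢ
      (Set.univ.pi fun _ : Fin k => Θ))) :=
    ((isCompact_univ_pi fun _ => isCompact_Icc).prod (isCompact_univ_pi fun _ => hΘ)).prod
      ((isCompact_univ_pi fun _ => isCompact_Icc).prod (isCompact_univ_pi fun _ => hΘ))
  obtain ⟨⟨⟨w₀, θ₀⟩, ⟨w₀', θ₀'⟩⟩, ⟨⟨hw₀, hθ₀⟩, ⟨hw₀', hθ₀'⟩⟩, φ, hφ, hconv⟩ :=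
    hcpt.tendsto_subseq (x := fun n => ((w n, θ n), (w' n, θ' n))) fun n =>
      ⟨⟨hw1i _ (hw n) (hw1 n), fun i _ => hθ n i⟩, ⟨hw1i _ (hw' n) (hw1' n), fun i _ => hθ' n i⟩⟩
  have hlw : Filter.Tendsto (fun n => w (φ n)) Filter.atTop (nhds w₀) := hconv.fst_nhds.fst_nhds
  have hlθ : Filter.Tendsto (fun n => θ (φ n)) Filter.atTop (nhds θ₀) := hconv.fst_nhds.snd_nhds
  have hlw' : Filter.Tendsto (fun n => w' (φ n)) Filter.atTop (nhds w₀') :=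
    hconv.snd_nhds.fst_nhds
  have hlθ' : Filter.Tendsto (fun n => θ' (φ n)) Filter.atTop (nhds θ₀') :=
    hconv.snd_nhds.snd_nhds
  have hθ₀m : ∀ i, θ₀ i ∈ Θ := fun i => hθ₀ i trivial
  have hθ₀m' : ∀ i, θ₀' i ∈ Θ := fun i => hθ₀' i trivial
  have hs1 : ∀ {w : ℕ → Fin k → ℝ} {w₀ : Fin k → ℝ}, (∀ n, ∑ i, w n i = 1) →
      Filter.Tendsto (fun n => w (φ n)) Filter.atTop (nhds w₀) → ∑ i, w₀ i = 1 := by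
    intro w w₀ h1 h2
    have h3 := tendsto_finsetSum Finset.univ fun i _ => (tendsto_pi_nhds.1 h2) i
    simp only [h1] at h3
    exact tendsto_nhds_unique h3 tendsto_const_nhds
  have hG₀ : ofPoints w₀ θ₀ ∈ mixAtMost Θ k :=
    ofPoints_mem (fun i => (hw₀ i trivial).1) (hs1 hw1 hlw) hθ₀m
  have hG₀' : ofPoints w₀' θ₀' ∈ mixAtMost Θ k :=
    ofPoints_mem (fun i => (hw₀' i trivial).1) (hs1 hw1' hlw') hθ₀m'
  have hle : ∀ n : ℕ, (n : ℝ) ≤ (φ n : ℝ) := fun n => by exact_mod_cast hφ.le_apply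
  -- Equal limits require the cluster analysis. For different limits identifiability suffices, since
  -- the Wasserstein distances stay bounded and the discrepancies are therefore O(1/n).
  by_cases heq : ofPoints w₀ θ₀ = ofPoints w₀' θ₀'
  · refine false_of_common_limit hk hH hΘ hp hk₁k hm hA hL (fun n => hw (φ n))
      (fun n => hw' (φ n)) (fun n => hw1 (φ n)) (fun n => hw1' (φ n)) (fun n => hθ (φ n))
      (fun n => hθ' (φ n)) hθ₀m hθ₀m' hlθ hlθ' heq ?_ fun n => ?_
    · refine hlim _ hG₀ φ hφ fun F hF => ?_
      simp only [hGw]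
      exact tendsto_mixInt_ofPoints hlw hlθ (fun n => hθ (φ n)) hθ₀m hF.continuousOn
    · rw [← hGw, ← hGw']
      exact (mul_le_mul_of_nonneg_right (hle n) (mmd_nonneg _ _)).trans_lt (hbig (φ n))
  · obtain ⟨h, hh⟩ := exists_mixInt_ne (H := H) hk hH hp hid hG₀ hG₀' heq
    obtain ⟨D, hD⟩ := hΘ.isBounded.exists_norm_le
    have hc := continuousOn_testFun (H := H) hk hH hp hA h
    have h1 := (tendsto_mixInt_ofPoints hlw hlθ (fun n => hθ (φ n)) hθ₀m hc).sub
      (tendsto_mixInt_ofPoints hlw' hlθ' (fun n => hθ' (φ n)) hθ₀m' hc)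
    refine hh (sub_eq_zero.1 (eq_zero_of_tendsto_of_mul_le (B := ‖h‖ * (D + D) ^ m) h1
      fun n => ?_))
    rw [← hGw, ← hGw']
    have h2 := abs_mixInt_sub_le_mmd hk hH hp (hG (φ n)) (hG' (φ n)) h
    have h3 := wasserstein_pow_le_diam (l := m) (by omega) (hG (φ n)) (hG' (φ n)) (D := D + D)
      fun a ha b hb => (norm_sub_le a b).trans (add_le_add (hD a ha) (hD b hb))
    calc (n : ℝ) * |mixInt (G (φ n)) (testFun lam p h) - mixInt (G' (φ n)) (testFun lam p h)|
        ≤ (φ n : ℝ) * (‖h‖ * mmd H (mixture lam p (G (φ n))) (mixture lam p (G' (φ n)))) :=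
          mul_le_mul (hle n) h2 (abs_nonneg _) (Nat.cast_nonneg _)
      _ = ‖h‖ * ((φ n : ℝ) * mmd H (mixture lam p (G (φ n))) (mixture lam p (G' (φ n)))) := by ring
      _ ≤ _ := mul_le_mul_of_nonneg_left ((hbig (φ n)).le.trans h3) (norm_nonneg _)

/-- The global inverse bound. -/
theorem exists_inverse_bound (hk : GoodKernel ker) (hH : HasKernel H ker)
    (hΘ : IsCompact Θ) (hp : IsDensityFamily lam p Θ) (hid : Identifiable lam p Θ k)
    (hk1 : 1 ≤ k) (hA : AssumptionA2 lam p Θ (2 * k - 1))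
    (hL : LinIndep lam p Θ (2 * k - 1) 1 k) :
    ∃ C : ℝ, 0 < C ∧ ∀ G ∈ mixAtMost Θ k, ∀ G' ∈ mixAtMost Θ k,
      wasserstein (2 * k - 1) G G' ^ (2 * k - 1)
        ≤ C * mmd H (mixture lam p G) (mixture lam p G') := by
  by_contra hcon
  push Not at hcon
  choose G hG G' hG' hbig using fun n : ℕ => hcon (n + 1) (by positivity)
  refine false_of_sequences hk hH hΘ hp hid hk1 (m := 2 * k - 1) (by omega) hA hL hG hG'
    (fun n => ?_) ?_
  · refine lt_of_le_of_lt ?_ (hbig n)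
    exact mul_le_mul_of_nonneg_right (by linarith) (mmd_nonneg _ _)
  -- For k₁ = 1 the condition on the limit only says that a probability distribution has an atom.
  · intro G₀ hG₀ _ _ _
    rw [Nat.one_le_iff_ne_zero, Ne, Finset.card_eq_zero]
    intro h0
    have := hG₀.2.2.1
    rw [h0] at this
    simp at this

/-- Discrete distributions are determined by the integrals of Lipschitz functions. -/
theorem eq_of_forall_mixInt {G G' : Par q →₀ ℝ}
    (h : ∀ F : Par q → ℝ, (∃ L : ℝ, 0 < L ∧ ∀ a b, |F a - F b| ≤ L * ‖a - b‖) →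
      mixInt G F = mixInt G' F) : G = G' := by
  classical
  ext x
  set S := (G.support ∪ G'.support).erase x with hS
  obtain ⟨ε, hε, hεS⟩ : ∃ ε : ℝ, 0 < ε ∧ ∀ y ∈ S, ε ≤ ‖y - x‖ := by
    have h1 : ∀ᶠ ε in nhdsWithin (0 : ℝ) (Set.Ioi 0), ∀ y ∈ S, ε ≤ ‖y - x‖ :=
      (Filter.eventually_all_finset _).2 fun y hy => nhdsWithin_le_nhds
        (Iic_mem_nhds (norm_pos_iff.2 (sub_ne_zero.2 (Finset.ne_of_mem_erase hy))))
    obtain ⟨ε, h2, h3⟩ := (h1.and self_mem_nhdsWithin).exists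
    exact ⟨ε, h3, h2⟩
  -- A Lipschitz tent at x, so narrow that it vanishes at all other atoms; its integral is the
  -- weight at x.
  set F : Par q → ℝ := fun y => max 0 (1 - ε⁻¹ * ‖y - x‖) with hF
  have hFx : F x = 1 := by simp [hF]
  have hFS : ∀ y ∈ S, F y = 0 := fun y hy => by
    simp only [hF, max_eq_left_iff, sub_nonpos]
    rw [inv_mul_eq_div, one_le_div hε]
    exact hεS y hy
  have hLip : ∀ a b, |F a - F b| ≤ ε⁻¹ * ‖a - b‖ := fun a b => by
    simp only [hF]
    refine (abs_max_sub_max_le_max 0 _ 0 _).trans ?_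
    rw [sub_self, abs_zero, max_eq_right (abs_nonneg _)]
    have h1 : (1 - ε⁻¹ * ‖a - x‖) - (1 - ε⁻¹ * ‖b - x‖) = ε⁻¹ * (‖b - x‖ - ‖a - x‖) := by ring
    rw [h1, abs_mul, abs_of_pos (inv_pos.2 hε)]
    refine mul_le_mul_of_nonneg_left ?_ (inv_pos.2 hε).le
    have h2 := abs_norm_sub_norm_le (b - x) (a - x)
    rwa [sub_sub_sub_cancel_right, norm_sub_rev b a] at h2
  have hval : ∀ G₁ : Par q →₀ ℝ, G₁.support ⊆ G.support ∪ G'.support → mixInt G₁ F = G₁ x := by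
    intro G₁ hG₁
    have h1 : G₁.support ⊆ insert x S := fun y hy => by
      by_cases hyx : y = x
      · exact Finset.mem_insert.2 (Or.inl hyx)
      · exact Finset.mem_insert.2 (Or.inr (Finset.mem_erase.2 ⟨hyx, hG₁ hy⟩))
    rw [mixInt_eq_sum h1, Finset.sum_insert (Finset.notMem_erase _ _), hFx,
      Finset.sum_eq_zero fun y hy => by rw [hFS y hy, mul_zero]]
    ring
  have := h F ⟨ε⁻¹, inv_pos.2 hε, hLip⟩
  rwa [hval G Finset.subset_union_left, hval G' Finset.subset_union_right] at this

/-- The inverse bound near a mixing measure with `k₁` atoms. -/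
theorem exists_local_inverse_bound (hk : GoodKernel ker) (hH : HasKernel H ker)
    (hΘ : IsCompact Θ) (hp : IsDensityFamily lam p Θ) (hid : Identifiable lam p Θ k)
    (hk₁k : k₁ ≤ k) (hm : m = 2 * (k - k₁) + 1) (hA : AssumptionA2 lam p Θ m)
    (hL : LinIndep lam p Θ m k₁ k) {G₀ : Par q →₀ ℝ} (hG₀ : G₀ ∈ mixExactly Θ k₁) :
    ∃ r C : ℝ, 0 < r ∧ 0 < C ∧ ∀ G ∈ mixAtMost Θ k, wasserstein 1 G₀ G < r →
      ∀ G' ∈ mixAtMost Θ k,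
        wasserstein m G G' ^ m ≤ C * mmd H (mixture lam p G) (mixture lam p G') := by
  by_contra hcon
  push Not at hcon
  -- The radius shrinks while the constant grows. The first sequence then tends to G₀ in W_1, so any
  -- limit of it is G₀ and has k₁ atoms.
  choose G hG hGr G' hG' hbig using fun n : ℕ =>
    hcon (1 / ((n : ℝ) + 1)) (n + 1) (by positivity) (by positivity)
  have hG₀k : G₀ ∈ mixAtMost Θ k := ⟨hG₀.1.1, hG₀.1.2.1, hG₀.1.2.2.1, hG₀.1.2.2.2.trans hk₁k⟩
  refine false_of_sequences hk hH hΘ hp hid hk₁k hm hA hL hG hG' (fun n => ?_) ?_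
  · refine lt_of_le_of_lt ?_ (hbig n)
    exact mul_le_mul_of_nonneg_right (by linarith) (mmd_nonneg _ _)
  · intro G₁ hG₁ φ hφ hconv
    have heq : G₀ = G₁ := by
      refine eq_of_forall_mixInt fun F ⟨L, hL0, hLip⟩ => ?_
      have hF : Continuous F := by
        have : LipschitzWith L.toNNReal F := LipschitzWith.of_dist_le_mul fun a b => by
          rw [Real.dist_eq, dist_eq_norm, Real.coe_toNNReal _ hL0.le]
          exact hLip a b
        exact this.continuous
      have h1 : Filter.Tendsto (fun n => mixInt (G (φ n)) F) Filter.atTop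
          (nhds (mixInt G₀ F)) := by
        rw [tendsto_iff_norm_sub_tendsto_zero]
        have h2 : Filter.Tendsto (fun n : ℕ => L * (1 / ((φ n : ℝ) + 1))) Filter.atTop
            (nhds 0) := by
          have := ((tendsto_one_div_add_atTop_nhds_zero_nat (𝕜 := ℝ)).comp
            hφ.tendsto_atTop).const_mul L
          simpa using this
        refine squeeze_zero (fun n => norm_nonneg _) (fun n => ?_) h2
        rw [norm_sub_rev, Real.norm_eq_abs]
        exact (abs_mixInt_sub_le hG₀k (hG (φ n)) hLip hL0).trans
          (mul_le_mul_of_nonneg_left (hGr (φ n)).le hL0.le)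
      exact tendsto_nhds_unique h1 (hconv F hF)
    rw [← heq, hG₀.2]

end inverse


/-! ### Separable subspaces of a Hilbert space -/

section hilbert

variable {H : Type*} [NormedAddCommGroup H] [InnerProductSpace ℝ H]

/-- Orthonormal vectors have mutual distance √2, so the balls of radius 1/2 around them are
disjoint, and a separable space admits only countably many of these. -/
theorem Orthonormal.countable_of_separable [TopologicalSpace.SeparableSpace H] {ι : Type*}
    {v : ι → H} (hv : Orthonormal ℝ v) : Countable ι := by
  have hdist : ∀ i j, i ≠ j → 1 ≤ dist (v i) (v j) := fun i j hij => by
    have h1 : ‖v i - v j‖ ^ 2 = 2 := by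
      rw [norm_sub_sq_real, hv.1 i, hv.1 j, hv.2 hij]
      norm_num
    rw [dist_eq_norm]
    nlinarith [norm_nonneg (v i - v j)]
  have hd : Set.PairwiseDisjoint (Set.univ : Set ι) fun i => Metric.ball (v i) (1 / 2) := by
    intro i _ j _ hij
    refine Metric.ball_disjoint_ball ?_
    have := hdist i j hij
    linarith
  have := hd.countable_of_isOpen (fun i _ => Metric.isOpen_ball)
    (fun i _ => ⟨v i, Metric.mem_ball_self (by norm_num)⟩)
  exact Set.countable_univ_iff.1 this

/-- Cauchy–Schwarz for the projection of y to M, with the norm of the projection written out by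
Parseval. In this form the norm is a countable sum of squares, hence measurable when y comes from a
sample, whereas the norm of y itself need not be. -/
theorem exists_countable_orthonormal [CompleteSpace H] (M : Submodule ℝ H)
    (hMc : IsClosed (M : Set H)) (hM : TopologicalSpace.IsSeparable (M : Set H)) :
    ∃ (w : Set M) (e : w → H), Countable w ∧ Orthonormal ℝ e ∧
      ∀ z ∈ M, ∀ y : H, inner ℝ z y ≤ ‖z‖ * √(∑' j, inner ℝ (e j) y ^ 2) := by
  have : CompleteSpace M := hMc.completeSpace_coe
  have : TopologicalSpace.SeparableSpace M := hM.separableSpace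
  obtain ⟨w, b, -⟩ := exists_hilbertBasis ℝ M
  refine ⟨w, fun j => (b j : H), Orthonormal.countable_of_separable b.orthonormal,
    b.orthonormal.comp_linearIsometry M.subtypeₗᵢ, fun z hz y => ?_⟩
  set y' := M.orthogonalProjectionOnto y with hy'
  have h1 : ∀ u : M, inner ℝ (u : H) y = inner ℝ u y' := fun u => by
    rw [hy', Submodule.inner_orthogonalProjectionOnto_eq_of_mem_left]
  have h2 : ‖y'‖ ^ 2 = ∑' j, inner ℝ (b j : H) y ^ 2 := by
    rw [← real_inner_self_eq_norm_sq, ← b.tsum_inner_mul_inner]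
    refine tsum_congr fun j => ?_
    rw [h1, real_inner_comm, sq]
  rw [← h2, Real.sqrt_sq (norm_nonneg _), h1 ⟨z, hz⟩]
  exact real_inner_le_norm _ _

/-- A minimiser of the distance to `v` is close to any competitor, up to the part of the error that
is visible in the subspace. -/
theorem norm_sub_le_of_minimiser {u u' v : H} {ι : Type*} {e : ι → H}
    (he : ∀ y : H, inner ℝ (u - u') y ≤ ‖u - u'‖ * √(∑' j, inner ℝ (e j) y ^ 2))
    (hmin : ‖u - v‖ ≤ ‖u' - v‖) :
    ‖u - u'‖ ≤ 2 * √(∑' j, inner ℝ (e j) (v - u') ^ 2) := by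
  -- With minimality this gives ‖u - u'‖² ≤ 2⟨u - u', v - u'⟩, and the inner product only sees the
  -- part of v - u' in the subspace.
  have h1 : ‖u - v‖ ^ 2 = ‖u - u'‖ ^ 2 - 2 * inner ℝ (u - u') (v - u') + ‖u' - v‖ ^ 2 := by
    rw [← norm_sub_rev v u', ← norm_sub_sq_real]
    congr 2
    abel
  have h2 := pow_le_pow_left₀ (norm_nonneg _) hmin 2
  have h3 := he (v - u')
  rcases eq_or_ne (u - u') 0 with h0 | h0
  · rw [h0, norm_zero]
    positivity
  · refine le_of_mul_le_mul_left ?_ (norm_pos_iff.2 h0)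
    nlinarith

end hilbert

/-! ### Mean elements -/

section meanElement

variable {X : Type*} [MeasurableSpace X] {ker : X → X → ℝ} {H : Type*} [NormedAddCommGroup H]
  [InnerProductSpace ℝ H] [RKHS ℝ H X ℝ] [CompleteSpace H]

/-- Riesz representation: integration against P is a linear form bounded by ‖ker‖_∞. -/
theorem exists_meanElement (hk : GoodKernel ker) (hH : HasKernel H ker) (P : Measure X)
    [IsProbabilityMeasure P] : ∃ u : H, ∀ h : H, inner ℝ u h = ∫ x, h x ∂P := by
  let L : H →ₗ[ℝ] ℝ :=
    { toFun := fun h => ∫ x, h x ∂P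
      map_add' := fun h h' => by
        simp only [RKHS.coe_add, Pi.add_apply]
        exact integral_add (integrable_rkhs hk hH h P) (integrable_rkhs hk hH h' P)
      map_smul' := fun c h => by
        simp only [RKHS.coe_smul, Pi.smul_apply, smul_eq_mul, RingHom.id_apply]
        exact integral_const_mul _ _ }
  refine ⟨(InnerProductSpace.toDual ℝ H).symm
    (L.mkContinuous (kerNorm ker) fun h => abs_integral_rkhs_le hk hH h P), fun h => ?_⟩
  rw [InnerProductSpace.toDual_symm_apply]
  rfl

/-- The discrepancy is the dual norm of h ↦ ⟨u - v, h⟩; testing with u - v itself gives the lower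
bound. -/
theorem mmd_eq_norm_sub (hk : GoodKernel ker) (hH : HasKernel H ker) (P Q : Measure X)
    [IsProbabilityMeasure P] [IsProbabilityMeasure Q] {u v : H}
    (hu : ∀ h : H, inner ℝ u h = ∫ x, h x ∂P) (hv : ∀ h : H, inner ℝ v h = ∫ x, h x ∂Q) :
    mmd H P Q = ‖u - v‖ := by
  have : Nonempty {h : H // ‖h‖ ≤ 1} := ⟨⟨0, by simp⟩⟩
  refine le_antisymm (ciSup_le fun ⟨h, hh⟩ => ?_) ?_
  · rw [← hu, ← hv, ← inner_sub_left]
    exact (abs_real_inner_le_norm _ _).trans (mul_le_of_le_one_right (norm_nonneg _) hh)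
  · have h1 := abs_integral_sub_le_mmd hk hH P Q (u - v)
    rw [← hu, ← hv, ← inner_sub_left, real_inner_self_eq_norm_sq, abs_of_nonneg (sq_nonneg _),
      sq] at h1
    rcases eq_or_ne (u - v) 0 with h0 | h0
    · rw [h0, norm_zero]
      exact mmd_nonneg _ _
    · exact le_of_mul_le_mul_left h1 (norm_pos_iff.2 h0)

theorem isProbabilityMeasure_empirical {n : ℕ} (hn : 1 ≤ n) (x : Fin n → X) :
    IsProbabilityMeasure (empirical x) := by
  refine ⟨?_⟩
  simp only [empirical, Measure.smul_apply, Measure.finsetSum_apply, measure_univ,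
    Finset.sum_const, Finset.card_univ, Fintype.card_fin, smul_eq_mul, nsmul_eq_mul, mul_one]
  exact ENNReal.inv_mul_cancel (by simpa using Nat.one_le_iff_ne_zero.1 hn) (by simp)

theorem integral_empirical {n : ℕ} (x : Fin n → X) {h : X → ℝ} (hh : Measurable h) :
    ∫ y, h y ∂empirical x = (n : ℝ)⁻¹ * ∑ i, h (x i) := by
  unfold empirical
  rw [integral_smul_measure, integral_finsetSum_measure]
  · simp [integral_dirac' _ _ hh.stronglyMeasurable]
  · intro i _
    exact integrable_dirac' hh.stronglyMeasurable (by simp)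

/-! ### The empirical error -/

/-- The left side is the variance of a mean of n independent copies, that is Var(h)/n, and a
variance is at most the second moment. -/
theorem lintegral_sq_error_le {P : Measure X} [IsProbabilityMeasure P] {n : ℕ} (hn : 1 ≤ n)
    {h : X → ℝ} (hm : Measurable h) {K : ℝ} (hK : ∀ x, |h x| ≤ K) :
    ∫⁻ x, ENNReal.ofReal (((n : ℝ)⁻¹ * ∑ i, h (x i) - ∫ y, h y ∂P) ^ 2)
        ∂Measure.pi (fun _ : Fin n => P)
      ≤ (n : ℝ≥0∞)⁻¹ * ∫⁻ y, ENNReal.ofReal (h y ^ 2) ∂P := by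
  have hn0 : (n : ℝ) ≠ 0 := by
    have := Nat.one_le_iff_ne_zero.1 hn
    exact_mod_cast this
  have hL : MemLp h 2 P := MemLp.of_bound hm.aestronglyMeasurable K
    (Filter.Eventually.of_forall hK)
  have hLi : ∀ i : Fin n, MemLp (fun x : Fin n → X => h (x i)) 2 (Measure.pi fun _ => P) :=
    fun i => hL.comp_measurePreserving (measurePreserving_eval (fun _ => P) i)
  set S : (Fin n → X) → ℝ := ∑ i, fun x => h (x i) with hS
  have hSL : MemLp S 2 (Measure.pi fun _ : Fin n => P) :=
    memLp_finsetSum' _ fun i _ => hLi i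
  have hES : ∫ x, S x ∂Measure.pi (fun _ : Fin n => P) = n * ∫ y, h y ∂P := by
    simp only [hS, Finset.sum_apply]
    rw [integral_finsetSum _ fun i _ => (hLi i).integrable one_le_two]
    have : ∀ i : Fin n, ∫ x : Fin n → X, h (x i) ∂Measure.pi (fun _ => P) = ∫ y, h y ∂P :=
      fun i => integral_comp_eval (μ := fun _ : Fin n => P) hm.aestronglyMeasurable
    simp [this]
  have hvar := ProbabilityTheory.variance_sum_pi (μ := fun _ : Fin n => P) (X := fun _ => h)
    fun _ => hL
  have h1 : ∀ x : Fin n → X, ENNReal.ofReal (((n : ℝ)⁻¹ * ∑ i, h (x i) - ∫ y, h y ∂P) ^ 2)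
      = ENNReal.ofReal ((n : ℝ)⁻¹ ^ 2)
        * ‖S x - ∫ x, S x ∂Measure.pi (fun _ : Fin n => P)‖ₑ ^ 2 := fun x => by
    rw [hES, ← ofReal_norm, ← ENNReal.ofReal_pow (norm_nonneg _),
      ← ENNReal.ofReal_mul (by positivity), Real.norm_eq_abs, sq_abs, ← mul_pow]
    congr 2
    rw [hS, Finset.sum_apply]
    field_simp
  simp only [h1]
  rw [lintegral_const_mul' _ _ (by simp)]
  change _ * ProbabilityTheory.evariance S _ ≤ _
  rw [← hSL.ofReal_variance_eq, hS, hvar, ← ENNReal.ofReal_mul (by positivity)]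
  have h2 : ProbabilityTheory.variance h P ≤ ∫ y, h y ^ 2 ∂P :=
    ProbabilityTheory.variance_le_expectation_sq hm.aestronglyMeasurable
  have h3 : ENNReal.ofReal (∫ y, h y ^ 2 ∂P) = ∫⁻ y, ENNReal.ofReal (h y ^ 2) ∂P :=
    ofReal_integral_eq_lintegral_ofReal hL.integrable_sq
      (Filter.Eventually.of_forall fun y => sq_nonneg _)
  rw [← h3, ← ENNReal.ofReal_natCast, ← ENNReal.ofReal_inv_of_pos (by positivity),
    ← ENNReal.ofReal_mul (by positivity)]
  refine ENNReal.ofReal_le_ofReal ?_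
  rw [Finset.sum_const, Finset.card_univ, Fintype.card_fin, nsmul_eq_mul]
  calc (n : ℝ)⁻¹ ^ 2 * (n * ProbabilityTheory.variance h P)
      = (n : ℝ)⁻¹ * ProbabilityTheory.variance h P := by field_simp
    _ ≤ _ := by gcongr

/-- By the reproducing property e_j(y) = ⟨e_j, ker(·, y)⟩, so Bessel's inequality bounds the sum of
the e_j(y)² by ker(y, y), regardless of the number of vectors. Countability is needed to interchange
sum and integral. -/
theorem lintegral_tsum_sq_error_le (hk : GoodKernel ker) (hH : HasKernel H ker) {P : Measure X}
    [IsProbabilityMeasure P] {n : ℕ} (hn : 1 ≤ n) {ι : Type*} [Countable ι] {e : ι → H}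
    (he : Orthonormal ℝ e) :
    ∫⁻ x, ∑' j, ENNReal.ofReal (((n : ℝ)⁻¹ * ∑ i, e j (x i) - ∫ y, e j y ∂P) ^ 2)
        ∂Measure.pi (fun _ : Fin n => P)
      ≤ (n : ℝ≥0∞)⁻¹ * ENNReal.ofReal (kerNorm ker ^ 2) := by
  have hm := fun j => measurable_rkhs hk hH (e j)
  rw [lintegral_tsum fun j => by
    exact ((((Finset.measurable_sum _ fun i _ => (hm j).comp (measurable_pi_apply i)).const_mul
      _).sub_const _).pow_const 2).ennreal_ofReal.aemeasurable]
  refine (ENNReal.tsum_le_tsum fun j =>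
    lintegral_sq_error_le hn (hm j) (abs_apply_le hk hH (e j))).trans ?_
  rw [ENNReal.tsum_mul_left, ← lintegral_tsum fun j => by
    have := hm j
    fun_prop]
  gcongr
  calc ∫⁻ y, ∑' j, ENNReal.ofReal (e j y ^ 2) ∂P
      ≤ ∫⁻ _, ENNReal.ofReal (kerNorm ker ^ 2) ∂P := lintegral_mono fun y => ?_
    _ = _ := by simp
  have h1 : ∀ j, e j y ^ 2 = ‖inner ℝ (e j) (RKHS.kerFun H y (1 : ℝ))‖ ^ 2 := fun j => by
    rw [real_inner_comm, inner_kerFun_one, Real.norm_eq_abs, sq_abs]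
  simp only [h1]
  rw [← ENNReal.ofReal_tsum_of_nonneg (fun j => sq_nonneg _) (he.inner_products_summable _)]
  exact ENNReal.ofReal_le_ofReal ((he.tsum_inner_products_le _).trans
    (pow_le_pow_left₀ (norm_nonneg _) (norm_kerFun_one_le hk hH y) 2))

end meanElement


/-! ### The risk of minimum distance estimators -/

theorem outerE_le {Ω : Type*} [MeasurableSpace Ω] {μ : Measure Ω} {f g : Ω → ℝ≥0∞}
    (hg : Measurable g) (hfg : ∀ ω, f ω ≤ g ω) : outerE μ f ≤ ∫⁻ ω, g ω ∂μ :=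
  (iInf_le _ g).trans ((iInf_le _ hg).trans (iInf_le _ hfg))

section risk

variable {X : Type*} [MeasurableSpace X] {q : ℕ} {lam : Measure X} {p : X → Par q → ℝ}
  {Θ : Set (Par q)} {k : ℕ} {ker : X → X → ℝ} {H : Type*} [NormedAddCommGroup H]
  [InnerProductSpace ℝ H] [RKHS ℝ H X ℝ] [CompleteSpace H]

/-- The mean elements of the mixtures lie in a separable closed subspace. -/
theorem exists_separable_meanElement (hk : GoodKernel ker) (hH : HasKernel H ker)
    (hp : IsDensityFamily lam p Θ)
    (hc : ∀ h : H, ContinuousOn (testFun lam p h) Θ) :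
    ∃ M : Submodule ℝ H, IsClosed (M : Set H) ∧ TopologicalSpace.IsSeparable (M : Set H) ∧
      ∀ G ∈ mixAtMost Θ k, ∀ u : H, (∀ h : H, inner ℝ u h = ∫ x, h x ∂mixture lam p G) →
        u ∈ M := by
  have hprob : ∀ θ : Θ, IsProbabilityMeasure (component lam p θ) := fun θ => (hp θ θ.2).2.2
  choose μ hμ using fun θ : Θ => exists_meanElement hk hH (component lam p θ)
  obtain ⟨D, hDc, hDd⟩ := TopologicalSpace.exists_countable_dense Θ
  set M := (Submodule.span ℝ (μ '' D)).topologicalClosure with hM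
  have hMc : IsClosed (M : Set H) := Submodule.isClosed_topologicalClosure _
  have : CompleteSpace M := hMc.completeSpace_coe
  refine ⟨M, hMc, ?_, fun G hG u hu => ?_⟩
  · rw [hM, Submodule.topologicalClosure_coe]
    exact ((hDc.image μ).isSeparable.span (R := ℝ)).closure
  -- If h is orthogonal to the mean elements of a dense set of parameters, its test function
  -- vanishes there, hence on all of Θ by continuity, and h is orthogonal to the mean element of
  -- every mixture.
  · rw [← Submodule.orthogonal_orthogonal M, Submodule.mem_orthogonal']
    intro h hh
    rw [hu h, integral_mixture_rkhs hk hH hp hG]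
    have h1 : (fun θ : Θ => testFun lam p h θ) = fun _ => 0 := by
      refine Continuous.ext_on hDd (continuousOn_iff_continuous_domRestrict.1 (hc h))
        continuous_const fun θ hθ => ?_
      simp only [testFun]
      rw [← integral_component hp θ.2, ← hμ]
      exact Submodule.inner_right_of_mem_orthogonal
        (Submodule.le_topologicalClosure _ (Submodule.subset_span (Set.mem_image_of_mem μ hθ))) hh
    exact Finset.sum_eq_zero fun θ hθ => by
      rw [congrFun h1 ⟨θ, hG.1 θ hθ⟩, mul_zero]

/-- The inverse bound reduces the loss to the distance between the mean elements of the fitted and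
the true mixture, which minimality bounds by twice the projected empirical error. The latter has
L²-norm at most ‖ker‖_∞/√n. -/
theorem risk_le_of_wasserstein_le (hk : GoodKernel ker) (hH : HasKernel H ker)
    (hp : IsDensityFamily lam p Θ) (hc : ∀ h : H, ContinuousOn (testFun lam p h) Θ)
    {l n : ℕ} (hn : 1 ≤ n) {Ghat : (Fin n → X) → (Par q →₀ ℝ)}
    (hmin : IsMinMMD H lam p Θ k n Ghat) {G : Par q →₀ ℝ} (hG : G ∈ mixAtMost Θ k) {C : ℝ}
    (hC : 0 ≤ C) (hW : ∀ G' ∈ mixAtMost Θ k,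
      wasserstein l G G' ^ l ≤ C * mmd H (mixture lam p G) (mixture lam p G')) :
    risk lam p l n Ghat G ≤ ENNReal.ofReal (2 * C * (kerNorm ker / √(n : ℝ))) := by
  have hP := isProbabilityMeasure_mixture hp hG
  obtain ⟨M, hMc, hMs, hMm⟩ := exists_separable_meanElement (k := k) hk hH hp hc
  obtain ⟨w, e, hw, he, hle⟩ := exists_countable_orthonormal M hMc hMs
  obtain ⟨u', hu'⟩ := exists_meanElement hk hH (mixture lam p G)
  set err : (Fin n → X) → w → ℝ := fun x j =>
    (n : ℝ)⁻¹ * ∑ i, e j (x i) - ∫ y, e j y ∂mixture lam p G with herr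
  -- This is the measurable majorant that the outer expectation calls for; it does not involve the
  -- estimator.
  set Z : (Fin n → X) → ℝ≥0∞ := fun x => (∑' j, ENNReal.ofReal (err x j ^ 2)) ^ (1 / 2 : ℝ)
    with hZ
  have hZm : Measurable Z := by
    refine (Measurable.tsum fun j => ?_).pow_const _
    exact ((((Finset.measurable_sum _ fun i _ => (measurable_rkhs hk hH (e j)).comp
      (measurable_pi_apply i)).const_mul _).sub_const _).pow_const 2).ennreal_ofReal
  have hdom : ∀ x, ENNReal.ofReal (wasserstein l G (Ghat x) ^ l)
      ≤ ENNReal.ofReal (2 * C) * Z x := by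
    intro x
    obtain ⟨hx, hxmin⟩ := hmin x
    have := isProbabilityMeasure_mixture hp hx
    have := isProbabilityMeasure_empirical hn x
    obtain ⟨u, hu⟩ := exists_meanElement hk hH (mixture lam p (Ghat x))
    obtain ⟨v, hv⟩ := exists_meanElement hk hH (empirical x)
    have h1 := hxmin G hG
    rw [mmd_eq_norm_sub hk hH _ _ hu hv, mmd_eq_norm_sub hk hH _ _ hu' hv] at h1
    have hsub : u - u' ∈ M := M.sub_mem (hMm _ hx u hu) (hMm _ hG u' hu')
    have h2 := norm_sub_le_of_minimiser (hle _ hsub) h1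
    have h3 : ∀ j, inner ℝ (e j) (v - u') = err x j := fun j => by
      rw [real_inner_comm, inner_sub_left, hv, hu',
        integral_empirical x (measurable_rkhs hk hH (e j))]
    have h4 := he.inner_products_summable (v - u')
    simp only [h3, Real.norm_eq_abs, sq_abs] at h2 h4
    have h5 := hW _ hx
    rw [mmd_eq_norm_sub hk hH _ _ hu' hu, norm_sub_rev] at h5
    have h6 : Z x = ENNReal.ofReal (√(∑' j, err x j ^ 2)) := by
      rw [hZ, Real.sqrt_eq_rpow, ← ENNReal.ofReal_rpow_of_nonneg
        (tsum_nonneg fun j => sq_nonneg _) (by norm_num),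
        ENNReal.ofReal_tsum_of_nonneg (fun j => sq_nonneg _) h4]
    rw [h6, ← ENNReal.ofReal_mul (by positivity)]
    refine ENNReal.ofReal_le_ofReal (h5.trans ?_)
    calc C * ‖u - u'‖ ≤ C * (2 * √(∑' j, err x j ^ 2)) := mul_le_mul_of_nonneg_left h2 hC
      _ = _ := by ring
  -- On a probability space the L¹-norm is at most the L²-norm.
  have hEZ : ∫⁻ x, Z x ∂Measure.pi (fun _ : Fin n => mixture lam p G)
      ≤ ENNReal.ofReal (kerNorm ker / √(n : ℝ)) := by
    have h1 := eLpNorm_le_eLpNorm_of_exponent_le (μ := Measure.pi fun _ : Fin n => mixture lam p G)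
      (p := 1) (q := 2) one_le_two hZm.aestronglyMeasurable
    rw [eLpNorm_one_eq_lintegral_enorm, eLpNorm_eq_lintegral_rpow_enorm_toReal (by simp) (by simp)]
      at h1
    simp only [enorm_eq_self] at h1
    refine h1.trans ?_
    have h2 : ∀ x, Z x ^ (2 : ℝ≥0∞).toReal = ∑' j, ENNReal.ofReal (err x j ^ 2) := fun x => by
      rw [hZ, ← ENNReal.rpow_mul]
      norm_num
    simp only [h2]
    have hn0 : (0 : ℝ) < n := by exact_mod_cast hn
    calc (∫⁻ x, ∑' j, ENNReal.ofReal (err x j ^ 2)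
          ∂Measure.pi (fun _ : Fin n => mixture lam p G)) ^ (1 / (2 : ℝ≥0∞).toReal)
        ≤ ((n : ℝ≥0∞)⁻¹ * ENNReal.ofReal (kerNorm ker ^ 2)) ^ (1 / (2 : ℝ≥0∞).toReal) := by
          gcongr
          exact lintegral_tsum_sq_error_le hk hH hn he
      _ = ENNReal.ofReal ((kerNorm ker / √(n : ℝ)) ^ 2) ^ (1 / 2 : ℝ) := by
          rw [← ENNReal.ofReal_natCast, ← ENNReal.ofReal_inv_of_pos hn0,
            ← ENNReal.ofReal_mul (by positivity), div_pow, Real.sq_sqrt hn0.le, inv_mul_eq_div]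
          simp
      _ = _ := by
          rw [ENNReal.ofReal_rpow_of_nonneg (by positivity) (by norm_num), ← Real.sqrt_eq_rpow,
            Real.sqrt_sq (div_nonneg (kerNorm_nonneg _) (Real.sqrt_nonneg _))]
  refine (outerE_le (hZm.const_mul _) hdom).trans ?_
  rw [lintegral_const_mul _ hZm, ENNReal.ofReal_mul (p := 2 * C) (by positivity)]
  exact mul_le_mul_right hEZ _

end risk

end MMDMixture

/-! ### The main theorem: constants that are uniform over the kernels with a given class of test
functions -/

theorem theorem5 {X : Type*} [MeasurableSpace X] {q : ℕ}
    (lam : MeasureTheory.Measure X) (p : X → MMDMixture.Par q → ℝ) (Θ : Set (MMDMixture.Par q))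
    (k : ℕ) (hk : 1 ≤ k) (hΘ : IsCompact Θ)
    (hp : MMDMixture.IsDensityFamily lam p Θ) (hid : MMDMixture.Identifiable lam p Θ k)
    (Φ : Set (Θ → ℝ)) :
    (MMDMixture.AssumptionA2 lam p Θ (2 * k - 1) →
      MMDMixture.LinIndep lam p Θ (2 * k - 1) 1 k →
      ∃ C : ℝ, 0 < C ∧
        ∀ (ker : X → X → ℝ) (H : Type*) [NormedAddCommGroup H] [InnerProductSpace ℝ H]
          [CompleteSpace H] [RKHS ℝ H X ℝ],
          MMDMixture.GoodKernel ker → MMDMixture.HasKernel H ker →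
          MMDMixture.testClass H lam p Θ = Φ →
          ∀ n : ℕ, 1 ≤ n → ∀ Ghat : (Fin n → X) → (MMDMixture.Par q →₀ ℝ),
            MMDMixture.IsMinMMD H lam p Θ k n Ghat →
            (⨆ G ∈ MMDMixture.mixAtMost Θ k, MMDMixture.risk lam p (2 * k - 1) n Ghat G)
              ≤ ENNReal.ofReal (C * (MMDMixture.kerNorm ker / √(n : ℝ)))) ∧
    (∀ k₀ : ℕ, 1 ≤ k₀ → k₀ ≤ k → ∀ d₁ : ℕ, d₁ = k - k₀ + 1 →
      MMDMixture.AssumptionA2 lam p Θ (2 * d₁ - 1) →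
      MMDMixture.LinIndep lam p Θ (2 * d₁ - 1) k₀ k →
      ∀ G₀ ∈ MMDMixture.mixExactly Θ k₀,
      ∃ r C : ℝ, 0 < r ∧ 0 < C ∧
        ∀ (ker : X → X → ℝ) (H : Type*) [NormedAddCommGroup H] [InnerProductSpace ℝ H]
          [CompleteSpace H] [RKHS ℝ H X ℝ],
          MMDMixture.GoodKernel ker → MMDMixture.HasKernel H ker →
          MMDMixture.testClass H lam p Θ = Φ →
          ∀ n : ℕ, 1 ≤ n → ∀ Ghat : (Fin n → X) → (MMDMixture.Par q →₀ ℝ),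
            MMDMixture.IsMinMMD H lam p Θ k n Ghat →
            (⨆ G ∈ {G | G ∈ MMDMixture.mixAtMost Θ k ∧ MMDMixture.wasserstein 1 G₀ G < r},
              MMDMixture.risk lam p (2 * d₁ - 1) n Ghat G)
              ≤ ENNReal.ofReal (C * (MMDMixture.kerNorm ker / √(n : ℝ)))) := by
  open MMDMixture in
  refine ⟨fun hA hL => ?_, fun k₀ _ hk₀k d₁ hd₁ hA hL G₀ hG₀ => ?_⟩
  -- If no kernel has the class Φ, any constant works. Otherwise the negated claim, with the
  -- constant 1, provides one kernel with this class; the constant of its inverse bound serves every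
  -- other such kernel, because the discrepancy between mixtures depends only on Φ.
  · by_contra hcon
    have hcon' := hcon
    push Not at hcon
    obtain ⟨ker₁, H₁, _, _, _, _, hk₁, hH₁, hΦ₁, -⟩ := hcon 1 one_pos
    obtain ⟨C, hC, hW⟩ := exists_inverse_bound hk₁ hH₁ hΘ hp hid hk hA hL
    refine hcon' ⟨2 * C, by positivity, ?_⟩
    intro ker H _ _ _ _ hker hH hΦ n hn Ghat hmin
    refine iSup₂_le fun G hG => risk_le_of_wasserstein_le hker hH hp
      (continuousOn_testFun hker hH hp hA) hn hmin hG hC.le fun G' hG' => ?_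
    exact (hW G hG G' hG').trans (mul_le_mul_of_nonneg_left
      (mmd_mixture_le_of_testClass hk₁ hH₁ hker hH hp (hΦ₁.trans hΦ.symm) hG hG') hC.le)
  · by_contra hcon
    have hcon' := hcon
    push Not at hcon
    obtain ⟨ker₁, H₁, _, _, _, _, hk₁, hH₁, hΦ₁, -⟩ := hcon 1 1 one_pos one_pos
    obtain ⟨r, C, hr, hC, hW⟩ := exists_local_inverse_bound hk₁ hH₁ hΘ hp hid hk₀k
      (m := 2 * d₁ - 1) (by omega) hA hL hG₀
    refine hcon' ⟨r, 2 * C, hr, by positivity, ?_⟩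
    intro ker H _ _ _ _ hker hH hΦ n hn Ghat hmin
    refine iSup₂_le fun G hG => risk_le_of_wasserstein_le hker hH hp
      (continuousOn_testFun hker hH hp hA) hn hmin hG.1 hC.le fun G' hG' => ?_
    exact (hW G hG.1 hG.2 G' hG').trans (mul_le_mul_of_nonneg_left
      (mmd_mixture_le_of_testClass hk₁ hH₁ hker hH hp (hΦ₁.trans hΦ.symm) hG.1 hG') hC.le)
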